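/- **Setting.** Fix a dimension $d\ge 1$ and constants $\sigma,s,\tau_\theta,\kappa_\infty,\kappa_2,\lambda>0$. A parameter $\theta^*\in\mathbb R^d$ is drawn from a prior supported in $\{\|\theta\|_2\le\tau_\theta\}$. Given $\theta^*$, the types $(\mathbf x_i,y_i,c_i)$ of the agents $i=1,\dots,n$ are i.i.d.: $\mathbf x_i$ is centred and $\langle \mathbf x_i,u\rangle$ is sub-Gaussian with variance proxy $\sigma^2/d$ for every unit vector $u$; the covariance matrix satisfies $\|\Sigma w\|_\infty\ge\kappa_\infty\|w\|_\infty$ and $\|\Sigma w\|_2\ge\kappa_2\|w\|_2$ for all $w$; $y_i=\langle\theta^*,\mathbf x_i\rangle+\zeta_i$ with $\zeta_i\sim N(0,s^2)$ independent of $\mathbf x_i$; the privacy cost coefficient $c_i\ge 0$ is drawn from a law depending only on $D_i=(\mathbf x_i,y_i)$. For $j\neq i$, the law of $c_j$ given $D_i$ satisfies $\inf_{D_i}\mathbb P(c_j\le\tau\mid D_i)\ge 1-e^{-\lambda\tau}$ for all $\tau$. The privacy cost functions satisfy $f_i(c,\varepsilon,\gamma)\le c\,F(\varepsilon,\gamma)$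 for $c\ge0,\varepsilon>0,\gamma\ge0$, with $F(\varepsilon,\gamma)=(1+\gamma)\varepsilon^4$. Let $\tau_{\alpha,\beta}$ be the maximum of $\inf\{\tau>0:\mathbb P(\#\{i:c_i\le\tau\}\ge(1-\alpha)n)\ge1-\beta\}$ and $\inf\{\tau>0:\inf_{D_i}\mathbb P(c_j\le\tau\mid D_i)\ge1-\alpha\}$. A threshold strategy with threshold $\tau$ reports $\hat y_i=y_i$ if $c_i\le\tau$ and an arbitrary (measurable) function of the agent's type if $c_i>\tau$. **Mechanism.** Let $\delta\in(\frac14,\frac13)$ and let $c>0$, $C\ge4$, $C_0,C_1,\omega>0$ be constants. Put $\varepsilon=n^{-\delta}$, $\tau_2=n^{(1-3\delta)/2}$, $\alpha=\Theta(n^{-3\delta})$, $\beta=\Theta(n^{-c})$, $0<a_2=O(n^{-4\delta})$, $M_A=\tau_\theta\,C\sigma\sqrt{\log n}$, $\Delta_m=C_0\tau_2\sqrt{d\log m/m}$, $\gamma_m=C_1m^{-\omega}$, $\bar\gamma=\gamma_n+2\gamma_{n/2}$, and $a_1=a_2(M_A+3M_A^2)+\tau_{\alpha,\beta}F(2\varepsilon,\bar\gamma)$.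 The agents report $\hat D_i=(\mathbf x_i,\hat y_i)$ and are partitioned, independently of the data, into two groups $\hat D^0,\hat D^1$ of sizes $\lfloor n/2\rfloor$ and $\lceil n/2\rceil$ (in either order). Clip the responses to $[-\tau_2,\tau_2]$, and on the full data and on each group compute the least squares estimator $\hat\theta=(X^TX)^{-1}X^T\tilde y$ (taken to be $0$ if $X^TX$ is singular). Add independent noise vectors with densities $\propto\exp(-\frac{\varepsilon}{\Delta_n}\|v\|_2)$ (full data) and $\propto\exp(-\frac{\varepsilon}{\Delta_{n/2}}\|v\|_2)$ (each group), and project onto the ball of radius $\tau_\theta$, which gives $\bar\theta^P(\hat D),\bar\theta^P(\hat D^0),\bar\theta^P(\hat D^1)$. Output $\bar\theta^P(\hat D)$ and pay agent $i$ of group $1-b$ $$\pi_i=a_1-a_2(p-2pq+q^2),\quad p=\langle\mathbf x_i,\bar\theta^P(\hat D^b)\rangle,\quad q=\langle\mathbf x_i,\mathbb E[\theta\mid\hat D_i]\rangle,$$ where $\mathbb E[\theta\mid\hat D_i]$ is the posterior mean given one sample equal to $\hat D_i$. The utility of agent $i$ is $u_i=\pi_i-f_i(c_i,2\varepsilon,\bar\gamma)$.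 **Claim.** There are $K,\rho>0$ and $k,N\in\mathbb N$, depending only on the constants above (including those in $\Theta,O$), and not on $n$, the distributions or the functions $f_i$, such that the following holds for all $n\ge N$. 1. (Privacy.) $2\varepsilon\le Kn^{-\delta}$, $\bar\gamma\le Kn^{-\rho}$, and the mechanism is $(2\varepsilon,\bar\gamma)$-random jointly differentially private: $2\varepsilon>0$, $\bar\gamma\in(0,1)$, and for every such partition, every profile of reporting strategies (in particular the truthful one) and every agent $i$, with probability at least $1-\bar\gamma$ over the data sets $D$ and $D'$, where $D'$ replaces the type of $i$ by a fresh independent one (given $\theta^*$), one has for all measurable $S$: $\mathbb P((\bar\theta^P,\pi_{-i})(D)\in S)\le e^{2\varepsilon}\,\mathbb P((\bar\theta^P,\pi_{-i})(D')\in S)$, the probability being over the noise. 2. With probability at least $1-Kn^{-\rho}$ over $\theta^*$ and the types, at least $(1-Kn^{-3\delta})n$ agents have $c_i\le\tau_{\alpha,\beta}$ (and thus report truthfully under the strategies below), and for every profile of threshold strategies with threshold $\tau_{\alpha,\beta}$ and every such partition: - (Equilibrium.) for every $i$ with $c_i\le\tau_{\alpha,\beta}$, no other reporting strategy of $i$ increases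 the conditional expectation of $u_i$ given $(D_i,c_i)$, the others playing this profile, by more than $Kn^{-4\delta}(\log n)^k$; - (Accuracy.) $\mathbb E\|\bar\theta^P(\hat D)-\theta^*\|_2^2\le Kn^{-\delta}(\log n)^k$, the expectation being over the noise; - (Individual rationality.) for every $i$ with $c_i\le\tau_{\alpha,\beta}$, the conditional expectation of $u_i$ given $(D_i,c_i)$ is nonnegative; - (Budget.) $\mathbb E\sum_i\pi_i\le Kn^{1-4\delta}(\log n)^k$, the expectation being over the noise. -/

import Mathlib

open MeasureTheory ProbabilityTheory Set
open scoped NNReal ENNReal Matrix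

noncomputable section

namespace TruthfulRegression

/-! ### The population: prior, covariates, Gaussian responses, privacy cost coefficients -/

/-- The Euclidean space of covariates and of regression parameters. -/
abbrev Vec (d : ℕ) : Type := EuclideanSpace ℝ (Fin d)

/-- A data sample `(x, y)`. -/
abbrev Sample (d : ℕ) : Type := Vec d × ℝ

/-- The type `((x, y), c)` of an agent: data sample and privacy cost coefficient. -/
abbrev AgentType (d : ℕ) : Type := Sample d × ℝ

/-- The distributions describing the Bayesian linear regression game: the prior of the parameter,
the law of the covariates, the standard deviation of the centred Gaussian noise of the responses,
and the conditional law of the privacy cost coefficient given the agent's own data `(x, y)`. -/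
structure Population (d : ℕ) where
  prior : Measure (Vec d)
  covariate : Measure (Vec d)
  noiseSd : ℝ≥0
  cost : Kernel (Sample d) ℝ
  prior_prob : IsProbabilityMeasure prior
  covariate_prob : IsProbabilityMeasure covariate
  cost_markov : IsMarkovKernel cost

attribute [instance] Population.prior_prob Population.covariate_prob Population.cost_markov

namespace Population

variable {d : ℕ} (P : Population d)

/-- Given `θ`, the law of a sample `(x, ⟪θ, x⟫ + ζ)`, where `x` follows the covariate law and
`ζ` is an independent centred Gaussian. -/
def dataKernel : Kernel (Vec d) (Sample d) :=
  ((Kernel.id : Kernel (Vec d) (Vec d)) ×ₖ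
      Kernel.const (Vec d) (P.covariate.prod (gaussianReal 0 (P.noiseSd ^ 2)))).map
    (fun p : Vec d × (Vec d × ℝ) => (p.2.1, inner ℝ p.1 p.2.1 + p.2.2))

instance : IsMarkovKernel P.dataKernel := by
  unfold dataKernel
  exact Kernel.IsMarkovKernel.map _ (by fun_prop)

/-- Given `θ`, the law of an agent's type `((x, y), c)`; the coefficient `c` depends on `θ` and on
the other agents only through the agent's own data. -/
def typeKernel : Kernel (Vec d) (AgentType d) :=
  P.dataKernel ⊗ₖ Kernel.prodMkLeft (Vec d) P.cost

instance : IsMarkovKernel P.typeKernel := by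
  unfold typeKernel
  infer_instance

theorem measurable_pi_typeKernel (n : ℕ) :
    Measurable fun θ : Vec d => Measure.pi fun _ : Fin n => P.typeKernel θ := by
  refine Measurable.measure_of_isPiSystem_of_isProbabilityMeasure generateFrom_pi.symm
    isPiSystem_pi ?_
  rintro _ ⟨s, hs, rfl⟩
  simp only [Measure.pi_pi]
  exact Finset.measurable_fun_prod _ fun i _ => P.typeKernel.measurable_coe (hs i (mem_univ i))

/-- Given `θ`, the types of the `n` agents are independent and identically distributed. -/
def profileKernel (n : ℕ) : Kernel (Vec d) (Fin n → AgentType d) :=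
  ⟨fun θ => Measure.pi fun _ : Fin n => P.typeKernel θ, P.measurable_pi_typeKernel n⟩

instance (n : ℕ) : IsMarkovKernel (P.profileKernel n) :=
  ⟨fun _ => inferInstanceAs (IsProbabilityMeasure (Measure.pi _))⟩

/-- The joint law of the parameter and of the types of the `n` agents. -/
def jointLaw (n : ℕ) : Measure (Vec d × (Fin n → AgentType d)) :=
  P.prior ⊗ₘ P.profileKernel n

/-- The law of the types of `n` agents together with the type of one additional agent: all
`n + 1` types are independent given the parameter, which follows the prior. -/
def neighborLaw (n : ℕ) : Measure ((Fin n → AgentType d) × AgentType d) :=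
  P.prior.bind (P.profileKernel n ×ₖ P.typeKernel)

/-- The posterior law of the parameter given one sample `(x, y)` (Bayes' formula): its density
with respect to the prior is proportional to the Gaussian likelihood of `y`. -/
def posterior (z : Sample d) : Measure (Vec d) :=
  let m := P.prior.withDensity fun θ => gaussianPDF (inner ℝ z.1 θ) (P.noiseSd ^ 2) z.2
  (m univ)⁻¹ • m

/-- The posterior mean of the parameter given one sample. -/
def posteriorMean (z : Sample d) : Vec d := ∫ θ, θ ∂(P.posterior z)

/-- The belief of an agent with data `z` about a profile of types: the parameter is drawn from the
posterior given `z` and, given the parameter, the types are independent. Only the coordinates of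
the other agents are ever used. -/
def belief (n : ℕ) (z : Sample d) : Measure (Fin n → AgentType d) :=
  (P.posterior z).bind (P.profileKernel n)

/-- The law of the cost coefficient of another agent given that one's own data are `z`. -/
def costBelief (z : Sample d) : Measure ℝ :=
  ((P.posterior z).bind P.typeKernel).map Prod.snd

/-- The second moment matrix of the (centred) covariates. -/
def covarianceMatrix : Matrix (Fin d) (Fin d) ℝ :=
  Matrix.of fun j k => ∫ x, x j * x k ∂P.covariate

/-- The standing assumptions on the population:
the parameter lies in the ball of radius `τθ`; the covariates are centred and sub-Gaussian with
variance proxy `σ² / d` in every direction, with covariance matrix bounded below in the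
sup norm and in the Euclidean norm; the response noise has standard deviation `s`; the cost
coefficients are nonnegative; given one agent's data, the cost coefficient of another agent has
an exponential tail of rate `lam`. -/
structure Admissible (σ s τθ κinf κ2 lam : ℝ) : Prop where
  prior_bounded : ∀ᵐ θ ∂P.prior, ‖θ‖ ≤ τθ
  covariate_centred : ∫ x, x ∂P.covariate = 0
  covariate_subGaussian : ∀ u : Vec d, ‖u‖ = 1 →
    HasSubgaussianMGF (fun x : Vec d => inner ℝ x u) (Real.toNNReal (σ ^ 2 / d)) P.covariate
  covariance_sup : ∀ w : Fin d → ℝ, κinf * ‖w‖ ≤ ‖P.covarianceMatrix *ᵥ w‖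
  covariance_two : ∀ w : Fin d → ℝ,
    κ2 * ‖WithLp.toLp 2 w‖ ≤ ‖WithLp.toLp 2 (P.covarianceMatrix *ᵥ w)‖
  noise_sd : (P.noiseSd : ℝ) = s
  cost_nonneg : ∀ z : Sample d, ∀ᵐ c ∂(P.cost z), 0 ≤ c
  cost_tail : ∀ (z : Sample d) (τ : ℝ), 1 - Real.exp (-lam * τ) ≤ (P.costBelief z).real (Iic τ)

/-- The smallest threshold such that, with probability at least `1 - β`, at least a `1 - α`
fraction of the `n` agents have a cost coefficient below it. -/
def threshold₁ (n : ℕ) (α β : ℝ) : ℝ :=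
  sInf {τ : ℝ | 0 < τ ∧ 1 - β ≤ (P.jointLaw n).real
    {w | (1 - α) * n ≤ ({i : Fin n | (w.2 i).2 ≤ τ} : Set (Fin n)).ncard}}

/-- The smallest threshold such that every agent, whatever its own data, believes that the cost
coefficient of another agent is below it with probability at least `1 - α`. -/
def threshold₂ (α : ℝ) : ℝ :=
  sInf {τ : ℝ | 0 < τ ∧ ∀ z : Sample d, 1 - α ≤ (P.costBelief z).real (Iic τ)}

/-- The threshold `τ_{α,β}`. -/
def threshold (n : ℕ) (α β : ℝ) : ℝ := max (P.threshold₁ n α β) (P.threshold₂ α)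

end Population

/-! ### The mechanism -/

section Mechanism

variable {d n : ℕ}

/-- Clipping of a response to the interval `[-τ, τ]`. -/
def clip (τ y : ℝ) : ℝ := Real.sign y * min |y| τ

/-- Projection onto the closed Euclidean ball of radius `τ` centred at the origin. -/
def projBall (τ : ℝ) (v : Vec d) : Vec d := if ‖v‖ ≤ τ then v else (τ / ‖v‖) • v

theorem projBall_isMinOn (τ : ℝ) (hτ : 0 ≤ τ) (v : Vec d) :
    projBall τ v ∈ Metric.closedBall (0 : Vec d) τ ∧
      IsMinOn (fun u => ‖u - v‖ ^ 2) (Metric.closedBall (0 : Vec d) τ) (projBall τ v) := by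
  by_cases h : ‖v‖ ≤ τ
  · refine ⟨by simp [projBall, h], ?_⟩
    intro u _
    simp [projBall, h]
  · have hv : 0 < ‖v‖ := lt_of_le_of_lt hτ (not_le.mp h)
    have h1 : ‖(τ / ‖v‖) • v‖ = τ := by
      rw [norm_smul, Real.norm_of_nonneg (by positivity)]
      field_simp
    refine ⟨by simp [projBall, h, h1], ?_⟩
    intro u hu
    have hu' : ‖u‖ ≤ τ := by simpa using hu
    simp only [projBall, h, if_false, Set.mem_ofPred_eq]
    have h2 : ‖(τ / ‖v‖) • v - v‖ = ‖v‖ - τ := by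
      have : (τ / ‖v‖) • v - v = (τ / ‖v‖ - 1) • v := by rw [sub_smul, one_smul]
      rw [this, norm_smul, Real.norm_of_nonpos]
      · field_simp
        ring
      · rw [sub_nonpos, div_le_one hv]
        exact (not_le.mp h).le
    rw [h2]
    have h3 : ‖v‖ ≤ ‖u‖ + ‖u - v‖ := by
      have := norm_sub_le u (u - v)
      simpa using this
    have h4 := not_le.mp h
    exact pow_le_pow_left₀ (by linarith) (by linarith) 2

/-- The rescaled Brier score. -/
def brier (a₁ a₂ p q : ℝ) : ℝ := a₁ - a₂ * (p - 2 * p * q + q ^ 2)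

/-- The closed-form estimator `(XᵀX)⁻¹ Xᵀ ỹ` computed on the agents in `g`, where the rows of `X` are
their covariates and `ỹ` are their responses clipped at `τ₂`. -/
def estimator (τ₂ : ℝ) (g : Finset (Fin n)) (D : Fin n → Sample d) : Vec d :=
  let X : Matrix g (Fin d) ℝ := Matrix.of fun j k => (D j).1 k
  let y : g → ℝ := fun j => clip τ₂ (D j).2
  WithLp.toLp 2 ((Xᵀ * X)⁻¹ *ᵥ (Xᵀ *ᵥ y))

/-- The probability measure with density proportional to `exp (-b ‖v‖)`. -/
def radialLaplace (d : ℕ) (b : ℝ) : Measure (Vec d) :=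
  let m := (volume : Measure (Vec d)).withDensity fun v => ENNReal.ofReal (Real.exp (-b * ‖v‖))
  (m univ)⁻¹ • m

/-- The parameters of the mechanism: noise level, sensitivities for the full data set and for the
two groups, clipping level, radius of the parameter ball, payment parameters. -/
structure MechParams where
  eps : ℝ
  sens : ℝ
  sensHalf : ℝ
  τ₂ : ℝ
  τθ : ℝ
  a₁ : ℝ
  a₂ : ℝ

/-- The noise vectors `(v, v₀, v₁)`, added to the estimators on the full data set and on the
two groups. -/
abbrev Noise (d : ℕ) : Type := Vec d × Vec d × Vec d

/-- The joint law of the three independent noise vectors. -/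
def MechParams.noiseLaw (m : MechParams) (d : ℕ) : Measure (Noise d) :=
  (radialLaplace d (m.eps / m.sens)).prod
    ((radialLaplace d (m.eps / m.sensHalf)).prod (radialLaplace d (m.eps / m.sensHalf)))

/-- The released private estimator. -/
def privateEstimator (m : MechParams) (D : Fin n → Sample d) (v : Noise d) : Vec d :=
  projBall m.τθ (estimator m.τ₂ Finset.univ D + v.1)

/-- The private estimator used to pay agent `i`; it is computed on the group to which `i` does not
belong. The two groups are `g` and its complement. -/
def peerEstimator (m : MechParams) (g : Finset (Fin n)) (D : Fin n → Sample d) (v : Noise d)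
    (i : Fin n) : Vec d :=
  if i ∈ g then projBall m.τθ (estimator m.τ₂ gᶜ D + v.2.2)
  else projBall m.τθ (estimator m.τ₂ g D + v.2.1)

/-- The payment of agent `i`. For linear regression the derivative of the log-partition function
`a ↦ a² / 2` is the identity, so that the predictions are inner products with the covariate. -/
def payment (P : Population d) (m : MechParams) (g : Finset (Fin n)) (D : Fin n → Sample d)
    (v : Noise d) (i : Fin n) : ℝ :=
  brier m.a₁ m.a₂ (inner ℝ (D i).1 (peerEstimator m g D v i))
    (inner ℝ (D i).1 (P.posteriorMean (D i)))

/-- The output of the mechanism: the private estimator and all the payments. -/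
def mechanism (P : Population d) (m : MechParams) (g : Finset (Fin n)) (D : Fin n → Sample d)
    (v : Noise d) : Vec d × (Fin n → ℝ) :=
  (privateEstimator m D v, fun i => payment P m g D v i)

/-- The group `g` and its complement form a partition into two halves (up to parity). -/
def IsBalanced (g : Finset (Fin n)) : Prop := g.card = n / 2 ∨ gᶜ.card = n / 2

end Mechanism

/-! ### Random joint differential privacy -/

section Privacy

variable {n : ℕ} {X Θ Ω Z : Type*} [MeasurableSpace Θ] [MeasurableSpace Ω] [MeasurableSpace Z]

/-- The part of the output that agent `i` does not observe exclusively: the estimator and the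
payments of all the other agents. -/
def outsideView (i : Fin n) (o : Θ × (Fin n → ℝ)) : Θ × ({j : Fin n // j ≠ i} → ℝ) :=
  (o.1, fun j => o.2 j)

/-- The bound of `ε`-joint differential privacy for agent `i` and a pair of data sets. The
randomness of the mechanism `M` is `ν`. -/
def JDPBound (M : (Fin n → X) → Ω → Θ × (Fin n → ℝ)) (ν : Measure Ω) (ε : ℝ) (i : Fin n)
    (D D' : Fin n → X) : Prop :=
  ∀ S : Set (Θ × ({j : Fin n // j ≠ i} → ℝ)), MeasurableSet S →
    ν {v | outsideView i (M D v) ∈ S} ≤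
      ENNReal.ofReal (Real.exp ε) * ν {v | outsideView i (M D' v) ∈ S}

/-- `(ε, γ)`-random joint differential privacy of the mechanism `M` with internal randomness `ν`:
for every agent `i`, the joint differential privacy bound holds with probability at
least `1 - γ` over the random neighboring data sets `D z` and `D' i z`, with `z` distributed
according to `μ`. -/
def IsRJDP (M : (Fin n → X) → Ω → Θ × (Fin n → ℝ)) (ν : Measure Ω) (μ : Measure Z)
    (D : Z → Fin n → X) (D' : Fin n → Z → Fin n → X) (ε γ : ℝ) : Prop :=
  0 < ε ∧ γ ∈ Ioo (0 : ℝ) 1 ∧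
    ∀ i : Fin n, μ {z | ¬ JDPBound M ν ε i (D z) (D' i z)} ≤ ENNReal.ofReal γ

end Privacy

/-! ### The game -/

section Game

variable {d n : ℕ}

/-- A reporting strategy: an agent can manipulate only the response. -/
abbrev Strategy (d : ℕ) : Type := AgentType d → ℝ

/-- The reported data when the strategy profile `strat` is played at the type profile `t`. -/
def reports (strat : Fin n → Strategy d) (t : Fin n → AgentType d) : Fin n → Sample d :=
  fun i => ((t i).1.1, strat i (t i))

/-- A threshold strategy: the response is reported truthfully if the cost coefficient is at
most `τ`, and arbitrarily otherwise. -/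
def IsThresholdStrategy (τ : ℝ) (r : Strategy d) : Prop :=
  Measurable r ∧ ∀ t : AgentType d, t.2 ≤ τ → r t = t.1.2

/-- The bound on the privacy costs. -/
def costBound (ε γ : ℝ) : ℝ := (1 + γ) * ε ^ 4

/-- The expected utility of agent `i` of type `ti`, given this type, when the profile `strat` is played:
expected payment (over the types of the others and the noise) minus privacy cost. -/
def interimUtility (P : Population d) (m : MechParams) (g : Finset (Fin n)) (privCost : ℝ)
    (strat : Fin n → Strategy d) (i : Fin n) (ti : AgentType d) : ℝ :=
  (∫ p : (Fin n → AgentType d) × Noise d,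
      payment P m g (reports strat (Function.update p.1 i ti)) p.2 i
      ∂((P.belief n ti.1).prod (m.noiseLaw d))) - privCost

/-- The `η`-Bayesian Nash equilibrium condition for agent `i` at type `ti`. -/
def IsApproxBestResponse (P : Population d) (m : MechParams) (g : Finset (Fin n)) (privCost η : ℝ)
    (strat : Fin n → Strategy d) (i : Fin n) (ti : AgentType d) : Prop :=
  ∀ r : Strategy d,
    interimUtility P m g privCost (Function.update strat i r) i ti - η ≤
      interimUtility P m g privCost strat i ti

/-- `MA = τθ τ₁` with `τ₁ = C σ √(log n)`, the maximum of `|a|` on `[-τθ τ₁, τθ τ₁]`. -/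
def boundMA (C σ τθ : ℝ) (n : ℕ) : ℝ := τθ * (C * σ * Real.sqrt (Real.log n))

/-- The clipping level `n ^ ((1 - 3δ) / 2)`. -/
def clipLevel (δ : ℝ) (n : ℕ) : ℝ := (n : ℝ) ^ ((1 - 3 * δ) / 2)

/-- The sensitivity bound for `m` samples, `C₀ κ √(d log m) / √m` with `κ = τ₂`, the maximum of `|a|` on
`[-τ₂, τ₂]`; it is used for `m = n` and for `m = n / 2`. -/
def sensBound (C₀ τ₂ : ℝ) (d : ℕ) (m : ℝ) : ℝ :=
  C₀ * τ₂ * (Real.sqrt (d * Real.log m) / Real.sqrt m)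

/-- The confidence level `γ_n + 2 γ_{n/2}` of the mechanism, where `γ_m = C₁ m ^ (-ω)`. -/
def confidence (C₁ ω : ℝ) (n : ℕ) : ℝ :=
  C₁ * (n : ℝ) ^ (-ω) + 2 * (C₁ * ((n : ℝ) / 2) ^ (-ω))

/-- The parameters of the mechanism for linear regression with `n` agents, threshold `τ` and
payment parameter `a₂`. -/
def linearParams (d : ℕ) (σ τθ δ C C₀ C₁ ω : ℝ) (n : ℕ) (τ a₂ : ℝ) : MechParams where
  eps := (n : ℝ) ^ (-δ)
  sens := sensBound C₀ (clipLevel δ n) d n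
  sensHalf := sensBound C₀ (clipLevel δ n) d ((n : ℝ) / 2)
  τ₂ := clipLevel δ n
  τθ := τθ
  a₁ := a₂ * (boundMA C σ τθ n + 3 * boundMA C σ τθ n ^ 2) +
    τ * costBound (2 * (n : ℝ) ^ (-δ)) (confidence C₁ ω n)
  a₂ := a₂

end Game

end TruthfulRegression

end

noncomputable section

namespace TruthfulRegression

/-! ### Projection and clipping -/

section Deterministic

variable {d n : ℕ}

/-! Everything rests on two facts about least squares. If the Gram matrix of a group `g` is at least
`l * g.card`, then (i) changing one row moves the estimator by at most a constant times `τ₂ * R ^ 3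
/ n`, where `R ≥ 1` bounds the covariates, and (ii) its error is at most the norm of the
residual-weighted sum of covariates, plus `2 * τ₂ * R` per misreport, divided by the Gram bound.
Both come from testing the normal equations against the difference of the two vectors compared
(`estimator_sensitivity`, `estimator_accuracy`). The Gram bound fails with exponentially small
probability: truncate the covariates, which can only lower the Gram matrix, and apply Hoeffding
entrywise (`exists_design_concentration`).

Privacy. What agent `i` does not own is a fixed function of the three estimators plus noise, the
same function for both data sets. Replacing the data of `i` therefore amounts to translating the
noise, and the density `exp (-b ‖v‖)` changes under translation by a factor at most `exp (b ‖a‖)`.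
Only the full estimator and one group estimator move, so the cost is `2 * eps`. With covariates
below `n ^ (1/8)` the sensitivity is `O(τ₂ n ^ (-5/8))`, below the `τ₂ n ^ (-1/2)` provided by the
mechanism. The exceptional events are smaller than any power of `n`, hence smaller than the
confidence level whatever `C₁` and `ω` are (`eventually_isRJDP`).

Equilibrium, rationality, budget. The report of `i` does not influence the estimator used to pay
`i`, and the score equals `a₁ - a₂ * ((q - p) ^ 2 + p - p ^ 2)`, a concave parabola in `q` peaked at
the expected prediction `p`. A deviation gains at most `a₂ * (q - p) ^ 2`; since `p` and `q` are at
most `M_A = O(√(log n))`, this is already `O(n ^ (-4δ) log n)`, with no need to compare `p` and `q`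
statistically. The choice of `a₁` covers the worst score plus the largest privacy cost of a
participant, and summing the payments gives the budget. The threshold enters through `τ = O(log n)`,
a union bound over the exponential cost tails (`threshold_log_bounds`).

Accuracy. Projection onto a ball containing the parameter does not increase the error. The squared
error then has three sources: residuals, at most `n ^ (-δ)` up to constants by Chebyshev; at most `α
* n` misreports, of no larger order up to logarithms; and privacy noise of second moment of order
`(Δ_n / ε) ^ 2`, which is of order `n ^ (-δ) log n` (`sensBound_div_sq`). On the good event no
response is actually clipped, because `δ < 1/3` makes the clipping level a positive power of `n`.
This event involves neither the strategies nor the partition, so the conclusions hold for all of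
them at once. -/

theorem projBall_norm_le {τ : ℝ} (hτ : 0 ≤ τ) (v : Vec d) : ‖projBall τ v‖ ≤ τ := by
  simpa using (projBall_isMinOn τ hτ v).1

theorem projBall_sub_le {τ : ℝ} (hτ : 0 ≤ τ) (v θ : Vec d) (hθ : ‖θ‖ ≤ τ) :
    ‖projBall τ v - θ‖ ≤ ‖v - θ‖ := by
  unfold projBall
  split_ifs with h
  · exact le_rfl
  have h' : τ < ‖v‖ := not_le.mp h
  have hv : 0 < ‖v‖ := lt_of_le_of_lt hτ h'
  set r := ‖v‖ with hr
  set q := τ / r with hq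
  have hqr : q * r = τ := by rw [hq]; field_simp
  have hq0 : 0 ≤ q := by positivity
  have hq1 : q ≤ 1 := by rw [hq, div_le_one hv]; exact h'.le
  have hin : inner ℝ v θ ≤ r * τ :=
    (real_inner_le_norm v θ).trans (mul_le_mul_of_nonneg_left hθ hv.le)
  rw [← abs_of_nonneg (norm_nonneg (q • v - θ)), ← abs_of_nonneg (norm_nonneg (v - θ)), ← sq_le_sq]
  rw [norm_sub_sq_real, norm_sub_sq_real, norm_smul, inner_smul_left, Real.norm_of_nonneg hq0,
    ← hr]
  simp only [conj_trivial]
  -- The product is the difference of the two squared distances; its second factor is nonnegative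
  -- because the inner product is at most `r * τ = q * r ^ 2` and `q ≤ 1`.
  have : 0 ≤ (1 - q) * (r ^ 2 * (1 + q) - 2 * inner ℝ v θ) := by
    refine mul_nonneg (by linarith) ?_
    have : r * τ = q * r ^ 2 := by rw [← hqr]; ring
    nlinarith [sq_nonneg r]
  nlinarith

theorem measurable_projBall (τ : ℝ) : Measurable (projBall τ : Vec d → Vec d) := by
  unfold projBall
  refine Measurable.ite (measurableSet_le (by fun_prop) measurable_const) measurable_id ?_
  exact (measurable_const.div measurable_norm).smul measurable_id

theorem abs_clip_le {τ : ℝ} (hτ : 0 ≤ τ) (y : ℝ) : |clip τ y| ≤ τ := by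
  unfold clip
  rw [abs_mul, abs_of_nonneg (le_min (abs_nonneg y) hτ)]
  have h1 : |Real.sign y| ≤ 1 := by
    rcases Real.sign_apply_eq y with h | h | h <;> rw [h] <;> norm_num
  calc |Real.sign y| * min |y| τ ≤ 1 * min |y| τ :=
        mul_le_mul_of_nonneg_right h1 (le_min (abs_nonneg y) hτ)
    _ ≤ τ := by rw [one_mul]; exact min_le_right _ _

theorem clip_eq_self {τ y : ℝ} (h : |y| ≤ τ) : clip τ y = y := by
  unfold clip
  rw [min_eq_left h]
  rcases lt_trichotomy y 0 with hy | hy | hy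
  · simp [Real.sign_of_neg hy, abs_of_neg hy]
  · simp [hy]
  · simp [Real.sign_of_pos hy, abs_of_pos hy]

theorem measurable_clip (τ : ℝ) : Measurable (clip τ) := by
  unfold clip
  refine Measurable.mul ?_ (by fun_prop)
  unfold Real.sign
  exact Measurable.ite measurableSet_Iio measurable_const
    (Measurable.ite measurableSet_Ioi measurable_const measurable_const)

/-! ### The least squares estimator -/

/-- The second moment matrix of the covariates of the agents in `g` is at least `l`. -/
def DesignBound (g : Finset (Fin n)) (x : Fin n → Vec d) (l : ℝ) : Prop :=
  ∀ w : Vec d, l * ‖w‖ ^ 2 ≤ ∑ j ∈ g, inner ℝ (x j) w ^ 2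

/-- A positive design bound makes the Gram matrix injective, so the totalised matrix inverse is a
genuine one. Later arguments about the estimator use only this weak form, tested against a
well-chosen `w`. -/
theorem normal_equations (τ : ℝ) (g : Finset (Fin n)) (D : Fin n → Sample d) {l : ℝ} (hl : 0 < l)
    (h : DesignBound g (fun j => (D j).1) l) (w : Vec d) :
    ∑ j ∈ g, inner ℝ (D j).1 (estimator τ g D) * inner ℝ (D j).1 w =
      ∑ j ∈ g, clip τ (D j).2 * inner ℝ (D j).1 w := by
  set X : Matrix g (Fin d) ℝ := Matrix.of fun j k => (D j).1 k with hX
  set y : g → ℝ := fun j => clip τ (D j).2 with hy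
  have hXv : ∀ v : Vec d, ∀ j : g, (X *ᵥ v.ofLp) j = inner ℝ (D j).1 v := by
    intro v j
    simp [Matrix.mulVec, dotProduct, hX, PiLp.inner_apply, mul_comm]
  have hunit : IsUnit (Xᵀ * X) := by
    rw [← Matrix.mulVec_injective_iff_isUnit]
    refine (injective_iff_map_eq_zero (Xᵀ * X).mulVecLin).2 fun v hv => ?_
    have hv' : (Xᵀ * X) *ᵥ v = 0 := hv
    have h0 : (X *ᵥ v) ⬝ᵥ (X *ᵥ v) = 0 := by
      have h00 : (X *ᵥ v) ⬝ᵥ (X *ᵥ v) = v ⬝ᵥ (Xᵀ *ᵥ (X *ᵥ v)) := by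
        rw [Matrix.dotProduct_mulVec v, Matrix.vecMul_transpose]
      rw [h00, Matrix.mulVec_mulVec, hv', dotProduct_zero]
    have h1 := h (WithLp.toLp 2 v)
    have h2 : ∑ j ∈ g, inner ℝ (D j).1 (WithLp.toLp 2 v) ^ 2 = 0 := by
      rw [← h0, ← Finset.sum_coe_sort g, dotProduct]
      refine Finset.sum_congr rfl fun j _ => ?_
      rw [← hXv (WithLp.toLp 2 v) j]
      simp [sq]
    simp only [h2] at h1
    have h3 : ‖WithLp.toLp 2 v‖ ^ 2 ≤ 0 := by nlinarith [sq_nonneg ‖WithLp.toLp 2 v‖]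
    have h4 : WithLp.toLp 2 v = 0 := by
      rw [← norm_eq_zero]; exact pow_eq_zero_iff (two_ne_zero) |>.1 (le_antisymm h3 (sq_nonneg _))
    simpa using congrArg WithLp.ofLp h4
  have hdet : IsUnit (Xᵀ * X).det := (Matrix.isUnit_iff_isUnit_det _).1 hunit
  have hest : estimator τ g D = WithLp.toLp 2 ((Xᵀ * X)⁻¹ *ᵥ (Xᵀ *ᵥ y)) := rfl
  have hne : (Xᵀ * X) *ᵥ (estimator τ g D).ofLp = Xᵀ *ᵥ y := by
    rw [hest]
    simp only [Matrix.mulVec_mulVec]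
    rw [← Matrix.mul_assoc, Matrix.mul_nonsing_inv _ hdet, Matrix.one_mul]
  have h5 := congrArg (fun u => w.ofLp ⬝ᵥ u) hne
  simp only [← Matrix.mulVec_mulVec, Matrix.dotProduct_mulVec, Matrix.vecMul_transpose] at h5
  rw [← Matrix.dotProduct_mulVec] at h5
  simp only [dotProduct, hXv, hy] at h5
  rw [← Finset.sum_coe_sort g, ← Finset.sum_coe_sort g]
  simpa [mul_comm] using h5

/-- Test the normal equations against the estimator itself: the left side is quadratic in its norm
by the design bound, the right side linear. -/
theorem estimator_norm_le {τ R l : ℝ} (hτ : 0 ≤ τ) (hR : 0 ≤ R) (hl : 0 < l) (g : Finset (Fin n))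
    (D : Fin n → Sample d) (h : DesignBound g (fun j => (D j).1) l)
    (hx : ∀ j ∈ g, ‖(D j).1‖ ≤ R) :
    ‖estimator τ g D‖ ≤ g.card * (τ * R) / l := by
  set u := estimator τ g D
  have h1 := h u
  have h2 := normal_equations τ g D hl h u
  have h3 : ∑ j ∈ g, clip τ (D j).2 * inner ℝ (D j).1 u ≤ g.card • (τ * R * ‖u‖) := by
    refine Finset.sum_le_card_nsmul _ _ _ fun j hj => ?_
    refine (le_abs_self _).trans ?_
    rw [abs_mul, mul_assoc]
    exact mul_le_mul (abs_clip_le hτ _) ((abs_real_inner_le_norm _ _).trans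
      (mul_le_mul_of_nonneg_right (hx j hj) (norm_nonneg _))) (abs_nonneg _) hτ
  rw [nsmul_eq_mul] at h3
  have h4 : l * ‖u‖ ^ 2 ≤ g.card * (τ * R * ‖u‖) := by
    refine h1.trans (le_trans (le_of_eq ?_) h3)
    rw [← h2]
    exact Finset.sum_congr rfl fun j _ => sq _
  rw [le_div_iff₀ hl]
  rcases (norm_nonneg u).eq_or_lt with h0 | h0
  · rw [← h0]; simp; positivity
  · nlinarith

/-- Sensitivity of the least squares estimator to the data of one agent. -/
theorem estimator_sensitivity {τ R l : ℝ} (hτ : 0 ≤ τ) (hR : 0 ≤ R) (hl : 0 < l)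
    (hl' : R ^ 2 ≤ l / 2) (g : Finset (Fin n)) (D D' : Fin n → Sample d) (i : Fin n)
    (hD : ∀ j, j ≠ i → D' j = D j)
    (h : DesignBound g (fun j => (D j).1) l)
    (hx : ∀ j, ‖(D j).1‖ ≤ R) (hx' : ‖(D' i).1‖ ≤ R) :
    ‖estimator τ g D' - estimator τ g D‖ ≤ 4 * R * (τ + R * (g.card * (τ * R) / l)) / l := by
  have hl2 : 0 < l / 2 := by linarith
  -- Losing the row of `i` lowers the quadratic form by at most `R ^ 2 * ‖w‖ ^ 2`, at most half of
  -- the design bound.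
  have hdes' : DesignBound g (fun j => (D' j).1) (l / 2) := by
    intro w
    have h1 := h w
    have h2 : ∑ j ∈ g, inner ℝ (D j).1 w ^ 2 ≤
        ∑ j ∈ g, inner ℝ (D' j).1 w ^ 2 + inner ℝ (D i).1 w ^ 2 := by
      calc ∑ j ∈ g, inner ℝ (D j).1 w ^ 2
          ≤ ∑ j ∈ g, (inner ℝ (D' j).1 w ^ 2 + if j = i then inner ℝ (D i).1 w ^ 2 else 0) := by
            refine Finset.sum_le_sum fun j _ => ?_
            by_cases hj : j = i
            · subst hj; simp; positivity
            · simp [hj, hD j hj]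
        _ ≤ _ := by
            rw [Finset.sum_add_distrib, Finset.sum_ite_eq']
            gcongr
            split_ifs
            · exact le_rfl
            · positivity
    have h3 : inner ℝ (D i).1 w ^ 2 ≤ l / 2 * ‖w‖ ^ 2 := by
      have := abs_real_inner_le_norm (D i).1 w
      calc inner ℝ (D i).1 w ^ 2 = |inner ℝ (D i).1 w| ^ 2 := (sq_abs _).symm
        _ ≤ (R * ‖w‖) ^ 2 := by
            gcongr; exact this.trans (mul_le_mul_of_nonneg_right (hx i) (norm_nonneg _))
        _ = R ^ 2 * ‖w‖ ^ 2 := by ring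
        _ ≤ _ := by gcongr
    simp only at h1 h2 ⊢
    linarith
  set a := estimator τ g D with ha
  set a' := estimator τ g D' with ha'
  set u := a' - a with hu
  have hna : ‖a‖ ≤ g.card * (τ * R) / l := estimator_norm_le hτ hR hl g D h fun j _ => hx j
  set B := (g.card : ℝ) * (τ * R) / l
  have hB : 0 ≤ B := (norm_nonneg _).trans hna
  have e1 := normal_equations τ g D hl h u
  have e2 := normal_equations τ g D' hl2 hdes' u
  have e3 := hdes' u
  have key : ∀ x : Vec d, ‖x‖ ≤ R → ∀ y : ℝ,
      |(clip τ y - inner ℝ x a) * inner ℝ x u| ≤ (τ + R * B) * (R * ‖u‖) := by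
    intro x hxR y
    rw [abs_mul]
    refine mul_le_mul ?_ ((abs_real_inner_le_norm _ _).trans
      (mul_le_mul_of_nonneg_right hxR (norm_nonneg _))) (abs_nonneg _) (by positivity)
    refine (abs_sub _ _).trans (add_le_add (abs_clip_le hτ y) ?_)
    exact (abs_real_inner_le_norm _ _).trans (mul_le_mul hxR hna (norm_nonneg _) hR)
  -- The subtracted sum of fitted residuals vanishes by the normal equations for `D`. Subtracting it
  -- termwise makes every summand with `j ≠ i` cancel, so only two bounded terms remain.
  have e4 : ∑ j ∈ g, inner ℝ (D' j).1 u ^ 2 =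
      ∑ j ∈ g, ((clip τ (D' j).2 - inner ℝ (D' j).1 a) * inner ℝ (D' j).1 u -
        (clip τ (D j).2 - inner ℝ (D j).1 a) * inner ℝ (D j).1 u) := by
    have : ∀ j, inner ℝ (D' j).1 u ^ 2 =
        inner ℝ (D' j).1 a' * inner ℝ (D' j).1 u - inner ℝ (D' j).1 a * inner ℝ (D' j).1 u := by
      intro j
      rw [← sub_mul, ← inner_sub_right, ← hu, sq]
    simp only [this, sub_mul, Finset.sum_sub_distrib]
    linarith
  have e5 : ∑ j ∈ g, ((clip τ (D' j).2 - inner ℝ (D' j).1 a) * inner ℝ (D' j).1 u -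
        (clip τ (D j).2 - inner ℝ (D j).1 a) * inner ℝ (D j).1 u) ≤
      2 * ((τ + R * B) * (R * ‖u‖)) := by
    have hpos : 0 ≤ 2 * ((τ + R * B) * (R * ‖u‖)) := by positivity
    calc _ ≤ ∑ j ∈ g, if j = i then 2 * ((τ + R * B) * (R * ‖u‖)) else 0 := by
          refine Finset.sum_le_sum fun j _ => ?_
          by_cases hj : j = i
          · subst hj
            have k1 := abs_le.1 (key (D j).1 (hx j) (D j).2)
            have k2 := abs_le.1 (key (D' j).1 hx' (D' j).2)
            simp only [if_true]
            linarith [k1.1, k2.2]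
          · simp [hj, hD j hj]
      _ ≤ _ := by
          rw [Finset.sum_ite_eq']
          split_ifs
          · exact le_rfl
          · exact hpos
  have e6 : l / 2 * ‖u‖ ^ 2 ≤ 2 * ((τ + R * B) * (R * ‖u‖)) := e3.trans (e4.le.trans e5)
  rw [le_div_iff₀ hl]
  rcases (norm_nonneg u).eq_or_lt with h0 | h0
  · rw [← h0]; simp; positivity
  · nlinarith

/-- Accuracy of the least squares estimator when all but `b` of the responses are truthful. -/
theorem estimator_accuracy {τ R l b : ℝ} (hτ : 0 ≤ τ) (hR : 0 ≤ R) (hl : 0 < l)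
    (g : Finset (Fin n)) (x : Fin n → Vec d) (y yhat : Fin n → ℝ) (θ : Vec d)
    (h : DesignBound g x l) (hx : ∀ j, ‖x j‖ ≤ R) (hy : ∀ j, |y j| ≤ τ)
    (hb : ((g.filter fun j => yhat j ≠ y j).card : ℝ) ≤ b) :
    ‖estimator τ g (fun j => (x j, yhat j)) - θ‖ ≤
      (‖∑ j ∈ g, (y j - inner ℝ θ (x j)) • x j‖ + b * (2 * τ * R)) / l := by
  set a := estimator τ g (fun j => (x j, yhat j))
  set u := a - θ with hu
  have e1 := normal_equations τ g (fun j => (x j, yhat j)) hl h u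
  simp only at e1
  -- The error is split into the true residuals and the effect of misreports; a truthful response
  -- contributes nothing to the second sum since clipping leaves it unchanged.
  have e2 : ∑ j ∈ g, inner ℝ (x j) u ^ 2 =
      inner ℝ (∑ j ∈ g, (y j - inner ℝ θ (x j)) • x j) u +
        ∑ j ∈ g, (clip τ (yhat j) - y j) * inner ℝ (x j) u := by
    rw [sum_inner, ← Finset.sum_add_distrib]
    have : ∀ j, inner ℝ (x j) u ^ 2 =
        inner ℝ (x j) a * inner ℝ (x j) u - inner ℝ (x j) θ * inner ℝ (x j) u := by
      intro j
      rw [← sub_mul, ← inner_sub_right, ← hu, sq]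
    simp only [this, Finset.sum_sub_distrib]
    rw [show ∑ j ∈ g, inner ℝ (x j) a * inner ℝ (x j) u =
      ∑ j ∈ g, clip τ (yhat j) * inner ℝ (x j) u from e1, ← Finset.sum_sub_distrib]
    refine Finset.sum_congr rfl fun j _ => ?_
    rw [inner_smul_left, real_inner_comm θ (x j)]
    simp only [conj_trivial]
    ring
  have e3 : ∑ j ∈ g, (clip τ (yhat j) - y j) * inner ℝ (x j) u ≤ b * (2 * τ * R * ‖u‖) := by
    calc _ ≤ ∑ j ∈ g, if yhat j ≠ y j then 2 * τ * R * ‖u‖ else 0 := by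
          refine Finset.sum_le_sum fun j _ => ?_
          split_ifs with hj
          · refine (le_abs_self _).trans ?_
            rw [abs_mul, mul_assoc]
            refine mul_le_mul ?_ ((abs_real_inner_le_norm _ _).trans
              (mul_le_mul_of_nonneg_right (hx j) (norm_nonneg _))) (abs_nonneg _) (by positivity)
            exact (abs_sub _ _).trans (by linarith [abs_clip_le hτ (yhat j), hy j])
          · rw [not_not] at hj
            rw [hj, clip_eq_self (hy j)]
            simp
      _ = ((g.filter fun j => yhat j ≠ y j).card : ℝ) * (2 * τ * R * ‖u‖) := by
          rw [← Finset.sum_filter, Finset.sum_const, nsmul_eq_mul]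
      _ ≤ _ := mul_le_mul_of_nonneg_right hb (by positivity)
  have e4 := h u
  have e5 := real_inner_le_norm (∑ j ∈ g, (y j - inner ℝ θ (x j)) • x j) u
  have hb0 : 0 ≤ b := (Nat.cast_nonneg _).trans hb
  rw [le_div_iff₀ hl]
  set Z := ‖∑ j ∈ g, (y j - inner ℝ θ (x j)) • x j‖
  have e6 : l * ‖u‖ ^ 2 ≤ (Z + b * (2 * τ * R)) * ‖u‖ := by
    rw [add_mul]
    linarith
  have hZ : 0 ≤ Z := norm_nonneg _
  rcases (norm_nonneg u).eq_or_lt with h0 | h0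
  · rw [← h0]; simp; positivity
  · nlinarith

theorem measurable_estimator {Ω : Type*} [MeasurableSpace Ω] (τ : ℝ) (g : Finset (Fin n))
    (D : Ω → Fin n → Sample d) (hD : ∀ j, Measurable fun ω => D ω j) :
    Measurable fun ω => estimator τ g (D ω) := by
  have hX : ∀ (j : g) (k : Fin d), Measurable fun ω => (D ω j).1 k := fun j k => by
    have := hD j
    fun_prop
  have hy : ∀ j : g, Measurable fun ω => clip τ (D ω j).2 := fun j =>
    (measurable_clip τ).comp (measurable_snd.comp (hD j))
  have hM : ∀ a b : Fin d, Measurable fun ω =>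
      ((Matrix.of fun (j : g) k => (D ω j).1 k)ᵀ * (Matrix.of fun (j : g) k => (D ω j).1 k)) a b := by
    intro a b
    simp only [Matrix.mul_apply, Matrix.transpose_apply, Matrix.of_apply]
    exact Finset.measurable_fun_sum _ fun j _ => (hX j a).mul (hX j b)
  have hMM : Measurable fun ω => fun a b : Fin d =>
      ((Matrix.of fun (j : g) k => (D ω j).1 k)ᵀ * (Matrix.of fun (j : g) k => (D ω j).1 k)) a b :=
    measurable_pi_lambda _ fun a => measurable_pi_lambda _ fun b => hM a b
  have hinv : ∀ a b : Fin d, Measurable fun ω =>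
      ((Matrix.of fun (j : g) k => (D ω j).1 k)ᵀ * (Matrix.of fun (j : g) k => (D ω j).1 k))⁻¹
        a b := by
    intro a b
    have hof : Continuous fun M : Fin d → Fin d → ℝ => (Matrix.of M : Matrix (Fin d) (Fin d) ℝ) :=
      continuous_id
    have hdet : Measurable fun M : Fin d → Fin d → ℝ => (Matrix.of M).det :=
      hof.matrix_det.measurable
    have hadj : Measurable fun M : Fin d → Fin d → ℝ => (Matrix.of M).adjugate a b :=
      (hof.matrix_adjugate.matrix_elem a b).measurable
    -- Adjugate times the total inverse of the determinant: this is measurable also across singular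
    -- matrices, where the value is zero.
    simp only [Matrix.inv_def, Ring.inverse_eq_inv', Matrix.smul_apply, smul_eq_mul]
    exact ((hdet.comp hMM).inv).mul (hadj.comp hMM)
  unfold estimator
  refine (WithLp.measurable_toLp 2 _).comp (measurable_pi_lambda _ fun a => ?_)
  simp only [Matrix.mulVec, dotProduct, Matrix.transpose_apply, Matrix.of_apply]
  exact Finset.measurable_fun_sum _ fun b _ => (hinv a b).mul
    (Finset.measurable_fun_sum _ fun j _ => (hX j b).mul (hy j))

end Deterministic

/-! ### The radial Laplace distribution -/

section Noise

variable {d n : ℕ}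

/-- Polar coordinates reduce this to a Gamma integral; `1 ≤ d` makes the space nontrivial, as polar
coordinates require. -/
theorem integrable_exp_neg_mul_norm (hd : 1 ≤ d) {b : ℝ} (hb : 0 < b) :
    Integrable fun v : Vec d => Real.exp (-b * ‖v‖) := by
  have : Nonempty (Fin d) := ⟨⟨0, hd⟩⟩
  have : Nontrivial (Vec d) := inferInstance
  rw [integrable_fun_norm_addHaar volume (f := fun r => Real.exp (-b * r))]
  have h := integrableOn_rpow_mul_exp_neg_mul_rpow (s := ((Module.finrank ℝ (Vec d) - 1 : ℕ) : ℝ))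
    (p := 1) (by have : (0 : ℝ) ≤ ((Module.finrank ℝ (Vec d) - 1 : ℕ) : ℝ) := Nat.cast_nonneg _
                 linarith) zero_lt_one hb
  refine h.congr_fun (fun y _ => ?_) measurableSet_Ioi
  simp

theorem integral_exp_neg_mul_norm_pos (hd : 1 ≤ d) {b : ℝ} (hb : 0 < b) :
    0 < ∫ v : Vec d, Real.exp (-b * ‖v‖) :=
  integral_exp_pos (integrable_exp_neg_mul_norm hd hb)

theorem lintegral_exp_neg_mul_norm (hd : 1 ≤ d) {b : ℝ} (hb : 0 < b) :
    ∫⁻ v : Vec d, ENNReal.ofReal (Real.exp (-b * ‖v‖)) =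
      ENNReal.ofReal (∫ v : Vec d, Real.exp (-b * ‖v‖)) :=
  (ofReal_integral_eq_lintegral_ofReal (integrable_exp_neg_mul_norm hd hb)
    (.of_forall fun _ => (Real.exp_pos _).le)).symm

theorem isProbabilityMeasure_radialLaplace (hd : 1 ≤ d) {b : ℝ} (hb : 0 < b) :
    IsProbabilityMeasure (radialLaplace d b) := by
  constructor
  simp only [radialLaplace, Measure.smul_apply, smul_eq_mul, withDensity_apply _ MeasurableSet.univ,
    Measure.restrict_univ, lintegral_exp_neg_mul_norm hd hb]
  exact ENNReal.inv_mul_cancel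
    (by simpa using integral_exp_neg_mul_norm_pos hd hb) ENNReal.ofReal_ne_top

/-- Translation invariance of Lebesgue measure and the triangle inequality for the exponent. This is
the one place where the shape of the noise density produces privacy. -/
theorem map_add_radialLaplace_le {b : ℝ} (hb : 0 ≤ b) (a : Vec d) :
    (radialLaplace d b).map (· + a) ≤ ENNReal.ofReal (Real.exp (b * ‖a‖)) • radialLaplace d b := by
  refine Measure.le_iff.2 fun S hS => ?_
  have hpre : MeasurableSet ((· + a) ⁻¹' S) := (measurable_add_const a) hS
  rw [Measure.map_apply (measurable_add_const a) hS]
  simp only [radialLaplace, Measure.smul_apply, smul_eq_mul, withDensity_apply _ hS,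
    withDensity_apply _ hpre]
  rw [mul_left_comm]
  gcongr
  rw [← lintegral_indicator hpre, ← lintegral_indicator hS,
    ← lintegral_const_mul _ (Measurable.indicator (by fun_prop) hS),
    ← lintegral_add_right_eq_self (fun v => ENNReal.ofReal (Real.exp (b * ‖a‖)) *
      S.indicator (fun v => ENNReal.ofReal (Real.exp (-b * ‖v‖))) v) a]
  refine lintegral_mono fun v => ?_
  by_cases hv : v + a ∈ S
  · have hv' : v ∈ (· + a) ⁻¹' S := hv
    simp only [indicator_of_mem hv, indicator_of_mem hv']
    rw [← ENNReal.ofReal_mul (Real.exp_pos _).le, ← Real.exp_add]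
    refine ENNReal.ofReal_le_ofReal (Real.exp_le_exp.2 ?_)
    nlinarith [norm_add_le v a]
  · have hv' : v ∉ (· + a) ⁻¹' S := hv
    simp [indicator_of_notMem hv']

/-- Half of the exponential decay absorbs the square, since `t ^ 2 / 2 ≤ exp t` at `t = b ‖v‖ / 2`
yields the factor `8 / b ^ 2`. The other half is the density rescaled by `1 / 2`, whose mass is `2 ^
d` times the normalisation. -/
theorem radialLaplace_second_moment (hd : 1 ≤ d) {b : ℝ} (hb : 0 < b) :
    Integrable (fun v : Vec d => ‖v‖ ^ 2) (radialLaplace d b) ∧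
      ∫ v, ‖v‖ ^ 2 ∂(radialLaplace d b) ≤ 8 * 2 ^ d / b ^ 2 := by
  have hZ := integral_exp_neg_mul_norm_pos hd hb
  have hpt : ∀ v : Vec d, Real.exp (-b * ‖v‖) * ‖v‖ ^ 2 ≤
      8 / b ^ 2 * Real.exp (-b * ‖(2⁻¹ : ℝ) • v‖) := by
    intro v
    have h1 : (b * ‖v‖ / 2) ^ 2 / 2 ≤ Real.exp (b * ‖v‖ / 2) := by
      have := Real.pow_div_factorial_le_exp (b * ‖v‖ / 2) (by positivity) 2
      simpa using this
    have h2 : Real.exp (-b * ‖(2⁻¹ : ℝ) • v‖) = Real.exp (-b * ‖v‖) * Real.exp (b * ‖v‖ / 2) := by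
      rw [norm_smul, ← Real.exp_add]
      congr 1
      norm_num
      ring
    rw [h2, mul_left_comm]
    gcongr
    rw [div_mul_eq_mul_div, le_div_iff₀ (by positivity)]
    nlinarith
  have hint0 : Integrable fun v : Vec d => Real.exp (-b * ‖(2⁻¹ : ℝ) • v‖) :=
    (integrable_exp_neg_mul_norm hd hb).comp_smul (by norm_num)
  have hint : Integrable fun v : Vec d => Real.exp (-b * ‖v‖) * ‖v‖ ^ 2 := by
    refine (hint0.const_mul (8 / b ^ 2)).mono' (by fun_prop) (.of_forall fun v => ?_)
    rw [Real.norm_of_nonneg (by positivity)]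
    exact hpt v
  have hmeas : Measurable fun v : Vec d => ENNReal.ofReal (Real.exp (-b * ‖v‖)) := by fun_prop
  have htr : ∀ v : Vec d, (ENNReal.ofReal (Real.exp (-b * ‖v‖))).toReal = Real.exp (-b * ‖v‖) :=
    fun v => ENNReal.toReal_ofReal (Real.exp_pos _).le
  have huniv : ((volume : Measure (Vec d)).withDensity fun v =>
      ENNReal.ofReal (Real.exp (-b * ‖v‖))) univ =
      ENNReal.ofReal (∫ v : Vec d, Real.exp (-b * ‖v‖)) := by
    rw [withDensity_apply _ MeasurableSet.univ, Measure.restrict_univ,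
      lintegral_exp_neg_mul_norm hd hb]
  constructor
  · simp only [radialLaplace]
    refine Integrable.smul_measure ?_ (by rw [huniv]; simpa using hZ)
    rw [integrable_withDensity_iff_integrable_smul' hmeas (.of_forall fun _ => by simp)]
    simpa only [htr, smul_eq_mul] using hint
  · simp only [radialLaplace]
    rw [integral_smul_measure, huniv,
      integral_withDensity_eq_integral_toReal_smul hmeas (.of_forall fun _ => by simp)]
    simp only [htr, smul_eq_mul, ENNReal.toReal_inv, ENNReal.toReal_ofReal hZ.le]
    rw [inv_mul_le_iff₀ hZ]
    calc _ ≤ ∫ v : Vec d, 8 / b ^ 2 * Real.exp (-b * ‖(2⁻¹ : ℝ) • v‖) :=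
          integral_mono hint (hint0.const_mul _) hpt
      _ = _ := by
          rw [integral_const_mul,
            Measure.integral_comp_smul volume (fun v : Vec d => Real.exp (-b * ‖v‖)) (2⁻¹ : ℝ)]
          simp
          ring

/-! ### Joint differential privacy from closeness of the estimators -/

theorem isProbabilityMeasure_noiseLaw (hd : 1 ≤ d) (m : MechParams) (h0 : 0 < m.eps)
    (h1 : 0 < m.sens) (h2 : 0 < m.sensHalf) : IsProbabilityMeasure (m.noiseLaw d) := by
  have := isProbabilityMeasure_radialLaplace hd (div_pos h0 h1)
  have := isProbabilityMeasure_radialLaplace hd (div_pos h0 h2)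
  unfold MechParams.noiseLaw
  infer_instance

/-- The three density ratios multiply. The hypothesis on the two group shifts bounds their sum
because at most one of them is nonzero in the application; hence `2 * eps` and not `3 * eps`. -/
theorem map_add_noiseLaw_le (hd : 1 ≤ d) (m : MechParams) (h0 : 0 < m.eps)
    (h1 : 0 < m.sens) (h2 : 0 < m.sensHalf) (a : Noise d) (ha1 : ‖a.1‖ ≤ m.sens)
    (ha2 : ‖a.2.1‖ + ‖a.2.2‖ ≤ m.sensHalf) :
    (m.noiseLaw d).map (· + a) ≤ ENNReal.ofReal (Real.exp (2 * m.eps)) • m.noiseLaw d := by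
  have := isProbabilityMeasure_radialLaplace hd (div_pos h0 h1)
  have := isProbabilityMeasure_radialLaplace hd (div_pos h0 h2)
  have hb1 := (div_pos h0 h1).le
  have hb2 := (div_pos h0 h2).le
  have hmap : (m.noiseLaw d).map (· + a) =
      ((radialLaplace d (m.eps / m.sens)).map (· + a.1)).prod
      (((radialLaplace d (m.eps / m.sensHalf)).map (· + a.2.1)).prod
        ((radialLaplace d (m.eps / m.sensHalf)).map (· + a.2.2))) := by
    rw [Measure.map_prod_map _ _ (measurable_add_const _) (measurable_add_const _),
      Measure.map_prod_map _ _ (measurable_add_const _) (by fun_prop)]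
    rfl
  rw [hmap]
  have hfin : ∀ x : ℝ, IsFiniteMeasure
      (ENNReal.ofReal x • radialLaplace d (m.eps / m.sensHalf)) := fun x =>
    Measure.smul_finite _ ENNReal.ofReal_ne_top
  refine (Measure.prod_mono (map_add_radialLaplace_le hb1 a.1)
    (Measure.prod_mono (map_add_radialLaplace_le hb2 a.2.1)
      (map_add_radialLaplace_le hb2 a.2.2))).trans ?_
  rw [Measure.prod_smul_left, Measure.prod_smul_left, Measure.prod_smul_right,
    Measure.prod_smul_right, Measure.prod_smul_right, smul_smul, smul_smul]
  unfold MechParams.noiseLaw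
  rw [← ENNReal.ofReal_mul (Real.exp_pos _).le, ← Real.exp_add,
    ← ENNReal.ofReal_mul (Real.exp_pos _).le, ← Real.exp_add]
  refine Measure.le_iff.2 fun S _ => ?_
  simp only [Measure.smul_apply, smul_eq_mul]
  gcongr
  have e1 : m.eps / m.sens * ‖a.1‖ ≤ m.eps := by
    rw [div_mul_eq_mul_div, div_le_iff₀ h1]; gcongr
  have e2 : m.eps / m.sensHalf * (‖a.2.1‖ + ‖a.2.2‖) ≤ m.eps := by
    rw [div_mul_eq_mul_div, div_le_iff₀ h2]; gcongr
  linarith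

theorem estimator_congr (τ : ℝ) (g : Finset (Fin n)) {D D' : Fin n → Sample d}
    (h : ∀ j ∈ g, D j = D' j) : estimator τ g D = estimator τ g D' := by
  have h' : ∀ j : g, D j = D' j := fun j => h j j.2
  simp only [estimator, h']

/-- The outside view is post-processing of the three noisy estimators, so only their shift matters.
-/
theorem jdpBound_mechanism (hd : 1 ≤ d) (P : Population d) (m : MechParams) (h0 : 0 < m.eps)
    (h1 : 0 < m.sens) (h2 : 0 < m.sensHalf) (g : Finset (Fin n)) (D D' : Fin n → Sample d)
    (i : Fin n) (hD : ∀ j, j ≠ i → D' j = D j)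
    (hu : ‖estimator m.τ₂ Finset.univ D' - estimator m.τ₂ Finset.univ D‖ ≤ m.sens)
    (hg : ‖estimator m.τ₂ g D' - estimator m.τ₂ g D‖ ≤ m.sensHalf)
    (hgc : ‖estimator m.τ₂ gᶜ D' - estimator m.τ₂ gᶜ D‖ ≤ m.sensHalf) :
    JDPBound (mechanism P m g) (m.noiseLaw d) (2 * m.eps) i D D' := by
  intro S hS
  -- Besides the noisy estimators, `H` uses only the data of agents other than `i`, so the same `H`
  -- serves for `D` and `D'`.
  let H : Noise d → Vec d × ({j : Fin n // j ≠ i} → ℝ) := fun w =>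
    (projBall m.τθ w.1, fun j => brier m.a₁ m.a₂
      (inner ℝ (D j).1 (if (j : Fin n) ∈ g then projBall m.τθ w.2.2 else projBall m.τθ w.2.1))
      (inner ℝ (D j).1 (P.posteriorMean (D j))))
  have hH : Measurable H := by
    have hp := measurable_projBall (d := d) m.τθ
    refine (hp.comp measurable_fst).prodMk (measurable_pi_lambda _ fun j => ?_)
    unfold brier
    have : Measurable fun w : Noise d => inner ℝ (D j).1
        (if (j : Fin n) ∈ g then projBall m.τθ w.2.2 else projBall m.τθ w.2.1) := by
      split_ifs
      · exact measurable_const.inner (hp.comp (measurable_snd.comp measurable_snd))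
      · exact measurable_const.inner (hp.comp (measurable_fst.comp measurable_snd))
    fun_prop
  let T : (Fin n → Sample d) → Noise d := fun E =>
    (estimator m.τ₂ Finset.univ E, estimator m.τ₂ g E, estimator m.τ₂ gᶜ E)
  have hview : ∀ v, outsideView i (mechanism P m g D v) = H (T D + v) := by
    intro v
    refine Prod.ext rfl (funext fun j => ?_)
    simp only [outsideView, mechanism, payment, peerEstimator, H, T]
    congr 2
  have hview' : ∀ v, outsideView i (mechanism P m g D' v) = H (T D' + v) := by
    intro v
    refine Prod.ext rfl (funext fun j => ?_)
    simp only [outsideView, mechanism, payment, peerEstimator, H, T, hD j j.2]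
    congr 2
  simp only [hview, hview']
  set a : Noise d := T D - T D' with ha
  have hset : {v | H (T D + v) ∈ S} = (· + a) ⁻¹' {v | H (T D' + v) ∈ S} := by
    ext v
    simp only [mem_ofPred_eq, mem_preimage, ha]
    rw [show T D' + (v + (T D - T D')) = T D + v by abel]
  have hmeas : MeasurableSet {v | H (T D' + v) ∈ S} := (hH.comp (measurable_const_add _)) hS
  rw [hset, ← Measure.map_apply (measurable_add_const a) hmeas]
  refine (map_add_noiseLaw_le hd m h0 h1 h2 a ?_ ?_ _).trans_eq rfl
  · rw [norm_sub_rev] at hu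
    exact hu
  -- The estimator of the group that does not contain `i` is unchanged, so its shift is zero.
  · by_cases hi : i ∈ g
    · have : estimator m.τ₂ gᶜ D = estimator m.τ₂ gᶜ D' := by
        refine estimator_congr _ _ fun j hj => (hD j ?_).symm
        rintro rfl
        exact (Finset.mem_compl.1 hj) hi
      rw [norm_sub_rev] at hg
      simpa [ha, T, this] using hg
    · have : estimator m.τ₂ g D = estimator m.τ₂ g D' := by
        refine estimator_congr _ _ fun j hj => (hD j ?_).symm
        rintro rfl
        exact hi hj
      rw [norm_sub_rev] at hgc
      simpa [ha, T, this] using hgc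

end Noise

/-! ### Moments and tails of sub-Gaussian vectors -/

section SubGaussian

variable {d n : ℕ}

/-- Every one-dimensional projection of `μ` is sub-Gaussian with variance proxy `σ² / d`. -/
def SubGaussianVec (σ : ℝ) (μ : Measure (Vec d)) : Prop :=
  ∀ u : Vec d, ‖u‖ = 1 →
    HasSubgaussianMGF (fun x : Vec d => inner ℝ x u) (Real.toNNReal (σ ^ 2 / d)) μ

/-- A bound on the fourth moment of the norm of a sub-Gaussian vector. -/
def fourthMoment (σ : ℝ) (d : ℕ) : ℝ := 48 * d ^ 2 * Real.exp (σ ^ 2 / d / 2)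

theorem one_le_fourthMoment (hd : 1 ≤ d) (σ : ℝ) : 1 ≤ fourthMoment σ d := by
  unfold fourthMoment
  have h1 : (1 : ℝ) ≤ d := by exact_mod_cast hd
  have h2 : 1 ≤ Real.exp (σ ^ 2 / d / 2) := Real.one_le_exp (by positivity)
  have h3 : (1 : ℝ) ≤ (d : ℝ) ^ 2 := one_le_pow₀ h1
  nlinarith

variable {σ : ℝ} {μ : Measure (Vec d)}

theorem SubGaussianVec.coord (h : SubGaussianVec σ μ) (a : Fin d) :
    HasSubgaussianMGF (fun x : Vec d => x a) (Real.toNNReal (σ ^ 2 / d)) μ := by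
  have := h (EuclideanSpace.single a 1) (by simp)
  refine this.congr (.of_forall fun x => ?_)
  simp [EuclideanSpace.inner_single_right]

/-- Coordinatewise `x ^ 4 ≤ 24 * exp |x| ≤ 24 * (exp x + exp (-x))`, and the moment generating
function is bounded at `±1`. One factor `d` comes from Cauchy–Schwarz, the other from the number of
coordinates. -/
theorem SubGaussianVec.norm_pow_four (h : SubGaussianVec σ μ) :
    Integrable (fun x => ‖x‖ ^ 4) μ ∧ ∫ x, ‖x‖ ^ 4 ∂μ ≤ fourthMoment σ d := by
  have hpt : ∀ x : Vec d, ‖x‖ ^ 4 ≤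
      d * ∑ a, 24 * (Real.exp (1 * x a) + Real.exp ((-1) * x a)) := by
    intro x
    have h1 : ‖x‖ ^ 2 = ∑ a, x a ^ 2 := by
      rw [EuclideanSpace.norm_sq_eq]; simp
    have h2 : ‖x‖ ^ 4 ≤ d * ∑ a, (x a ^ 2) ^ 2 := by
      rw [show ‖x‖ ^ 4 = (‖x‖ ^ 2) ^ 2 by ring, h1]
      simpa using sq_sum_le_card_mul_sum_sq (s := Finset.univ) (f := fun a : Fin d => x a ^ 2)
    refine h2.trans ?_
    gcongr with a
    have h3 := Real.pow_div_factorial_le_exp |x a| (abs_nonneg _) 4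
    have h4 : Real.exp |x a| ≤ Real.exp (1 * x a) + Real.exp ((-1) * x a) := by
      rcases abs_cases (x a) with h | h <;> rw [h.1]
      · simp [Real.exp_nonneg]
      · simp [Real.exp_nonneg]
    have h5 : |x a| ^ 4 = (x a ^ 2) ^ 2 := by
      rw [← sq_abs (x a)]; ring
    rw [h5, div_le_iff₀ (by positivity)] at h3
    norm_num [Nat.factorial] at h3
    norm_num at h4 ⊢
    linarith
  have hi : ∀ (a : Fin d) (t : ℝ), Integrable (fun x : Vec d => Real.exp (t * x a)) μ :=
    fun a t => (h.coord a).integrable_exp_mul t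
  have hint : Integrable (fun x : Vec d =>
      d * ∑ a, 24 * (Real.exp (1 * x a) + Real.exp ((-1) * x a))) μ :=
    (integrable_finsetSum _ fun a _ => ((hi a 1).add (hi a (-1))).const_mul 24).const_mul _
  have hint4 : Integrable (fun x : Vec d => ‖x‖ ^ 4) μ := by
    refine hint.mono' (by fun_prop) (.of_forall fun x => ?_)
    rw [Real.norm_of_nonneg (by positivity)]
    exact hpt x
  refine ⟨hint4, (integral_mono hint4 hint hpt).trans ?_⟩
  have hm : ∀ (a : Fin d) (t : ℝ), t ^ 2 = 1 →
      ∫ x : Vec d, Real.exp (t * x a) ∂μ ≤ Real.exp (σ ^ 2 / d / 2) := by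
    intro a t ht
    have := (h.coord a).mgf_le t
    rw [ht, mul_one, Real.coe_toNNReal _ (by positivity)] at this
    exact this
  have hi2 : ∀ a ∈ (Finset.univ : Finset (Fin d)), Integrable (fun x : Vec d =>
      24 * (Real.exp (1 * x a) + Real.exp ((-1) * x a))) μ :=
    fun a _ => ((hi a 1).add (hi a (-1))).const_mul 24
  rw [integral_const_mul, integral_finsetSum _ hi2]
  unfold fourthMoment
  calc _ ≤ (d : ℝ) * ∑ a : Fin d, 48 * Real.exp (σ ^ 2 / d / 2) := by
        gcongr with a
        rw [integral_const_mul, integral_add (hi a 1) (hi a (-1))]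
        linarith [hm a 1 (by norm_num), hm a (-1) (by norm_num)]
    _ = _ := by simp; ring

variable [IsProbabilityMeasure μ]

theorem SubGaussianVec.norm_sq (hd : 1 ≤ d) (h : SubGaussianVec σ μ) :
    Integrable (fun x => ‖x‖ ^ 2) μ ∧ ∫ x, ‖x‖ ^ 2 ∂μ ≤ 2 * fourthMoment σ d := by
  obtain ⟨h1, h2⟩ := h.norm_pow_four
  have hpt : ∀ x : Vec d, ‖x‖ ^ 2 ≤ 1 + ‖x‖ ^ 4 := fun x => by nlinarith [sq_nonneg (‖x‖ ^ 2 - 1)]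
  have hint : Integrable (fun x => ‖x‖ ^ 2) μ := by
    refine ((integrable_const 1).add h1).mono' (by fun_prop) (.of_forall fun x => ?_)
    rw [Real.norm_of_nonneg (by positivity)]
    exact hpt x
  refine ⟨hint, (integral_mono hint ((integrable_const 1).add h1) hpt).trans ?_⟩
  rw [integral_add' (integrable_const 1) h1]
  simp
  linarith [one_le_fourthMoment hd σ]

theorem SubGaussianVec.integrable_inner_mul (hd : 1 ≤ d) (h : SubGaussianVec σ μ) (v w : Vec d) :
    Integrable (fun x => inner ℝ x v * inner ℝ x w) μ := by
  refine ((h.norm_sq hd).1.mul_const (‖v‖ * ‖w‖)).mono' (by fun_prop) (.of_forall fun x => ?_)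
  rw [norm_mul]
  calc _ ≤ (‖x‖ * ‖v‖) * (‖x‖ * ‖w‖) :=
        mul_le_mul (norm_inner_le_norm x v) (norm_inner_le_norm x w) (norm_nonneg _) (by positivity)
    _ = _ := by ring

theorem SubGaussianVec.integral_inner_sq_le (hd : 1 ≤ d) (h : SubGaussianVec σ μ) (v : Vec d) :
    ∫ x, inner ℝ x v ^ 2 ∂μ ≤ 2 * fourthMoment σ d * ‖v‖ ^ 2 := by
  have hi := h.integrable_inner_mul hd v v
  simp only [← sq] at hi
  calc ∫ x, inner ℝ x v ^ 2 ∂μ ≤ ∫ x, ‖x‖ ^ 2 * ‖v‖ ^ 2 ∂μ := by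
        refine integral_mono hi ((h.norm_sq hd).1.mul_const _) fun x => ?_
        simp only
        rw [← mul_pow, ← sq_abs]
        gcongr
        exact abs_real_inner_le_norm x v
    _ ≤ _ := by
        rw [integral_mul_const]
        gcongr
        exact (h.norm_sq hd).2

/-- A sub-Gaussian vector is nondegenerate if its covariance matrix is bounded below. -/
theorem SubGaussianVec.le_integral_inner_sq (hd : 1 ≤ d) (h : SubGaussianVec σ μ) {κ : ℝ}
    (hκ : 0 < κ)
    (hcov : ∀ w : Fin d → ℝ, κ * ‖WithLp.toLp 2 w‖ ≤
      ‖WithLp.toLp 2 ((Matrix.of fun j k => ∫ x : Vec d, x j * x k ∂μ) *ᵥ w)‖) (w : Vec d) :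
    κ ^ 2 / (2 * fourthMoment σ d) * ‖w‖ ^ 2 ≤ ∫ x, inner ℝ x w ^ 2 ∂μ := by
  set M := 2 * fourthMoment σ d
  have hM : 0 < M := by have := one_le_fourthMoment hd σ; positivity
  set v : Vec d := WithLp.toLp 2 ((Matrix.of fun j k => ∫ x : Vec d, x j * x k ∂μ) *ᵥ w.ofLp)
    with hv
  have hw : κ * ‖w‖ ≤ ‖v‖ := hcov w.ofLp
  have hcoord : ∀ (x : Vec d) (j : Fin d), x j = inner ℝ x (EuclideanSpace.single j (1 : ℝ)) := by
    intro x j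
    simp [EuclideanSpace.inner_single_right]
  have hinn : ∀ x u : Vec d, inner ℝ x u = ∑ k, x k * u k := by
    intro x u
    simp [PiLp.inner_apply, mul_comm]
  have hij : ∀ j k : Fin d, Integrable (fun x : Vec d => x j * x k) μ := by
    intro j k
    simp only [hcoord]
    exact h.integrable_inner_mul hd _ _
  have hvj : ∀ j, v j = ∫ x, x j * inner ℝ x w ∂μ := by
    intro j
    simp only [hv, Matrix.mulVec, dotProduct, Matrix.of_apply, hinn, Finset.mul_sum, ← mul_assoc]
    rw [integral_finsetSum _ fun k _ => (hij j k).mul_const _]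
    simp [integral_mul_const]
  have hvv : ‖v‖ ^ 2 = ∫ x, inner ℝ x v * inner ℝ x w ∂μ := by
    have : ‖v‖ ^ 2 = ∑ j, v j * v j := by
      rw [EuclideanSpace.norm_sq_eq]; simp [sq]
    rw [this]
    have e : ∀ x : Vec d, inner ℝ x v * inner ℝ x w = ∑ j, v j * (x j * inner ℝ x w) := by
      intro x
      rw [hinn x v, Finset.sum_mul]
      exact Finset.sum_congr rfl fun j _ => by ring
    simp only [e]
    rw [integral_finsetSum]
    · refine Finset.sum_congr rfl fun j _ => ?_
      rw [integral_const_mul, ← hvj]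
    · intro j _
      have := h.integrable_inner_mul hd (EuclideanSpace.single j (1 : ℝ)) w
      simp only [← hcoord] at this
      exact this.const_mul _
  have hiv := h.integrable_inner_mul hd v v
  have hiw := h.integrable_inner_mul hd w w
  simp only [← sq] at hiv hiw
  -- Weighted AM–GM on the pairing of `w` with `v`, its image under the covariance matrix. The
  -- weight `1 / (2 * M)` is chosen so that the upper second moment bound in direction `v` uses
  -- exactly half of `‖v‖ ^ 2`, which is then absorbed on the left.
  have hle : ‖v‖ ^ 2 ≤ ‖v‖ ^ 2 / 2 + M / 2 * ∫ x, inner ℝ x w ^ 2 ∂μ := by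
    calc ‖v‖ ^ 2 = ∫ x, inner ℝ x v * inner ℝ x w ∂μ := hvv
      _ ≤ ∫ x, (1 / (2 * M) * inner ℝ x v ^ 2 + M / 2 * inner ℝ x w ^ 2) ∂μ := by
          refine integral_mono (h.integrable_inner_mul hd v w)
            ((hiv.const_mul _).add (hiw.const_mul _)) fun x => ?_
          simp only
          have : 0 ≤ 1 / (2 * M) * (inner ℝ x v - M * inner ℝ x w) ^ 2 := by positivity
          have e : 1 / (2 * M) * (inner ℝ x v - M * inner ℝ x w) ^ 2 =
              1 / (2 * M) * inner ℝ x v ^ 2 + M / 2 * inner ℝ x w ^ 2 -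
                inner ℝ x v * inner ℝ x w := by
            field_simp
            ring
          linarith
      _ = 1 / (2 * M) * ∫ x, inner ℝ x v ^ 2 ∂μ + M / 2 * ∫ x, inner ℝ x w ^ 2 ∂μ := by
          rw [integral_add (hiv.const_mul _) (hiw.const_mul _), integral_const_mul,
            integral_const_mul]
      _ ≤ 1 / (2 * M) * (M * ‖v‖ ^ 2) + M / 2 * ∫ x, inner ℝ x w ^ 2 ∂μ := by
          gcongr
          exact h.integral_inner_sq_le hd v
      _ = _ := by
          field_simp
  rw [div_mul_eq_mul_div, div_le_iff₀ hM]
  have : (κ * ‖w‖) ^ 2 ≤ ‖v‖ ^ 2 := by gcongr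
  nlinarith

/-- If the norm is at least `r`, some coordinate is at least `r / √d` in absolute value; the proxy
`σ ^ 2 / d` cancels this `√d`, and the union bound costs only the factor `2 * d`. -/
theorem SubGaussianVec.norm_tail (hd : 1 ≤ d) (h : SubGaussianVec σ μ) {r : ℝ} (hr : 0 ≤ r) :
    μ.real {x | r ≤ ‖x‖} ≤ 2 * d * Real.exp (-r ^ 2 / (2 * σ ^ 2)) := by
  have hd0 : (0 : ℝ) < d := by exact_mod_cast hd
  have hsub : {x : Vec d | r ≤ ‖x‖} ⊆
      ⋃ a ∈ (Finset.univ : Finset (Fin d)), ({x | r / √d ≤ x a} ∪ {x | r / √d ≤ -x a}) := by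
    intro x hx
    by_contra hcon
    simp only [Finset.mem_univ, iUnion_true, mem_iUnion, mem_union, mem_ofPred_eq, not_exists,
      not_or, not_le] at hcon hx
    have h1 : ‖x‖ ^ 2 = ∑ a, x a ^ 2 := by
      rw [EuclideanSpace.norm_sq_eq]; simp
    have h2 : ∑ a : Fin d, x a ^ 2 < ∑ a : Fin d, (r / √d) ^ 2 := by
      refine Finset.sum_lt_sum_of_nonempty ⟨⟨0, hd⟩, Finset.mem_univ _⟩ fun a _ => ?_
      rw [sq_lt_sq, abs_of_nonneg (show 0 ≤ r / √d by positivity)]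
      exact abs_lt.2 ⟨by linarith [(hcon a).2], (hcon a).1⟩
    have h3 : ∑ a : Fin d, (r / √d) ^ 2 = r ^ 2 := by
      simp [div_pow]
      field_simp
    have h4 : r ^ 2 ≤ ‖x‖ ^ 2 := by gcongr
    linarith
  refine (measureReal_mono hsub (measure_ne_top _ _)).trans ((measureReal_biUnion_finset_le _ _).trans ?_)
  have key : -(r / √d) ^ 2 / (2 * (Real.toNNReal (σ ^ 2 / d) : ℝ)) = -r ^ 2 / (2 * σ ^ 2) := by
    rw [Real.coe_toNNReal _ (by positivity), div_pow, Real.sq_sqrt hd0.le]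
    field_simp
  calc ∑ a : Fin d, μ.real ({x | r / √d ≤ x a} ∪ {x | r / √d ≤ -x a})
      ≤ ∑ a : Fin d, 2 * Real.exp (-r ^ 2 / (2 * σ ^ 2)) := by
        refine Finset.sum_le_sum fun a _ => (measureReal_union_le _ _).trans ?_
        have e1 := (h.coord a).measure_ge_le (show 0 ≤ r / √d by positivity)
        have e2 := (h.coord a).neg.measure_ge_le (show 0 ≤ r / √d by positivity)
        rw [key] at e1 e2
        simp only [Pi.neg_apply] at e2
        linarith
    _ = _ := by simp; ring

theorem hasSubgaussianMGF_gaussianReal (v : ℝ≥0) :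
    HasSubgaussianMGF (fun x : ℝ => x) v (gaussianReal 0 v) where
  integrable_exp_mul t := integrable_exp_mul_gaussianReal t
  mgf_le t := by
    rw [mgf_fun_id_gaussianReal]
    simp

theorem gaussianReal_abs_tail (v : ℝ≥0) {r : ℝ} (hr : 0 ≤ r) :
    (gaussianReal 0 v).real {x | r ≤ |x|} ≤ 2 * Real.exp (-r ^ 2 / (2 * v)) := by
  have hsub : {x : ℝ | r ≤ |x|} ⊆ {x | r ≤ x} ∪ {x | r ≤ -x} := fun x hx => by
    simpa [le_abs] using hx
  have e1 := (hasSubgaussianMGF_gaussianReal v).measure_ge_le hr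
  have e2 := (hasSubgaussianMGF_gaussianReal v).neg.measure_ge_le hr
  simp only [Pi.neg_apply] at e2
  refine (measureReal_mono hsub).trans ((measureReal_union_le _ _).trans ?_)
  linarith

end SubGaussian

/-! ### Hoeffding's inequality on product spaces, and concentration of the design -/

section Concentration

variable {d n : ℕ}

/-- Hoeffding's inequality for both signs: a variable with values in `[-B, B]` has variance proxy `B
^ 2`. -/
theorem pi_abs_sum_sub_tail {Ω : Type*} [MeasurableSpace Ω] (ν : Measure Ω)
    [IsProbabilityMeasure ν] {f : Ω → ℝ} (hf : Measurable f) {B : ℝ} (hB : ∀ ω, |f ω| ≤ B)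
    (g : Finset (Fin n)) {η : ℝ} (hη : 0 ≤ η) :
    (Measure.pi fun _ : Fin n => ν).real {t | η * g.card ≤ |∑ j ∈ g, (f (t j) - ∫ ω, f ω ∂ν)|} ≤
      2 * Real.exp (-(η ^ 2 / (2 * B ^ 2)) * g.card) := by
  have hB0 : 0 ≤ B := by
    obtain ⟨ω⟩ := nonempty_of_isProbabilityMeasure ν
    exact (abs_nonneg _).trans (hB ω)
  have hsub : HasSubgaussianMGF (fun ω => f ω - ∫ ω, f ω ∂ν) (‖B - -B‖₊ ^ 2 / 4) ν := by
    have := hasSubgaussianMGF_of_mem_Icc (μ := ν) hf.aemeasurable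
      (.of_forall fun ω => abs_le.1 (hB ω))
    convert this using 1
    rw [div_pow]; norm_num
  have hpi : ∀ j : Fin n, HasSubgaussianMGF (fun t : Fin n → Ω => f (t j) - ∫ ω, f ω ∂ν)
      (‖B - -B‖₊ ^ 2 / 4) (Measure.pi fun _ : Fin n => ν) := by
    intro j
    have hmp := measurePreserving_eval (fun _ : Fin n => ν) j
    refine HasSubgaussianMGF.of_map (X := fun ω => f ω - ∫ ω, f ω ∂ν)
      (Y := Function.eval j) hmp.measurable.aemeasurable ?_
    rwa [hmp.map_eq]
  have hind : iIndepFun (fun (j : Fin n) (t : Fin n → Ω) => f (t j) - ∫ ω, f ω ∂ν)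
      (Measure.pi fun _ : Fin n => ν) :=
    iIndepFun_pi (X := fun _ ω => f ω - ∫ ω, f ω ∂ν) fun _ => (hf.sub_const _).aemeasurable
  have hind' : iIndepFun (fun (j : Fin n) => -(fun (t : Fin n → Ω) => f (t j) - ∫ ω, f ω ∂ν))
      (Measure.pi fun _ : Fin n => ν) :=
    iIndepFun_pi (X := fun _ => -(fun ω => f ω - ∫ ω, f ω ∂ν))
      fun _ => (hf.sub_const _).neg.aemeasurable
  have hε : 0 ≤ η * g.card := by positivity
  have e1 := HasSubgaussianMGF.measure_sum_ge_le_of_iIndepFun hind (s := g) (fun j _ => hpi j) hε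
  have e2 := HasSubgaussianMGF.measure_sum_ge_le_of_iIndepFun hind' (s := g)
    (fun j _ => (hpi j).neg) hε
  have key : -(η * g.card) ^ 2 / (2 * ((∑ j ∈ g, ‖B - -B‖₊ ^ 2 / 4 : ℝ≥0) : ℝ)) =
      -(η ^ 2 / (2 * B ^ 2)) * g.card := by
    have : ((∑ j ∈ g, ‖B - -B‖₊ ^ 2 / 4 : ℝ≥0) : ℝ) = g.card * B ^ 2 := by
      push_cast
      rw [Finset.sum_const, nsmul_eq_mul, sub_neg_eq_add, Real.norm_of_nonneg (by positivity)]
      ring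
    rw [this]
    -- For an empty group or `B = 0`, division by zero makes both exponents `0`, and the resulting
    -- bound by `2` is trivial.
    rcases Nat.eq_zero_or_pos g.card with h0 | h0
    · simp [h0]
    · have : (g.card : ℝ) ≠ 0 := by positivity
      rcases hB0.eq_or_lt with hB | hB
      · simp [← hB]
      · field_simp
  rw [key] at e1 e2
  have hsub : {t : Fin n → Ω | η * g.card ≤ |∑ j ∈ g, (f (t j) - ∫ ω, f ω ∂ν)|} ⊆
      {t | η * g.card ≤ ∑ j ∈ g, (f (t j) - ∫ ω, f ω ∂ν)} ∪
      {t | η * g.card ≤ ∑ j ∈ g, (-(fun t : Fin n → Ω => f (t j) - ∫ ω, f ω ∂ν)) t} := by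
    intro t ht
    simp only [mem_union, mem_ofPred_eq, Pi.neg_apply, Finset.sum_neg_distrib] at ht ⊢
    exact le_abs.1 ht
  refine (measureReal_mono hsub).trans ((measureReal_union_le _ _).trans ?_)
  linarith

/-- Truncation of a vector at norm `R`. -/
def trunc (R : ℝ) (x : Vec d) : Vec d := if ‖x‖ ≤ R then x else 0

theorem norm_trunc_le {R : ℝ} (hR : 0 ≤ R) (x : Vec d) : ‖trunc R x‖ ≤ R := by
  unfold trunc
  split_ifs with h
  · exact h
  · simpa using hR

theorem measurable_trunc (R : ℝ) : Measurable (trunc R : Vec d → Vec d) :=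
  Measurable.ite (measurableSet_le (by fun_prop) measurable_const) measurable_id measurable_const

theorem abs_coord_le_norm (x : Vec d) (a : Fin d) : |x a| ≤ ‖x‖ := by
  simpa using PiLp.norm_apply_le x a

theorem inner_trunc_sq_le (R : ℝ) (x w : Vec d) : inner ℝ (trunc R x) w ^ 2 ≤ inner ℝ x w ^ 2 := by
  unfold trunc
  split_ifs
  · exact le_rfl
  · simpa using sq_nonneg _

/-- Where truncation acts, `‖x‖ > R`, so `‖x‖ ^ 2 ≤ ‖x‖ ^ 4 / R ^ 2`: the loss in expectation is
controlled by the fourth moment and is small for large `R`. -/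
theorem le_inner_trunc_sq {R : ℝ} (hR : 0 < R) (x w : Vec d) :
    inner ℝ x w ^ 2 - ‖x‖ ^ 4 / R ^ 2 * ‖w‖ ^ 2 ≤ inner ℝ (trunc R x) w ^ 2 := by
  unfold trunc
  split_ifs with h
  · have : 0 ≤ ‖x‖ ^ 4 / R ^ 2 * ‖w‖ ^ 2 := by positivity
    linarith
  · rw [inner_zero_left, zero_pow two_ne_zero, sub_nonpos]
    calc inner ℝ x w ^ 2 = |inner ℝ x w| ^ 2 := (sq_abs _).symm
      _ ≤ (‖x‖ * ‖w‖) ^ 2 := by gcongr; exact abs_real_inner_le_norm x w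
      _ = ‖x‖ ^ 2 * ‖w‖ ^ 2 := by ring
      _ ≤ _ := by
          gcongr
          rw [le_div_iff₀ (by positivity)]
          have : R ^ 2 ≤ ‖x‖ ^ 2 := by gcongr; exact (not_le.1 h).le
          nlinarith [sq_nonneg ‖x‖]

theorem inner_sq_eq_sum (x w : Vec d) :
    inner ℝ x w ^ 2 = ∑ a, ∑ b, w a * w b * (x a * x b) := by
  have : inner ℝ x w = ∑ k, x k * w k := by simp [PiLp.inner_apply, mul_comm]
  rw [this, sq, Finset.sum_mul_sum]
  exact Finset.sum_congr rfl fun a _ => Finset.sum_congr rfl fun b _ => by ring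

/-- Concentration of the truncated second moments implies a lower bound on the design. -/
theorem designBound_of_abs_sum_lt {σ : ℝ} {μ : Measure (Vec d)} [IsProbabilityMeasure μ]
    (h : SubGaussianVec σ μ) (hd : 1 ≤ d) {κ R η : ℝ} (hR : 0 < R)
    (hκ : ∀ w : Vec d, κ * ‖w‖ ^ 2 ≤ ∫ x, inner ℝ x w ^ 2 ∂μ) (g : Finset (Fin n))
    (x : Fin n → Vec d)
    (hx : ∀ a b, |∑ j ∈ g, (trunc R (x j) a * trunc R (x j) b -
      ∫ z, trunc R z a * trunc R z b ∂μ)| ≤ η * g.card) :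
    DesignBound g x ((κ - fourthMoment σ d / R ^ 2 - η * d) * g.card) := by
  intro w
  have hint : ∀ a b : Fin d, Integrable (fun z => trunc R z a * trunc R z b) μ := by
    intro a b
    have := measurable_trunc (d := d) R
    refine Integrable.of_bound (C := R * R) (by fun_prop) (.of_forall fun z => ?_)
    rw [norm_mul]
    exact mul_le_mul ((abs_coord_le_norm _ a).trans (norm_trunc_le hR.le z))
      ((abs_coord_le_norm _ b).trans (norm_trunc_le hR.le z)) (norm_nonneg _) hR.le
  have hintw : ∀ a b : Fin d, Integrable (fun z => w a * w b * (trunc R z a * trunc R z b)) μ :=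
    fun a b => (hint a b).const_mul _
  have hexp : ∑ a, ∑ b, w a * w b * ∫ z, trunc R z a * trunc R z b ∂μ =
      ∫ z, inner ℝ (trunc R z) w ^ 2 ∂μ := by
    simp only [inner_sq_eq_sum]
    rw [integral_finsetSum _ fun a _ => integrable_finsetSum _ fun b _ => hintw a b]
    refine Finset.sum_congr rfl fun a _ => ?_
    rw [integral_finsetSum _ fun b _ => hintw a b]
    exact Finset.sum_congr rfl fun b _ => (integral_const_mul _ _).symm
  have hlow : (κ - fourthMoment σ d / R ^ 2) * ‖w‖ ^ 2 ≤ ∫ z, inner ℝ (trunc R z) w ^ 2 ∂μ := by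
    obtain ⟨i4, m4⟩ := h.norm_pow_four
    have iw := h.integrable_inner_mul hd w w
    simp only [← sq] at iw
    have i4' : Integrable (fun z => ‖z‖ ^ 4 / R ^ 2 * ‖w‖ ^ 2) μ :=
      (i4.div_const _).mul_const _
    have it : Integrable (fun z => inner ℝ (trunc R z) w ^ 2) μ := by
      simp only [inner_sq_eq_sum]
      exact integrable_finsetSum _ fun a _ => integrable_finsetSum _ fun b _ => hintw a b
    calc _ ≤ (∫ z, inner ℝ z w ^ 2 ∂μ) - (∫ z, ‖z‖ ^ 4 ∂μ) / R ^ 2 * ‖w‖ ^ 2 := by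
          have h1 := hκ w
          have h2 : (∫ z, ‖z‖ ^ 4 ∂μ) / R ^ 2 * ‖w‖ ^ 2 ≤ fourthMoment σ d / R ^ 2 * ‖w‖ ^ 2 := by
            gcongr
          linarith
      _ = ∫ z, (inner ℝ z w ^ 2 - ‖z‖ ^ 4 / R ^ 2 * ‖w‖ ^ 2) ∂μ := by
          rw [integral_sub iw i4', integral_mul_const, integral_div]
      _ ≤ _ := integral_mono (iw.sub i4') it fun z => le_inner_trunc_sq hR z w
  have hsum : ∑ j ∈ g, inner ℝ (trunc R (x j)) w ^ 2 =
      g.card * ∑ a, ∑ b, w a * w b * ∫ z, trunc R z a * trunc R z b ∂μ +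
      ∑ a, ∑ b, w a * w b * ∑ j ∈ g, (trunc R (x j) a * trunc R (x j) b -
        ∫ z, trunc R z a * trunc R z b ∂μ) := by
    rw [Finset.mul_sum, ← Finset.sum_add_distrib]
    simp only [inner_sq_eq_sum]
    rw [Finset.sum_comm]
    refine Finset.sum_congr rfl fun a _ => ?_
    rw [Finset.mul_sum, ← Finset.sum_add_distrib, Finset.sum_comm]
    refine Finset.sum_congr rfl fun b _ => ?_
    rw [Finset.sum_sub_distrib, Finset.sum_const, nsmul_eq_mul, ← Finset.mul_sum]
    ring
  -- Entrywise errors `η * g.card` give a quadratic form of size `η * g.card * (∑ a, |w a|) ^ 2`;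
  -- Cauchy–Schwarz turns the square into `d * ‖w‖ ^ 2`.
  have herr : |∑ a, ∑ b, w a * w b * ∑ j ∈ g, (trunc R (x j) a * trunc R (x j) b -
        ∫ z, trunc R z a * trunc R z b ∂μ)| ≤ η * g.card * (d * ‖w‖ ^ 2) := by
    have hηg : 0 ≤ η * g.card := (abs_nonneg _).trans (hx ⟨0, hd⟩ ⟨0, hd⟩)
    calc _ ≤ ∑ a, ∑ b, |w a| * |w b| * (η * g.card) := by
          refine (Finset.abs_sum_le_sum_abs _ _).trans (Finset.sum_le_sum fun a _ => ?_)
          refine (Finset.abs_sum_le_sum_abs _ _).trans (Finset.sum_le_sum fun b _ => ?_)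
          rw [abs_mul, abs_mul]
          gcongr
          exact hx a b
      _ = η * g.card * (∑ a, |w a|) ^ 2 := by
          rw [sq, Finset.sum_mul_sum]
          simp only [← Finset.sum_mul]
          ring
      _ ≤ _ := by
          gcongr
          have := sq_sum_le_card_mul_sum_sq (s := Finset.univ) (f := fun a : Fin d => |w a|)
          simpa [EuclideanSpace.norm_sq_eq] using this
  calc _ = g.card * ((κ - fourthMoment σ d / R ^ 2) * ‖w‖ ^ 2) - η * g.card * (d * ‖w‖ ^ 2) := by
        ring
    _ ≤ ∑ j ∈ g, inner ℝ (trunc R (x j)) w ^ 2 := by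
        rw [hsum, hexp]
        have h1 := (abs_le.1 herr).1
        have h2 : (g.card : ℝ) * ((κ - fourthMoment σ d / R ^ 2) * ‖w‖ ^ 2) ≤
          g.card * ∫ z, inner ℝ (trunc R z) w ^ 2 ∂μ := by gcongr
        linarith
    _ ≤ _ := Finset.sum_le_sum fun j _ => inner_trunc_sq_le R (x j) w

end Concentration

namespace Population

variable {d : ℕ} (P : Population d)

/-! ### Laws of single types and of type profiles -/

/-- Given `θ`, the covariate and the residual of a type are independent. -/
theorem measurePreserving_residual (θ : Vec d) :
    MeasurePreserving (fun t : AgentType d => (t.1.1, t.1.2 - inner ℝ θ t.1.1))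
      (P.typeKernel θ) (P.covariate.prod (gaussianReal 0 (P.noiseSd ^ 2))) := by
  refine ⟨by fun_prop, ?_⟩
  have hm1 : Measurable fun p : Vec d × (Vec d × ℝ) => (p.2.1, inner ℝ p.1 p.2.1 + p.2.2) := by
    fun_prop
  have hm2 : Measurable fun z : Sample d => (z.1, z.2 - inner ℝ θ z.1) := by fun_prop
  have h1 : (P.typeKernel θ).map Prod.fst = P.dataKernel θ := by
    rw [typeKernel, ← Kernel.fst_apply, Kernel.fst_compProd]
  have h2 : P.dataKernel θ = (P.covariate.prod (gaussianReal 0 (P.noiseSd ^ 2))).map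
      fun q : Vec d × ℝ => (q.1, inner ℝ θ q.1 + q.2) := by
    rw [dataKernel, Kernel.map_apply _ hm1, Kernel.prod_apply, Kernel.id_apply, Kernel.const_apply,
      Measure.dirac_prod, Measure.map_map hm1 (by fun_prop)]
    rfl
  calc (P.typeKernel θ).map (fun t : AgentType d => (t.1.1, t.1.2 - inner ℝ θ t.1.1))
      = ((P.typeKernel θ).map Prod.fst).map fun z : Sample d => (z.1, z.2 - inner ℝ θ z.1) := by
        rw [Measure.map_map hm2 measurable_fst]; rfl
    _ = _ := by
        rw [h1, h2, Measure.map_map hm2 (by fun_prop)]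
        convert Measure.map_id using 2
        ext q <;> simp

theorem measurePreserving_covariate (θ : Vec d) :
    MeasurePreserving (fun t : AgentType d => t.1.1) (P.typeKernel θ) P.covariate := by
  have h := measurePreserving_fst.comp (P.measurePreserving_residual θ)
  exact h

theorem measurePreserving_noise (θ : Vec d) :
    MeasurePreserving (fun t : AgentType d => t.1.2 - inner ℝ θ t.1.1) (P.typeKernel θ)
      (gaussianReal 0 (P.noiseSd ^ 2)) := by
  have h := measurePreserving_snd.comp (P.measurePreserving_residual θ)
  exact h

theorem profileKernel_apply (n : ℕ) (θ : Vec d) :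
    P.profileKernel n θ = Measure.pi fun _ : Fin n => P.typeKernel θ := rfl

theorem measurePreserving_profile_eval (n : ℕ) (θ : Vec d) (i : Fin n) :
    MeasurePreserving (Function.eval i) (P.profileKernel n θ) (P.typeKernel θ) :=
  measurePreserving_eval (fun _ : Fin n => P.typeKernel θ) i

theorem profileKernel_exists_mem_le (n : ℕ) (θ : Vec d) {B : Set (AgentType d)}
    (hB : MeasurableSet B) :
    (P.profileKernel n θ).real {t | ∃ i, t i ∈ B} ≤ n * (P.typeKernel θ).real B := by
  have : {t : Fin n → AgentType d | ∃ i, t i ∈ B} = ⋃ i, Function.eval i ⁻¹' B := by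
    ext t; simp
  rw [this]
  refine (measureReal_iUnion_fintype_le _).trans ?_
  simp [(P.measurePreserving_profile_eval n θ _).measureReal_preimage hB.nullMeasurableSet]

theorem jointLaw_real_le (n : ℕ) {S : Set (Vec d × (Fin n → AgentType d))} (hS : MeasurableSet S)
    {b : ℝ} (hb : 0 ≤ b)
    (h : ∀ᵐ θ ∂P.prior, (P.profileKernel n θ).real {t | (θ, t) ∈ S} ≤ b) :
    (P.jointLaw n).real S ≤ b := by
  refine ENNReal.toReal_le_of_le_ofReal hb ?_
  rw [jointLaw, Measure.compProd_apply hS]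
  calc _ ≤ ∫⁻ _, ENNReal.ofReal b ∂P.prior := by
        refine lintegral_mono_ae (h.mono fun θ hθ => ?_)
        rw [← ofReal_measureReal]
        exact ENNReal.ofReal_le_ofReal hθ
    _ = _ := by simp

theorem neighborLaw_le (n : ℕ) {S : Set ((Fin n → AgentType d) × AgentType d)}
    (hS : MeasurableSet S) {b : ℝ}
    (h : ∀ θ, ((P.profileKernel n θ).prod (P.typeKernel θ)).real S ≤ b) :
    P.neighborLaw n S ≤ ENNReal.ofReal b := by
  rw [neighborLaw, Measure.bind_apply hS (Kernel.aemeasurable _)]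
  calc _ ≤ ∫⁻ _, ENNReal.ofReal b ∂P.prior := by
        refine lintegral_mono fun θ => ?_
        rw [Kernel.prod_apply, ← ofReal_measureReal]
        exact ENNReal.ofReal_le_ofReal (h θ)
    _ = _ := by simp

instance (n : ℕ) : IsProbabilityMeasure (P.jointLaw n) := by
  unfold jointLaw; infer_instance

/-! ### The posterior -/

/-- The Gaussian likelihood is positive for every parameter and bounded uniformly, so the posterior
is a probability measure for every sample, not only for almost every one. -/
theorem posterior_normalization (hs : 0 < P.noiseSd) (z : Sample d) :
    (P.prior.withDensity fun θ => gaussianPDF (inner ℝ z.1 θ) (P.noiseSd ^ 2) z.2) univ ≠ 0 ∧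
    (P.prior.withDensity fun θ => gaussianPDF (inner ℝ z.1 θ) (P.noiseSd ^ 2) z.2) univ ≠ ∞ := by
  have hv : P.noiseSd ^ 2 ≠ 0 := by positivity
  have hm : Measurable fun θ : Vec d => gaussianPDF (inner ℝ z.1 θ) (P.noiseSd ^ 2) z.2 := by
    unfold gaussianPDF gaussianPDFReal
    fun_prop
  rw [withDensity_apply _ MeasurableSet.univ, Measure.restrict_univ]
  constructor
  · rw [← pos_iff_ne_zero, lintegral_pos_iff_support hm]
    have : (Function.support fun θ : Vec d =>
        gaussianPDF (inner ℝ z.1 θ) (P.noiseSd ^ 2) z.2) = univ :=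
      eq_univ_of_forall fun θ => (gaussianPDF_pos _ hv _).ne'
    simp [this]
  · refine ne_top_of_le_ne_top (b := ∫⁻ _, ENNReal.ofReal (√(2 * Real.pi * (P.noiseSd ^ 2 : ℝ≥0)))⁻¹
      ∂P.prior)
      (by rw [lintegral_const, measure_univ, mul_one]; exact ENNReal.ofReal_ne_top)
      (lintegral_mono fun θ => ?_)
    refine ENNReal.ofReal_le_ofReal ?_
    unfold gaussianPDFReal
    refine mul_le_of_le_one_right (by positivity) (Real.exp_le_one_iff.2 ?_)
    exact div_nonpos_of_nonpos_of_nonneg (by nlinarith [sq_nonneg (z.2 - inner ℝ z.1 θ)])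
      (by positivity)

theorem isProbabilityMeasure_posterior (hs : 0 < P.noiseSd) (z : Sample d) :
    IsProbabilityMeasure (P.posterior z) := by
  obtain ⟨h0, h1⟩ := P.posterior_normalization hs z
  exact ⟨ENNReal.inv_mul_cancel h0 h1⟩

theorem isProbabilityMeasure_belief (hs : 0 < P.noiseSd) (n : ℕ) (z : Sample d) :
    IsProbabilityMeasure (P.belief n z) := by
  have := P.isProbabilityMeasure_posterior hs z
  unfold belief
  infer_instance

/-- The posterior is absolutely continuous with respect to the prior, so it lives on the same ball.
This holds for any report whatsoever, which the deviation argument needs. -/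
theorem norm_posteriorMean_le (hs : 0 < P.noiseSd) {τ : ℝ} (hτ : ∀ᵐ θ ∂P.prior, ‖θ‖ ≤ τ)
    (z : Sample d) : ‖P.posteriorMean z‖ ≤ τ := by
  have := P.isProbabilityMeasure_posterior hs z
  have hac : P.posterior z ≪ P.prior :=
    (Measure.AbsolutelyContinuous.smul_left
      (withDensity_absolutelyContinuous _ _) _)
  have := norm_integral_le_of_norm_le_const (hac.ae_le hτ)
  simpa [posteriorMean] using this

/-- A zero covariate makes the likelihood independent of the parameter. Thus the tail assumption on
beliefs, read at the sample `(0, 0)`, is a statement about the unconditional law of a cost. -/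
theorem posterior_zero (hs : 0 < P.noiseSd) : P.posterior (0, 0) = P.prior := by
  obtain ⟨h0, h1⟩ := P.posterior_normalization hs (0, 0)
  unfold posterior
  simp only [inner_zero_left, withDensity_const, Measure.smul_apply, measure_univ, smul_eq_mul,
    mul_one] at h0 h1 ⊢
  rw [smul_smul, ENNReal.inv_mul_cancel h0 h1, one_smul]

/-! ### Costs and thresholds -/

theorem typeKernel_ae_cost_nonneg (h : ∀ z : Sample d, ∀ᵐ c ∂(P.cost z), 0 ≤ c) (θ : Vec d) :
    (P.typeKernel θ).real {t | t.2 < 0} = 0 := by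
  have hm : MeasurableSet {t : AgentType d | t.2 < 0} := measurableSet_lt (by fun_prop) (by fun_prop)
  rw [measureReal_def, typeKernel, Kernel.compProd_apply hm]
  have : ∀ z : Sample d, P.cost z {c | c < 0} = 0 := by
    intro z
    have := h z
    rw [ae_iff] at this
    simpa only [not_le] using this
  simp [this]

theorem measurable_count (n : ℕ) (τ : ℝ) :
    Measurable fun t : Fin n → AgentType d =>
      ((({i : Fin n | (t i).2 ≤ τ} : Set (Fin n)).ncard : ℕ) : ℝ) := by
  have : ∀ t : Fin n → AgentType d,
      ((({i : Fin n | (t i).2 ≤ τ} : Set (Fin n)).ncard : ℕ) : ℝ) =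
        ∑ i, if (t i).2 ≤ τ then (1 : ℝ) else 0 := by
    intro t
    rw [Finset.sum_boole, ncard_eq_toFinset_card']
    simp
  simp only [this]
  exact Finset.measurable_fun_sum _ fun i _ =>
    Measurable.ite (measurableSet_le (by fun_prop) measurable_const) measurable_const
      measurable_const

theorem measurableSet_count (n : ℕ) (α τ : ℝ) :
    MeasurableSet {w : Vec d × (Fin n → AgentType d) |
      (1 - α) * n ≤ (({i : Fin n | (w.2 i).2 ≤ τ} : Set (Fin n)).ncard : ℝ)} :=
  measurableSet_le measurable_const ((measurable_count n τ).comp measurable_snd)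

theorem jointLaw_exists_cost_gt_le (hs : 0 < P.noiseSd) {lam : ℝ}
    (htail : ∀ (z : Sample d) (τ : ℝ), 1 - Real.exp (-lam * τ) ≤ (P.costBelief z).real (Iic τ))
    (n : ℕ) (τ : ℝ) :
    (P.jointLaw n).real {w | ∃ i, τ < (w.2 i).2} ≤ n * Real.exp (-lam * τ) := by
  have hcost : IsProbabilityMeasure (P.costBelief (0, 0)) := by
    have := P.isProbabilityMeasure_posterior hs (0, 0)
    unfold costBelief
    exact Measure.isProbabilityMeasure_map (by fun_prop)
  have hone : ∀ i : Fin n, (P.jointLaw n).real {w | τ < (w.2 i).2} ≤ Real.exp (-lam * τ) := by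
    intro i
    have hB : MeasurableSet {t : AgentType d | τ < t.2} :=
      measurableSet_lt measurable_const (by fun_prop)
    have hS : MeasurableSet {w : Vec d × (Fin n → AgentType d) | τ < (w.2 i).2} :=
      measurableSet_lt measurable_const (by fun_prop)
    have h1 : P.jointLaw n {w | τ < (w.2 i).2} = P.costBelief (0, 0) (Ioi τ) := by
      rw [jointLaw, Measure.compProd_apply hS, costBelief, posterior_zero P hs,
        Measure.map_apply (by fun_prop) measurableSet_Ioi,
        Measure.bind_apply (measurableSet_Ioi.preimage (by fun_prop)) (Kernel.aemeasurable _)]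
      refine lintegral_congr fun θ => ?_
      exact (P.measurePreserving_profile_eval n θ i).measure_preimage hB.nullMeasurableSet
    have h2 := htail (0, 0) τ
    have h3 := probReal_compl_eq_one_sub (μ := P.costBelief (0, 0)) (measurableSet_Iic (a := τ))
    rw [compl_Iic] at h3
    rw [measureReal_def, h1, ← measureReal_def, h3]
    linarith
  have : {w : Vec d × (Fin n → AgentType d) | ∃ i, τ < (w.2 i).2} =
      ⋃ i, {w | τ < (w.2 i).2} := by
    ext w; simp
  rw [this]
  refine (measureReal_iUnion_fintype_le _).trans ((Finset.sum_le_sum fun i _ => hone i).trans ?_)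
  simp

theorem threshold₁_nonneg (n : ℕ) (α β : ℝ) : 0 ≤ P.threshold₁ n α β :=
  Real.sInf_nonneg fun _ h => h.1.le

theorem threshold_nonneg (n : ℕ) (α β : ℝ) : 0 ≤ P.threshold n α β :=
  le_max_of_le_left (P.threshold₁_nonneg n α β)

theorem threshold_mem (hs : 0 < P.noiseSd) {lam : ℝ}
    (htail : ∀ (z : Sample d) (τ : ℝ), 1 - Real.exp (-lam * τ) ≤ (P.costBelief z).real (Iic τ))
    (n : ℕ) {α β τ : ℝ} (hα : 0 ≤ α) (hβ : n * Real.exp (-lam * τ) ≤ β) :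
    1 - β ≤ (P.jointLaw n).real
      {w | (1 - α) * n ≤ ({i : Fin n | (w.2 i).2 ≤ τ} : Set (Fin n)).ncard} := by
  have hsub : {w : Vec d × (Fin n → AgentType d) |
      (1 - α) * n ≤ (({i : Fin n | (w.2 i).2 ≤ τ} : Set (Fin n)).ncard : ℝ)}ᶜ ⊆
      {w | ∃ i, τ < (w.2 i).2} := by
    intro w hw
    by_contra hcon
    simp only [mem_ofPred_eq, not_exists, not_lt] at hcon
    refine hw ?_
    have : ({i : Fin n | (w.2 i).2 ≤ τ} : Set (Fin n)) = univ := eq_univ_of_forall hcon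
    simp only [mem_ofPred_eq, this, ncard_univ, Nat.card_eq_fintype_card, Fintype.card_fin]
    have : (0 : ℝ) ≤ n := Nat.cast_nonneg n
    nlinarith
  have h1 := (measureReal_mono hsub).trans (P.jointLaw_exists_cost_gt_le hs htail n τ)
  have h2 := probReal_compl_eq_one_sub (μ := P.jointLaw n) (measurableSet_count n α τ)
  linarith

theorem threshold_le (hs : 0 < P.noiseSd) {lam : ℝ}
    (htail : ∀ (z : Sample d) (τ : ℝ), 1 - Real.exp (-lam * τ) ≤ (P.costBelief z).real (Iic τ))
    (n : ℕ) {α β τ : ℝ} (hτ : 0 < τ) (hα : Real.exp (-lam * τ) ≤ α)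
    (hβ : n * Real.exp (-lam * τ) ≤ β) : P.threshold n α β ≤ τ := by
  refine max_le ?_ ?_
  · exact csInf_le ⟨0, fun _ h => h.1.le⟩
      ⟨hτ, P.threshold_mem hs htail n ((Real.exp_pos _).le.trans hα) hβ⟩
  · exact csInf_le ⟨0, fun _ h => h.1.le⟩ ⟨hτ, fun z => by linarith [htail z τ]⟩

/-- The infimum defining the first threshold is attained. -/
theorem le_jointLaw_count_threshold (hs : 0 < P.noiseSd) {lam : ℝ}
    (htail : ∀ (z : Sample d) (τ : ℝ), 1 - Real.exp (-lam * τ) ≤ (P.costBelief z).real (Iic τ))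
    (n : ℕ) {α β τ₀ : ℝ} (hτ₀ : 0 < τ₀) (hα : 0 ≤ α) (hβ : n * Real.exp (-lam * τ₀) ≤ β) :
    1 - β ≤ (P.jointLaw n).real {w | (1 - α) * n ≤
      ({i : Fin n | (w.2 i).2 ≤ P.threshold n α β} : Set (Fin n)).ncard} := by
  set τ := P.threshold n α β
  set S : ℝ → Set (Vec d × (Fin n → AgentType d)) := fun r =>
    {w | (1 - α) * n ≤ (({i : Fin n | (w.2 i).2 ≤ r} : Set (Fin n)).ncard : ℝ)} with hS
  have hmono : Monotone S := by
    intro r r' hr w hw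
    simp only [hS, mem_ofPred_eq] at hw ⊢
    refine hw.trans ?_
    exact_mod_cast ncard_le_ncard (fun i hi => le_trans hi hr) (toFinite _)
  have hne : {τ : ℝ | 0 < τ ∧ 1 - β ≤ (P.jointLaw n).real (S τ)}.Nonempty :=
    ⟨τ₀, hτ₀, P.threshold_mem hs htail n hα hβ⟩
  have hgt : ∀ r, τ < r → 1 - β ≤ (P.jointLaw n).real (S r) := by
    intro r hr
    obtain ⟨r', hr', hlt⟩ := exists_lt_of_csInf_lt hne ((le_max_left _ _).trans_lt hr)
    exact hr'.2.trans (measureReal_mono (hmono hlt.le))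
  have hanti : Antitone fun k : ℕ => S (τ + 1 / (k + 1)) := fun k l hkl =>
    hmono (by gcongr)
  have hinter : ⋂ k : ℕ, S (τ + 1 / (k + 1)) = S τ := by
    refine Subset.antisymm (fun w hw => ?_) (subset_iInter fun k => hmono ?_)
    -- A fixed profile has finitely many costs, so for `k` large none of them lies strictly between
    -- `τ` and the enlarged threshold: the count is right-continuous, and continuity from above of
    -- the measure gives attainment.
    · have hex : ∃ k : ℕ, ∀ i : Fin n, (w.2 i).2 ≤ τ + 1 / (k + 1) → (w.2 i).2 ≤ τ := by
        have : ∀ i : Fin n, ∀ᶠ k : ℕ in Filter.atTop,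
            (w.2 i).2 ≤ τ + 1 / (k + 1) → (w.2 i).2 ≤ τ := by
          intro i
          by_cases hi : (w.2 i).2 ≤ τ
          · exact .of_forall fun _ _ => hi
          · have hlim : Filter.Tendsto (fun k : ℕ => τ + 1 / ((k : ℝ) + 1)) Filter.atTop
                (nhds (τ + 0)) := tendsto_one_div_add_atTop_nhds_zero_nat.const_add τ
            rw [add_zero] at hlim
            filter_upwards [hlim.eventually_lt_const (not_le.1 hi)] with k hk h
            exact absurd h (not_le.2 hk)
        exact (Filter.eventually_all.2 this).exists
      obtain ⟨k, hk⟩ := hex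
      have hwk : w ∈ S (τ + 1 / (k + 1)) := mem_iInter.1 hw k
      simp only [hS, mem_ofPred_eq] at hwk ⊢
      refine hwk.trans ?_
      exact_mod_cast ncard_le_ncard hk (toFinite _)
    · have : (0 : ℝ) ≤ 1 / ((k : ℝ) + 1) := by positivity
      linarith
  have hlim := tendsto_measure_iInter_atTop (μ := P.jointLaw n)
    (fun k : ℕ => (measurableSet_count n α (τ + 1 / (k + 1))).nullMeasurableSet) hanti
    ⟨0, measure_ne_top _ _⟩
  have hlim' := (ENNReal.tendsto_toReal (measure_ne_top _ _)).comp hlim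
  have hfin := ge_of_tendsto' hlim' fun k => hgt (τ + 1 / (k + 1)) (by
    have : (0 : ℝ) < 1 / ((k : ℝ) + 1) := by positivity
    linarith)
  change 1 - β ≤ ((P.jointLaw n) (⋂ k : ℕ, S (τ + 1 / (k + 1)))).toReal at hfin
  rwa [hinter] at hfin

/-! ### Concentration under the population law -/

theorem measurableSet_abs_sum_lt (R : ℝ) (n : ℕ) (g : Finset (Fin n)) (a b : Fin d) (m r : ℝ) :
    MeasurableSet {t : Fin n → AgentType d | r ≤
      |∑ j ∈ g, (trunc R (t j).1.1 a * trunc R (t j).1.1 b - m)|} := by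
  have hx : ∀ (j : Fin n) (a : Fin d), Measurable fun t : Fin n → AgentType d =>
      trunc R (t j).1.1 a := fun j a => by
    have h1 : Measurable fun t : Fin n → AgentType d => trunc R (t j).1.1 :=
      (measurable_trunc R).comp (by fun_prop)
    fun_prop
  exact measurableSet_le measurable_const (Finset.measurable_fun_sum _ fun j _ =>
    ((hx j a).mul (hx j b)).sub_const _).norm

/-- The design is bounded below outside an event of exponentially small probability. -/
theorem exists_design_concentration (hd : 1 ≤ d) (σ κ : ℝ) (hκ : 0 < κ) :
    ∃ l c : ℝ, 0 < l ∧ 0 < c ∧ ∀ P : Population d, SubGaussianVec σ P.covariate →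
      (∀ w : Fin d → ℝ,
        κ * ‖WithLp.toLp 2 w‖ ≤ ‖WithLp.toLp 2 (P.covarianceMatrix *ᵥ w)‖) →
      ∀ (n : ℕ) (g : Finset (Fin n)), ∃ E : Set (Fin n → AgentType d), MeasurableSet E ∧
        (∀ t ∈ E, DesignBound g (fun j => (t j).1.1) (l * g.card)) ∧
        ∀ θ, (P.profileKernel n θ).real Eᶜ ≤ 2 * d ^ 2 * Real.exp (-c * g.card) := by
  set M := fourthMoment σ d with hM
  have hM1 : 1 ≤ M := one_le_fourthMoment hd σ
  have hd0 : (0 : ℝ) < d := by exact_mod_cast hd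
  -- `q` is the population lower bound. The choices of `R` and `η` make the truncation loss and the
  -- fluctuation loss `q / 4` each, which leaves `q / 2`.
  set q := κ ^ 2 / (2 * M) with hq
  have hq0 : 0 < q := by positivity
  set R := √(4 * M / q) with hR
  have hR0 : 0 < R := Real.sqrt_pos.2 (by positivity)
  have hR2 : R ^ 2 = 4 * M / q := Real.sq_sqrt (by positivity)
  set η := q / (4 * d) with hη
  have hη0 : 0 < η := by positivity
  refine ⟨q / 2, η ^ 2 / (2 * (R * R) ^ 2), by positivity, by positivity, ?_⟩
  intro P hsub hcov n g
  refine ⟨(⋃ a : Fin d, ⋃ b : Fin d, {t : Fin n → AgentType d | η * g.card ≤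
      |∑ j ∈ g, (trunc R (t j).1.1 a * trunc R (t j).1.1 b -
        ∫ z, trunc R z a * trunc R z b ∂P.covariate)|})ᶜ,
    (MeasurableSet.iUnion fun a => MeasurableSet.iUnion fun b =>
      measurableSet_abs_sum_lt R n g a b _ _).compl, ?_, ?_⟩
  · intro t ht
    simp only [mem_compl_iff, mem_iUnion, mem_ofPred_eq, not_exists, not_le] at ht
    have := designBound_of_abs_sum_lt hsub hd hR0
      (hsub.le_integral_inner_sq hd hκ hcov) g (fun j => (t j).1.1) fun a b => (ht a b).le
    convert this using 2
    rw [← hM, ← hq, hR2, hη]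
    field_simp
    ring
  · intro θ
    rw [compl_compl]
    refine (measureReal_iUnion_fintype_le _).trans ?_
    calc _ ≤ ∑ a : Fin d, ∑ b : Fin d, 2 * Real.exp (-(η ^ 2 / (2 * (R * R) ^ 2)) * g.card) := by
          refine Finset.sum_le_sum fun a _ => (measureReal_iUnion_fintype_le _).trans ?_
          refine Finset.sum_le_sum fun b _ => ?_
          have hf : Measurable fun z : Vec d => trunc R z a * trunc R z b := by
            have := measurable_trunc (d := d) R
            fun_prop
          have hi : ∫ t : AgentType d, trunc R t.1.1 a * trunc R t.1.1 b ∂P.typeKernel θ =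
              ∫ z, trunc R z a * trunc R z b ∂P.covariate := by
            rw [← (P.measurePreserving_covariate θ).map_eq,
              integral_map (by fun_prop) hf.aestronglyMeasurable]
          have := pi_abs_sum_sub_tail (n := n) (P.typeKernel θ)
            (f := fun t : AgentType d => trunc R t.1.1 a * trunc R t.1.1 b)
            (hf.comp (by fun_prop : Measurable fun t : AgentType d => t.1.1)) (B := R * R)
            (fun t => ?_) g hη0.le
          · rw [hi] at this
            exact this
          · rw [abs_mul]
            exact mul_le_mul ((abs_coord_le_norm _ a).trans (norm_trunc_le hR0.le _))
              ((abs_coord_le_norm _ b).trans (norm_trunc_le hR0.le _)) (abs_nonneg _) hR0.le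
      _ = _ := by simp; ring

theorem typeKernel_norm_tail (hd : 1 ≤ d) {σ : ℝ} (h : SubGaussianVec σ P.covariate) (θ : Vec d)
    {r : ℝ} (hr : 0 ≤ r) :
    (P.typeKernel θ).real {t | r ≤ ‖t.1.1‖} ≤ 2 * d * Real.exp (-r ^ 2 / (2 * σ ^ 2)) := by
  refine le_trans (le_of_eq ?_) (h.norm_tail hd hr)
  have hB : MeasurableSet {x : Vec d | r ≤ ‖x‖} := measurableSet_le measurable_const (by fun_prop)
  exact (P.measurePreserving_covariate θ).measureReal_preimage hB.nullMeasurableSet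

theorem typeKernel_residual_tail (θ : Vec d) {r : ℝ} (hr : 0 ≤ r) :
    (P.typeKernel θ).real {t | r ≤ |t.1.2 - inner ℝ θ t.1.1|} ≤
      2 * Real.exp (-r ^ 2 / (2 * (P.noiseSd : ℝ) ^ 2)) := by
  have h := gaussianReal_abs_tail (P.noiseSd ^ 2) hr
  push_cast at h
  refine le_trans (le_of_eq ?_) h
  have hB : MeasurableSet {x : ℝ | r ≤ |x|} := measurableSet_le measurable_const (by fun_prop)
  exact (P.measurePreserving_noise θ).measureReal_preimage hB.nullMeasurableSet

/-- Chebyshev's inequality for the sum of the covariates weighted by the residuals. -/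
theorem profileKernel_residual_sum_tail (hd : 1 ≤ d) {σ : ℝ} (h : SubGaussianVec σ P.covariate)
    (n : ℕ) (θ : Vec d) {r : ℝ} (hr : 0 < r) :
    (P.profileKernel n θ).real
      {t | r ≤ ‖∑ j, ((t j).1.2 - inner ℝ θ (t j).1.1) • (t j).1.1‖} ≤
      n * (2 * d ^ 2 * (P.noiseSd : ℝ) ^ 2 * fourthMoment σ d) / r ^ 2 := by
  have hd0 : (0 : ℝ) < d := by exact_mod_cast hd
  set M := fourthMoment σ d
  set φ : Fin d → Vec d × ℝ → ℝ := fun a p => p.2 * p.1 a with hφ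
  set res : AgentType d → Vec d × ℝ := fun t => (t.1.1, t.1.2 - inner ℝ θ t.1.1) with hres
  have hmp : MeasurePreserving res (P.typeKernel θ)
    (P.covariate.prod (gaussianReal 0 (P.noiseSd ^ 2))) := P.measurePreserving_residual θ
  have hφm : ∀ a, Measurable (φ a) := fun a => by fun_prop
  have hx1 : ∀ a, Integrable (fun x : Vec d => x a) P.covariate := fun a =>
    (h.coord a).integrable
  have hx2 : ∀ a, Integrable (fun x : Vec d => x a ^ 2) P.covariate ∧
      ∫ x, x a ^ 2 ∂P.covariate ≤ 2 * M := by
    intro a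
    obtain ⟨i2, m2⟩ := h.norm_sq hd
    have hpt : ∀ x : Vec d, x a ^ 2 ≤ ‖x‖ ^ 2 := fun x => by
      rw [← sq_abs (x a)]; gcongr; exact abs_coord_le_norm x a
    have : Integrable (fun x : Vec d => x a ^ 2) P.covariate := by
      refine i2.mono' (by fun_prop) (.of_forall fun x => ?_)
      rw [Real.norm_of_nonneg (sq_nonneg _)]
      exact hpt x
    exact ⟨this, (integral_mono this i2 hpt).trans m2⟩
  have hz2 : Integrable (fun z : ℝ => z ^ 2) (gaussianReal 0 (P.noiseSd ^ 2)) :=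
    (memLp_id_gaussianReal 2).integrable_sq
  have hz2' : ∫ z, z ^ 2 ∂(gaussianReal 0 (P.noiseSd ^ 2)) = (P.noiseSd : ℝ) ^ 2 := by
    have := variance_of_integral_eq_zero (X := fun z : ℝ => z) (μ := gaussianReal 0 (P.noiseSd ^ 2))
      (by fun_prop) integral_id_gaussianReal
    rw [← this, variance_fun_id_gaussianReal]
    push_cast
    rfl
  have hsq : ∀ a, Integrable (fun p => φ a p ^ 2)
      (P.covariate.prod (gaussianReal 0 (P.noiseSd ^ 2))) := by
    intro a
    refine ((hx2 a).1.mul_prod hz2).congr (.of_forall fun p => ?_)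
    simp only [hφ]
    ring
  have hL2 : ∀ a, MemLp (φ a) 2 (P.covariate.prod (gaussianReal 0 (P.noiseSd ^ 2))) := fun a =>
    (memLp_two_iff_integrable_sq (hφm a).aestronglyMeasurable).2 (hsq a)
  -- The residual is centred and independent of the covariate, so the weighted coordinates have mean
  -- zero.
  have hmean : ∀ a, ∫ p, φ a p ∂(P.covariate.prod (gaussianReal 0 (P.noiseSd ^ 2))) = 0 := by
    intro a
    have hcomm : ∀ p, φ a p = p.1 a * p.2 := fun p => mul_comm _ _
    simp only [hcomm]
    rw [integral_prod_mul (fun x : Vec d => x a) (fun z : ℝ => z), integral_id_gaussianReal,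
      mul_zero]
  have hY : ∀ a, MemLp (φ a ∘ res) 2 (P.typeKernel θ) := fun a => (hL2 a).comp_measurePreserving hmp
  have hYmean : ∀ a, ∫ t, φ a (res t) ∂(P.typeKernel θ) = 0 := by
    intro a
    rw [← hmean a, ← hmp.map_eq,
      integral_map hmp.measurable.aemeasurable (hφm a).aestronglyMeasurable]
  have hYvar : ∀ a, variance (φ a ∘ res) (P.typeKernel θ) ≤ 2 * M * (P.noiseSd : ℝ) ^ 2 := by
    intro a
    rw [variance_of_integral_eq_zero (hY a).aestronglyMeasurable.aemeasurable (hYmean a)]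
    calc _ = ∫ p, φ a p ^ 2 ∂(P.covariate.prod (gaussianReal 0 (P.noiseSd ^ 2))) := by
          rw [← hmp.map_eq, integral_map hmp.measurable.aemeasurable
            ((hφm a).pow_const 2).aestronglyMeasurable]
          rfl
      _ = (∫ x, x a ^ 2 ∂P.covariate) * (P.noiseSd : ℝ) ^ 2 := by
          rw [← hz2', ← integral_prod_mul (fun x : Vec d => x a ^ 2) (fun z : ℝ => z ^ 2)]
          congr 1 with p
          simp only [hφ]
          ring
      _ ≤ _ := by gcongr; exact (hx2 a).2
  set S : Fin d → (Fin n → AgentType d) → ℝ := fun a => ∑ j : Fin n, fun t => (φ a ∘ res) (t j)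
    with hS
  have hSL2 : ∀ a, MemLp (S a) 2 (P.profileKernel n θ) := fun a =>
    memLp_finsetSum' _ fun j _ => (hY a).comp_measurePreserving (P.measurePreserving_profile_eval n θ j)
  have hSvar : ∀ a, variance (S a) (P.profileKernel n θ) ≤ n * (2 * M * (P.noiseSd : ℝ) ^ 2) := by
    intro a
    rw [hS, profileKernel_apply, variance_sum_pi (X := fun _ => φ a ∘ res) fun _ => hY a]
    simpa using mul_le_mul_of_nonneg_left (hYvar a) (Nat.cast_nonneg n)
  have hSmean : ∀ a, ∫ t, S a t ∂(P.profileKernel n θ) = 0 := by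
    intro a
    simp only [hS, Finset.sum_apply]
    rw [integral_finsetSum]
    · refine Finset.sum_eq_zero fun j _ => ?_
      have e := P.measurePreserving_profile_eval n θ j
      rw [← hYmean a, ← e.map_eq, integral_map e.measurable.aemeasurable]
      · rfl
      · exact ((hφm a).comp hmp.measurable).aestronglyMeasurable
    · exact fun j _ => ((hY a).comp_measurePreserving
        (P.measurePreserving_profile_eval n θ j)).integrable (by norm_num)
  have hsub : {t : Fin n → AgentType d |
      r ≤ ‖∑ j, ((t j).1.2 - inner ℝ θ (t j).1.1) • (t j).1.1‖} ⊆
      ⋃ a : Fin d, {t | r / √d ≤ |S a t - ∫ t, S a t ∂(P.profileKernel n θ)|} := by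
    intro t ht
    by_contra hcon
    simp only [mem_iUnion, mem_ofPred_eq, not_exists, not_le, hSmean, sub_zero] at hcon ht
    set V : Vec d := ∑ j, ((t j).1.2 - inner ℝ θ (t j).1.1) • (t j).1.1 with hV
    have hVa : ∀ a, V a = S a t := by
      intro a
      simp [hV, hS, hφ, hres]
    have h1 : ‖V‖ ^ 2 = ∑ a, V a ^ 2 := by
      rw [EuclideanSpace.norm_sq_eq]; simp
    have h2 : ∑ a : Fin d, V a ^ 2 < ∑ a : Fin d, (r / √d) ^ 2 := by
      refine Finset.sum_lt_sum_of_nonempty ⟨⟨0, hd⟩, Finset.mem_univ _⟩ fun a _ => ?_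
      rw [sq_lt_sq, abs_of_nonneg (show 0 ≤ r / √d by positivity), hVa]
      exact hcon a
    have h3 : ∑ a : Fin d, (r / √d) ^ 2 = r ^ 2 := by
      simp [div_pow]
      field_simp
    have h4 : r ^ 2 ≤ ‖V‖ ^ 2 := by gcongr
    linarith
  refine (measureReal_mono hsub).trans ((measureReal_iUnion_fintype_le _).trans ?_)
  calc _ ≤ ∑ a : Fin d, n * (2 * M * (P.noiseSd : ℝ) ^ 2) / (r / √d) ^ 2 := by
        refine Finset.sum_le_sum fun a _ => ?_
        have hcheb := meas_ge_le_variance_div_sq (hSL2 a) (show 0 < r / √d by positivity)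
        have hvn := variance_nonneg (S a) (P.profileKernel n θ)
        refine (ENNReal.toReal_le_of_le_ofReal (by positivity) hcheb).trans ?_
        gcongr
        exact hSvar a
    _ = _ := by
        rw [div_pow, Real.sq_sqrt hd0.le]
        simp
        field_simp

end Population

/-! ### Payments and interim utilities -/

section Payments

variable {d n : ℕ}

theorem norm_peerEstimator_le (m : MechParams) (hτ : 0 ≤ m.τθ) (g : Finset (Fin n))
    (D : Fin n → Sample d) (v : Noise d) (i : Fin n) : ‖peerEstimator m g D v i‖ ≤ m.τθ := by
  unfold peerEstimator
  split_ifs <;> exact projBall_norm_le hτ _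

/-- An agent is paid according to the group that excludes it, so its own report is irrelevant to the
prediction it is scored against. -/
theorem peerEstimator_congr (m : MechParams) (g : Finset (Fin n)) {D D' : Fin n → Sample d}
    (v : Noise d) (i : Fin n) (h : ∀ j, j ≠ i → D j = D' j) :
    peerEstimator m g D v i = peerEstimator m g D' v i := by
  unfold peerEstimator
  split_ifs with hi
  · rw [estimator_congr m.τ₂ gᶜ fun j hj => h j ?_]
    rintro rfl
    exact (Finset.mem_compl.1 hj) hi
  · rw [estimator_congr m.τ₂ g fun j hj => h j ?_]
    rintro rfl
    exact hi hj

theorem measurable_peerEstimator {Ω : Type*} [MeasurableSpace Ω] (m : MechParams)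
    (g : Finset (Fin n)) (D : Ω → Fin n → Sample d) (hD : ∀ j, Measurable fun ω => D ω j)
    (v : Ω → Noise d) (hv : Measurable v) (i : Fin n) :
    Measurable fun ω => peerEstimator m g (D ω) (v ω) i := by
  unfold peerEstimator
  split_ifs
  · exact (measurable_projBall _).comp
      ((measurable_estimator m.τ₂ gᶜ D hD).add (measurable_snd.comp (measurable_snd.comp hv)))
  · exact (measurable_projBall _).comp
      ((measurable_estimator m.τ₂ g D hD).add (measurable_fst.comp (measurable_snd.comp hv)))

/-- The prediction of the response of agent `i` of type `ti` that agent `i` expects. -/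
def expectedPrediction (P : Population d) (m : MechParams) (g : Finset (Fin n))
    (strat : Fin n → Strategy d) (i : Fin n) (ti : AgentType d) : ℝ :=
  ∫ p : (Fin n → AgentType d) × Noise d,
    inner ℝ ti.1.1 (peerEstimator m g (reports strat (Function.update p.1 i ti)) p.2 i)
    ∂((P.belief n ti.1).prod (m.noiseLaw d))

theorem abs_expectedPrediction_le (P : Population d) (m : MechParams) (g : Finset (Fin n))
    (strat : Fin n → Strategy d) (i : Fin n) (ti : AgentType d) (hτ : 0 ≤ m.τθ)
    [IsProbabilityMeasure (P.belief n ti.1)] [IsProbabilityMeasure (m.noiseLaw d)] :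
    |expectedPrediction P m g strat i ti| ≤ ‖ti.1.1‖ * m.τθ := by
  have := norm_integral_le_of_norm_le_const (μ := (P.belief n ti.1).prod (m.noiseLaw d))
    (C := ‖ti.1.1‖ * m.τθ) (f := fun p : (Fin n → AgentType d) × Noise d =>
      inner ℝ ti.1.1 (peerEstimator m g (reports strat (Function.update p.1 i ti)) p.2 i))
    (.of_forall fun p => (norm_inner_le_norm _ _).trans
      (mul_le_mul_of_nonneg_left (norm_peerEstimator_le m hτ g _ _ i) (norm_nonneg _)))
  simpa [expectedPrediction] using this

/-- The interim utility after a deviation is the score of the expected prediction. -/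
theorem interimUtility_update (P : Population d) (m : MechParams) (g : Finset (Fin n))
    (privCost : ℝ) (strat : Fin n → Strategy d) (hstrat : ∀ j, Measurable (strat j)) (i : Fin n)
    (ti : AgentType d) (hτ : 0 ≤ m.τθ)
    [IsProbabilityMeasure (P.belief n ti.1)] [IsProbabilityMeasure (m.noiseLaw d)]
    (r : Strategy d) :
    interimUtility P m g privCost (Function.update strat i r) i ti =
      brier m.a₁ m.a₂ (expectedPrediction P m g strat i ti)
        (inner ℝ ti.1.1 (P.posteriorMean (ti.1.1, r ti))) - privCost := by
  set Z : (Fin n → AgentType d) × Noise d → ℝ := fun p =>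
    inner ℝ ti.1.1 (peerEstimator m g (reports strat (Function.update p.1 i ti)) p.2 i) with hZ
  set q := inner ℝ ti.1.1 (P.posteriorMean (ti.1.1, r ti)) with hq
  have hpay : ∀ p : (Fin n → AgentType d) × Noise d,
      payment P m g (reports (Function.update strat i r) (Function.update p.1 i ti)) p.2 i =
        brier m.a₁ m.a₂ (Z p) q := by
    intro p
    have h1 : reports (Function.update strat i r) (Function.update p.1 i ti) i =
        (ti.1.1, r ti) := by simp [reports]
    rw [payment, h1, hZ, hq]
    simp only
    -- After this replacement the deviation `r` enters only through the number `r ti`, so no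
    -- measurability of `r` is needed.
    rw [peerEstimator_congr m g p.2 i (D' := reports strat (Function.update p.1 i ti))]
    intro j hj
    simp [reports, hj]
  have hm : Measurable Z := by
    refine measurable_const.inner (measurable_peerEstimator m g _ (fun j => ?_) _ measurable_snd i)
    have hu : Measurable fun p : (Fin n → AgentType d) × Noise d =>
        Function.update p.1 i ti j := by
      by_cases hj : j = i
      · subst hj; simp
      · simp only [Function.update_of_ne hj]; fun_prop
    exact (measurable_fst.comp (measurable_fst.comp hu)).prodMk ((hstrat j).comp hu)
  have hint : Integrable Z ((P.belief n ti.1).prod (m.noiseLaw d)) := by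
    refine Integrable.of_bound hm.aestronglyMeasurable (‖ti.1.1‖ * m.τθ) (.of_forall fun p => ?_)
    exact (norm_inner_le_norm _ _).trans
      (mul_le_mul_of_nonneg_left (norm_peerEstimator_le m hτ g _ _ i) (norm_nonneg _))
  have haff : ∀ p, brier m.a₁ m.a₂ (Z p) q =
      (m.a₁ - m.a₂ * q ^ 2) + (-(m.a₂ * (1 - 2 * q))) * Z p := by
    intro p; unfold brier; ring
  rw [interimUtility]
  simp only [hpay, haff]
  rw [integral_add (integrable_const _) (hint.const_mul _), integral_const_mul]
  have : ∫ p, Z p ∂((P.belief n ti.1).prod (m.noiseLaw d)) =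
    expectedPrediction P m g strat i ti := rfl
  rw [this]
  simp [brier]
  ring

/-- Completing the square, the gain of a deviation is `a₂ * ((q - p) ^ 2 - (q' - p) ^ 2)`. Dropping
the negative term and bounding `|q - p|` by `2 * B` suffices, since `a₂` itself has the order of the
desired slack. -/
theorem isApproxBestResponse_of_bound (P : Population d) (m : MechParams) (g : Finset (Fin n))
    (privCost : ℝ) (strat : Fin n → Strategy d) (hstrat : ∀ j, Measurable (strat j)) (i : Fin n)
    (ti : AgentType d) (hτ : 0 ≤ m.τθ) (ha : 0 ≤ m.a₂)
    [IsProbabilityMeasure (P.belief n ti.1)] [IsProbabilityMeasure (m.noiseLaw d)]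
    (hpost : ∀ z, ‖P.posteriorMean z‖ ≤ m.τθ) {B η : ℝ} (hB : ‖ti.1.1‖ * m.τθ ≤ B)
    (hη : m.a₂ * (4 * B ^ 2) ≤ η) :
    IsApproxBestResponse P m g privCost η strat i ti := by
  intro r
  have h0 := interimUtility_update P m g privCost strat hstrat i ti hτ (strat i)
  rw [Function.update_eq_self] at h0
  rw [h0, interimUtility_update P m g privCost strat hstrat i ti hτ r]
  have hp := (abs_expectedPrediction_le P m g strat i ti hτ).trans hB
  have hq : |inner ℝ ti.1.1 (P.posteriorMean (ti.1.1, strat i ti))| ≤ B :=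
    (abs_real_inner_le_norm _ _).trans
      ((mul_le_mul_of_nonneg_left (hpost _) (norm_nonneg _)).trans hB)
  set p := expectedPrediction P m g strat i ti
  set q := inner ℝ ti.1.1 (P.posteriorMean (ti.1.1, strat i ti))
  set q' := inner ℝ ti.1.1 (P.posteriorMean (ti.1.1, r ti))
  have h1 : (q - p) ^ 2 ≤ 4 * B ^ 2 := by
    have : |q - p| ≤ 2 * B := (abs_sub _ _).trans (by linarith)
    calc (q - p) ^ 2 = |q - p| ^ 2 := (sq_abs _).symm
      _ ≤ (2 * B) ^ 2 := by gcongr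
      _ = _ := by ring
  have h2 : m.a₂ * (q - p) ^ 2 ≤ η := (mul_le_mul_of_nonneg_left h1 ha).trans hη
  have h3 : 0 ≤ m.a₂ * (q' - p) ^ 2 := by positivity
  unfold brier
  nlinarith

theorem abs_brier_sub_le {a₁ a₂ p q B : ℝ} (ha : 0 ≤ a₂) (hp : |p| ≤ B) (hq : |q| ≤ B) :
    |brier a₁ a₂ p q - a₁| ≤ a₂ * (B + 3 * B ^ 2) := by
  have hB : 0 ≤ B := (abs_nonneg _).trans hp
  have h1 : brier a₁ a₂ p q - a₁ = -(a₂ * (p - 2 * p * q + q ^ 2)) := by unfold brier; ring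
  rw [h1, abs_neg, abs_mul, abs_of_nonneg ha]
  gcongr
  have hpq : |p * q| ≤ B * B := by rw [abs_mul]; gcongr
  have hqq : q ^ 2 ≤ B ^ 2 := by rw [← sq_abs]; gcongr
  have := abs_le.1 hpq
  have := abs_le.1 hp
  rw [abs_le]
  constructor <;> nlinarith [sq_nonneg q]

theorem interimUtility_nonneg (P : Population d) (m : MechParams) (g : Finset (Fin n))
    (privCost : ℝ) (strat : Fin n → Strategy d) (hstrat : ∀ j, Measurable (strat j)) (i : Fin n)
    (ti : AgentType d) (hτ : 0 ≤ m.τθ) (ha : 0 ≤ m.a₂)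
    [IsProbabilityMeasure (P.belief n ti.1)] [IsProbabilityMeasure (m.noiseLaw d)]
    (hpost : ∀ z, ‖P.posteriorMean z‖ ≤ m.τθ) {B : ℝ} (hB : ‖ti.1.1‖ * m.τθ ≤ B)
    (ha₁ : m.a₂ * (B + 3 * B ^ 2) + privCost ≤ m.a₁) :
    0 ≤ interimUtility P m g privCost strat i ti := by
  have h0 := interimUtility_update P m g privCost strat hstrat i ti hτ (strat i)
  rw [Function.update_eq_self] at h0
  rw [h0]
  have hp := (abs_expectedPrediction_le P m g strat i ti hτ).trans hB
  have hq : |inner ℝ ti.1.1 (P.posteriorMean (ti.1.1, strat i ti))| ≤ B :=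
    (abs_real_inner_le_norm _ _).trans
      ((mul_le_mul_of_nonneg_left (hpost _) (norm_nonneg _)).trans hB)
  have := (abs_le.1 (abs_brier_sub_le (a₁ := m.a₁) ha hp hq)).1
  linarith

theorem integral_payment_le (P : Population d) (m : MechParams) (g : Finset (Fin n))
    (D : Fin n → Sample d) (i : Fin n) (hτ : 0 ≤ m.τθ) (ha : 0 ≤ m.a₂)
    [IsProbabilityMeasure (m.noiseLaw d)] (hpost : ∀ z, ‖P.posteriorMean z‖ ≤ m.τθ) {B : ℝ}
    (hB : ‖(D i).1‖ * m.τθ ≤ B) (ha₁ : 0 ≤ m.a₁) :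
    ∫ v, payment P m g D v i ∂(m.noiseLaw d) ≤ m.a₁ + m.a₂ * (B + 3 * B ^ 2) := by
  refine (le_abs_self _).trans ?_
  have := norm_integral_le_of_norm_le_const (μ := m.noiseLaw d)
    (f := fun v => payment P m g D v i) (C := m.a₁ + m.a₂ * (B + 3 * B ^ 2))
    (.of_forall fun v => ?_)
  · simpa using this
  · have hp : |inner ℝ (D i).1 (peerEstimator m g D v i)| ≤ B :=
      (abs_real_inner_le_norm _ _).trans ((mul_le_mul_of_nonneg_left
        (norm_peerEstimator_le m hτ g _ _ i) (norm_nonneg _)).trans hB)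
    have hq : |inner ℝ (D i).1 (P.posteriorMean (D i))| ≤ B :=
      (abs_real_inner_le_norm _ _).trans
        ((mul_le_mul_of_nonneg_left (hpost _) (norm_nonneg _)).trans hB)
    have h := abs_le.1 (abs_brier_sub_le (a₁ := m.a₁) ha hp hq)
    rw [Real.norm_eq_abs, payment, abs_le]
    constructor <;> linarith

/-- Accuracy of the released estimator in terms of that of the least squares estimator. -/
theorem integral_privateEstimator_le (hd : 1 ≤ d) (m : MechParams) (h0 : 0 < m.eps)
    (h1 : 0 < m.sens) (h2 : 0 < m.sensHalf) (hτ : 0 ≤ m.τθ) (D : Fin n → Sample d) (θ : Vec d)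
    (hθ : ‖θ‖ ≤ m.τθ) :
    ∫ v, ‖privateEstimator m D v - θ‖ ^ 2 ∂(m.noiseLaw d) ≤
      2 * ‖estimator m.τ₂ Finset.univ D - θ‖ ^ 2 + 2 * (8 * 2 ^ d * (m.sens / m.eps) ^ 2) := by
  have := isProbabilityMeasure_radialLaplace hd (div_pos h0 h1)
  have := isProbabilityMeasure_radialLaplace hd (div_pos h0 h2)
  obtain ⟨hi, hle⟩ := radialLaplace_second_moment hd (div_pos h0 h1)
  set e := estimator m.τ₂ Finset.univ D
  have hmp : MeasurePreserving Prod.fst (m.noiseLaw d) (radialLaplace d (m.eps / m.sens)) :=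
    measurePreserving_fst
  have := isProbabilityMeasure_noiseLaw hd m h0 h1 h2
  have hi' : Integrable (fun v : Noise d => ‖v.1‖ ^ 2) (m.noiseLaw d) :=
    hmp.integrable_comp_of_integrable hi
  have hI : ∫ v : Noise d, ‖v.1‖ ^ 2 ∂(m.noiseLaw d) =
      ∫ v, ‖v‖ ^ 2 ∂(radialLaplace d (m.eps / m.sens)) := by
    rw [← hmp.map_eq, integral_map hmp.measurable.aemeasurable (by fun_prop)]
  have hpt : ∀ v : Noise d, ‖privateEstimator m D v - θ‖ ^ 2 ≤ 2 * ‖e - θ‖ ^ 2 + 2 * ‖v.1‖ ^ 2 := by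
    intro v
    -- Since `θ` lies in the ball, projecting does not increase the distance to it.
    have e1 : ‖privateEstimator m D v - θ‖ ≤ ‖e - θ‖ + ‖v.1‖ := by
      refine (projBall_sub_le hτ _ θ hθ).trans ?_
      rw [show e + v.1 - θ = (e - θ) + v.1 by abel]
      exact norm_add_le _ _
    calc _ ≤ (‖e - θ‖ + ‖v.1‖) ^ 2 := by gcongr
      _ ≤ _ := by nlinarith [sq_nonneg (‖e - θ‖ - ‖v.1‖)]
  calc _ ≤ ∫ v : Noise d, (2 * ‖e - θ‖ ^ 2 + 2 * ‖v.1‖ ^ 2) ∂(m.noiseLaw d) :=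
        integral_mono_of_nonneg (.of_forall fun _ => sq_nonneg _)
          ((integrable_const _).add (hi'.const_mul 2)) (.of_forall hpt)
    _ = 2 * ‖e - θ‖ ^ 2 + 2 * ∫ v, ‖v‖ ^ 2 ∂(radialLaplace d (m.eps / m.sens)) := by
        rw [← hI, integral_add (integrable_const _) (hi'.const_mul 2),
          integral_const_mul 2 fun v : Noise d => ‖v.1‖ ^ 2]
        simp
    _ ≤ _ := by
        gcongr
        refine hle.trans (le_of_eq ?_)
        field_simp

end Payments

/-! ### Comparison of growth rates -/

section Asymptotics

open Filter Topology

theorem eventually_exp_le {a q ε : ℝ} (B ω : ℝ) (ha : 0 < a) (hq : 0 < q) (hε : 0 < ε) :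
    ∀ᶠ n : ℕ in atTop, B * n * Real.exp (-a * (n : ℝ) ^ q) ≤ ε * (n : ℝ) ^ (-ω) := by
  -- With `x = n ^ q`, the power `x ^ ((1 + ω) / q)` is `n * n ^ ω`.
  have h1 := (tendsto_rpow_mul_exp_neg_mul_atTop_nhds_zero ((1 + ω) / q) a ha).comp
    ((tendsto_rpow_atTop hq).comp tendsto_natCast_atTop_atTop)
  have h2 := h1.const_mul B
  rw [mul_zero] at h2
  filter_upwards [h2.eventually_lt_const hε, eventually_gt_atTop 0] with n hn hn0
  have hn0' : (0 : ℝ) < n := by exact_mod_cast hn0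
  simp only [Function.comp_apply] at hn
  rw [← Real.rpow_mul hn0'.le, mul_div_cancel₀ _ hq.ne', Real.rpow_add hn0', Real.rpow_one] at hn
  rw [Real.rpow_neg hn0'.le, ← div_eq_mul_inv, le_div_iff₀ (by positivity)]
  calc _ = B * ((n : ℝ) * (n : ℝ) ^ ω * Real.exp (-a * (n : ℝ) ^ q)) := by ring
    _ ≤ ε := hn.le

theorem eventually_rpow_le {p q ε : ℝ} (B : ℝ) (hpq : p < q) (hε : 0 < ε) :
    ∀ᶠ n : ℕ in atTop, B * (n : ℝ) ^ p ≤ ε * (n : ℝ) ^ q := by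
  have h1 := (tendsto_rpow_neg_atTop (sub_pos.2 hpq)).comp tendsto_natCast_atTop_atTop
  have h2 := h1.const_mul B
  rw [mul_zero] at h2
  filter_upwards [h2.eventually_lt_const hε, eventually_gt_atTop 0] with n hn hn0
  have hn0' : (0 : ℝ) < n := by exact_mod_cast hn0
  have e : (n : ℝ) ^ p = (n : ℝ) ^ (-(q - p)) * (n : ℝ) ^ q := by
    rw [← Real.rpow_add hn0']; congr 1; ring
  rw [e, ← mul_assoc]
  exact mul_le_mul_of_nonneg_right hn.le (by positivity)

theorem eventually_one_le_log : ∀ᶠ n : ℕ in atTop, 1 ≤ Real.log ((n : ℝ) / 2) :=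
  (Real.tendsto_log_atTop.comp
    (tendsto_natCast_atTop_atTop.atTop_div_const two_pos)).eventually_ge_atTop 1

theorem eventually_sqrt_log_le {q ε : ℝ} (B : ℝ) (hq : 0 < q) (hε : 0 < ε) :
    ∀ᶠ n : ℕ in atTop, B * √(Real.log n) ≤ ε * (n : ℝ) ^ q := by
  have h1 := ((isLittleO_log_rpow_atTop hq).comp_tendsto tendsto_natCast_atTop_atTop).bound
    (show 0 < ε / (|B| + 1) by positivity)
  have h2 : ∀ᶠ n : ℕ in atTop, 1 ≤ Real.log (n : ℝ) :=
    (Real.tendsto_log_atTop.comp tendsto_natCast_atTop_atTop).eventually_ge_atTop 1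
  filter_upwards [h1, h2] with n hn hlog
  simp only [Function.comp_apply, Real.norm_eq_abs] at hn
  rw [abs_of_nonneg (show 0 ≤ Real.log (n : ℝ) by linarith),
    abs_of_nonneg (show 0 ≤ (n : ℝ) ^ q by positivity)] at hn
  have h3 : √(Real.log n) ≤ Real.log n := Real.sqrt_le_iff.2 ⟨by linarith, by nlinarith⟩
  have hB : 0 < |B| + 1 := by positivity
  rw [div_mul_eq_mul_div, le_div_iff₀ hB] at hn
  calc B * √(Real.log n) ≤ (|B| + 1) * Real.log n :=
        mul_le_mul (by linarith [le_abs_self B]) h3 (Real.sqrt_nonneg _) hB.le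
    _ ≤ _ := by linarith

end Asymptotics

/-! ### Privacy -/

section Privacy

variable {d n : ℕ}

open Filter

theorem IsBalanced.quarter_le {g : Finset (Fin n)} (hg : IsBalanced g) (hn : 2 ≤ n) :
    (n : ℝ) / 4 ≤ g.card ∧ (n : ℝ) / 4 ≤ gᶜ.card := by
  have h1 : g.card + gᶜ.card = n := by simp
  have h2 : n ≤ 4 * g.card ∧ n ≤ 4 * gᶜ.card := by
    rcases hg with h | h <;> constructor <;> omega
  have h3 : (n : ℝ) ≤ 4 * g.card := by exact_mod_cast h2.1
  have h4 : (n : ℝ) ≤ 4 * gᶜ.card := by exact_mod_cast h2.2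
  constructor <;> linarith

theorem confidence_eq (C₁ ω : ℝ) {n : ℕ} (hn : 0 < n) :
    confidence C₁ ω n = C₁ * (1 + 2 * 2 ^ ω) * (n : ℝ) ^ (-ω) := by
  unfold confidence
  rw [Real.div_rpow (Nat.cast_nonneg n) two_pos.le, Real.rpow_neg two_pos.le]
  field_simp

/-- A common lower bound without logarithm for the sensitivities of the full data (`m = n`) and of
the groups (`m = n / 2`). -/
theorem le_sensBound {C₀ τ₂ m : ℝ} (hd : 1 ≤ d) (hC₀ : 0 ≤ C₀) (hτ₂ : 0 ≤ τ₂)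
    (hm : 1 ≤ Real.log m) (hm0 : 0 < m) {n : ℝ} (hmn : m ≤ n) :
    C₀ * τ₂ / √n ≤ sensBound C₀ τ₂ d m := by
  unfold sensBound
  have hd1 : (1 : ℝ) ≤ d := by exact_mod_cast hd
  rw [← mul_div_assoc]
  refine div_le_div₀ (by positivity) ?_ (Real.sqrt_pos.2 hm0) (Real.sqrt_le_sqrt hmn)
  refine le_mul_of_one_le_right (by positivity) (Real.one_le_sqrt.2 ?_)
  nlinarith

/-- For large `n`, the sensitivity of the least squares estimators is below the bounds used by
the mechanism when the designs are well conditioned and the covariates at most `n ^ (1/8)`. -/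
theorem eventually_sensitivity (hd : 1 ≤ d) {l C₀ : ℝ} (hl : 0 < l) (hC₀ : 0 < C₀) :
    ∀ᶠ n : ℕ in atTop, ∀ τ₂ : ℝ, 0 ≤ τ₂ → ∀ m : ℝ, m ≤ n → 1 ≤ Real.log m → 0 < m →
      ∀ g : Finset (Fin n), (n : ℝ) / 4 ≤ g.card → ∀ (D D' : Fin n → Sample d) (i : Fin n),
        (∀ j, j ≠ i → D' j = D j) → DesignBound g (fun j => (D j).1) (l * g.card) →
        (∀ j, ‖(D j).1‖ ≤ (n : ℝ) ^ (1 / 8 : ℝ)) → ‖(D' i).1‖ ≤ (n : ℝ) ^ (1 / 8 : ℝ) →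
        ‖estimator τ₂ g D' - estimator τ₂ g D‖ ≤ sensBound C₀ τ₂ d m := by
  filter_upwards [eventually_gt_atTop 0,
    eventually_rpow_le 1 (show (1 / 4 : ℝ) < 1 by norm_num) (show 0 < l / 8 by positivity),
    eventually_rpow_le (16 / l) (show (1 / 8 : ℝ) < 1 / 2 by norm_num)
      (show 0 < C₀ / 2 by positivity),
    eventually_rpow_le (16 / l ^ 2) (show (3 / 8 : ℝ) < 1 / 2 by norm_num)
      (show 0 < C₀ / 2 by positivity)] with n hn0 h1 h2 h3
  intro τ₂ hτ₂ m hmn hlog hm0 g hg D D' i hD hdes hx hx'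
  have hn : (0 : ℝ) < n := by exact_mod_cast hn0
  refine le_trans ?_ (le_sensBound hd hC₀.le hτ₂ hlog hm0 hmn)
  set R : ℝ := (n : ℝ) ^ (1 / 8 : ℝ) with hR
  have hR0 : 0 < R := by positivity
  have hR2 : R ^ 2 = (n : ℝ) ^ (1 / 4 : ℝ) := by
    rw [hR, ← Real.rpow_natCast, ← Real.rpow_mul hn.le]; norm_num
  have hR3 : R ^ 3 = (n : ℝ) ^ (3 / 8 : ℝ) := by
    rw [hR, ← Real.rpow_natCast, ← Real.rpow_mul hn.le]; norm_num
  have hsq : (n : ℝ) ^ (1 / 2 : ℝ) = √n := (Real.sqrt_eq_rpow _).symm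
  rw [Real.rpow_one, ← hR2, one_mul] at h1
  rw [hsq] at h2 h3
  rw [← hR3] at h3
  have hg0 : (0 : ℝ) < g.card := lt_of_lt_of_le (by positivity) hg
  have hln : l * (n / 4) ≤ l * g.card := by gcongr
  refine (estimator_sensitivity hτ₂ hR0.le (by positivity) (by linarith) g D D' i hD hdes hx
    hx').trans ?_
  have e1 : (g.card : ℝ) * (τ₂ * R) / (l * g.card) = τ₂ * R / l := by field_simp
  rw [e1]
  -- With `R = n ^ (1/8)` the bracket is of order `n ^ (3/8)`, which is `o(√n)`; any exponent of `R`
  -- in `(0, 1/6)` would do here.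
  calc 4 * R * (τ₂ + R * (τ₂ * R / l)) / (l * g.card)
      ≤ 4 * R * (τ₂ + R * (τ₂ * R / l)) / (l * (n / 4)) := by gcongr
    _ = τ₂ * (16 / l * R + 16 / l ^ 2 * R ^ 3) / n := by field_simp; ring
    _ ≤ τ₂ * (C₀ * √n) / n := by gcongr; linarith
    _ = C₀ * τ₂ / √n := by
        have : √(n : ℝ) * √n = n := Real.mul_self_sqrt hn.le
        have hs : 0 < √(n : ℝ) := Real.sqrt_pos.2 hn
        rw [div_eq_div_iff hn.ne' hs.ne']
        linear_combination (τ₂ * C₀) * this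

theorem sensBound_pos {C₀ τ₂ m : ℝ} (hd : 1 ≤ d) (hC₀ : 0 < C₀) (hτ₂ : 0 < τ₂)
    (hm : 1 ≤ Real.log m) (hm0 : 0 < m) : 0 < sensBound C₀ τ₂ d m :=
  lt_of_lt_of_le (by positivity) (le_sensBound hd hC₀.le hτ₂.le hm hm0 le_rfl)

/-- Privacy can fail only if one of three designs is degenerate or one of `n + 1` covariates exceeds
`n ^ (1/8)`. These probabilities decay like `exp (-c n)` and `exp (-c n ^ (1/4))`, eventually below
any `C₁ * n ^ (-ω)`. -/
theorem eventually_isRJDP (hd : 1 ≤ d) {σ κ2 δ C₀ C₁ ω : ℝ} (hσ : 0 < σ) (hκ2 : 0 < κ2)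
    (hC₀ : 0 < C₀) (hC₁ : 0 < C₁) (hω : 0 < ω) (τθ C : ℝ) :
    ∀ᶠ n : ℕ in atTop, ∀ P : Population d, SubGaussianVec σ P.covariate →
      (∀ w : Fin d → ℝ,
        κ2 * ‖WithLp.toLp 2 w‖ ≤ ‖WithLp.toLp 2 (P.covarianceMatrix *ᵥ w)‖) →
      ∀ (τ a₂ : ℝ) (g : Finset (Fin n)), IsBalanced g → ∀ strat : Fin n → Strategy d,
        IsRJDP (mechanism P (linearParams d σ τθ δ C C₀ C₁ ω n τ a₂) g)
          ((linearParams d σ τθ δ C C₀ C₁ ω n τ a₂).noiseLaw d) (P.neighborLaw n)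
          (fun z => reports strat z.1)
          (fun i z => reports strat (Function.update z.1 i z.2)) (2 * (n : ℝ) ^ (-δ))
          (confidence C₁ ω n) := by
  obtain ⟨l, c, hl, hc, hdes⟩ := Population.exists_design_concentration hd σ κ2 hκ2
  have hconst : 0 < C₁ * (1 + 2 * 2 ^ ω) := by positivity
  -- `6 * d ^ 2` adds the failure bounds `2 * d ^ 2` of the three designs; `4 * d` covers the
  -- covariates of the `n` agents and of the fresh type. Each of the two gets half of `C₁ * n ^
  -- (-ω)`.
  filter_upwards [eventually_ge_atTop 2, eventually_sensitivity hd hl hC₀, eventually_one_le_log,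
    eventually_rpow_le (C₁ * (1 + 2 * 2 ^ ω)) (show -ω < 0 by linarith) (show (0 : ℝ) < 1 / 2 by
      norm_num),
    eventually_exp_le (6 * d ^ 2) ω (show 0 < c / 4 by positivity) one_pos
      (show 0 < C₁ / 2 by positivity),
    eventually_exp_le (4 * d) ω (show 0 < 1 / (2 * σ ^ 2) by positivity)
      (show (0 : ℝ) < 1 / 4 by norm_num) (show 0 < C₁ / 2 by positivity)]
    with n hn2 hsens hlog hconf hexp1 hexp2
  intro P hsub hcov τ a₂ g hg strat
  have hn : (0 : ℝ) < n := by positivity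
  have hn2' : (2 : ℝ) ≤ n := by exact_mod_cast hn2
  have hlogn : 1 ≤ Real.log n := hlog.trans (Real.log_le_log (by positivity) (by linarith))
  obtain ⟨hgq, hgcq⟩ := hg.quarter_le hn2
  have huq : (n : ℝ) / 4 ≤ (Finset.univ : Finset (Fin n)).card := by
    simp; linarith
  set m := linearParams d σ τθ δ C C₀ C₁ ω n τ a₂ with hm
  set R : ℝ := (n : ℝ) ^ (1 / 8 : ℝ) with hR
  have hτ₂ : 0 < clipLevel δ n := by unfold clipLevel; positivity
  rw [Real.rpow_zero, mul_one] at hconf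
  refine ⟨by positivity, ⟨?_, ?_⟩, fun i => ?_⟩
  · rw [confidence_eq C₁ ω (by omega)]; positivity
  · rw [confidence_eq C₁ ω (by omega)]; linarith
  obtain ⟨E₀, hE₀m, hE₀, hE₀p⟩ := hdes P hsub hcov n Finset.univ
  obtain ⟨E₁, hE₁m, hE₁, hE₁p⟩ := hdes P hsub hcov n g
  obtain ⟨E₂, hE₂m, hE₂, hE₂p⟩ := hdes P hsub hcov n gᶜ
  set T : Set (AgentType d) := {t | R ≤ ‖t.1.1‖} with hT
  have hTm : MeasurableSet T := measurableSet_le measurable_const (by fun_prop)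
  have hTm' : MeasurableSet {t : Fin n → AgentType d | ∃ i, t i ∈ T} := by
    have : {t : Fin n → AgentType d | ∃ i, t i ∈ T} = ⋃ i, Function.eval i ⁻¹' T := by
      ext t; simp
    rw [this]
    exact MeasurableSet.iUnion fun i => (measurable_pi_apply i) hTm
  set U : Set (Fin n → AgentType d) := ((E₀ᶜ ∪ E₁ᶜ) ∪ E₂ᶜ) ∪ {t | ∃ i, t i ∈ T} with hU
  have hUm : MeasurableSet U :=
    ((hE₀m.compl.union hE₁m.compl).union hE₂m.compl).union hTm'
  -- The failure set need not be measurable, the strategies being arbitrary; it is covered by a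
  -- measurable set that depends on covariates alone.
  have hbad : {z : (Fin n → AgentType d) × AgentType d | ¬ JDPBound (mechanism P m g)
      (m.noiseLaw d) (2 * (n : ℝ) ^ (-δ)) i (reports strat z.1)
      (reports strat (Function.update z.1 i z.2))} ⊆ Prod.fst ⁻¹' U ∪ Prod.snd ⁻¹' T := by
    intro z hz
    by_contra hcon
    simp only [hU, hT, mem_union, mem_preimage, mem_compl_iff, mem_ofPred_eq, not_or, not_not,
      not_exists, not_le] at hcon hz
    obtain ⟨⟨⟨⟨h0, h1⟩, h2⟩, h3⟩, h4⟩ := hcon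
    have hD : ∀ j, j ≠ i → reports strat (Function.update z.1 i z.2) j = reports strat z.1 j := by
      intro j hj
      simp [reports, hj]
    have hx : ∀ j, ‖(reports strat z.1 j).1‖ ≤ R := fun j => (h3 j).le
    have hx' : ‖(reports strat (Function.update z.1 i z.2) i).1‖ ≤ R := by
      simpa [reports] using h4.le
    refine hz (jdpBound_mechanism hd P m (by simp only [hm, linearParams]; positivity)
      (sensBound_pos hd hC₀ hτ₂ hlogn hn) (sensBound_pos hd hC₀ hτ₂ hlog (by positivity))
      g _ _ i hD ?_ ?_ ?_)
    · exact hsens _ hτ₂.le n le_rfl hlogn hn _ huq _ _ i hD (hE₀ _ h0) hx hx'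
    · exact hsens _ hτ₂.le _ (by linarith) hlog (by positivity) _ hgq _ _ i hD (hE₁ _ h1) hx hx'
    · exact hsens _ hτ₂.le _ (by linarith) hlog (by positivity) _ hgcq _ _ i hD (hE₂ _ h2) hx hx'
  refine (measure_mono hbad).trans (P.neighborLaw_le n
    ((measurable_fst hUm).union (measurable_snd hTm)) fun θ => ?_)
  have hexpg : ∀ h : Finset (Fin n), (n : ℝ) / 4 ≤ h.card →
      2 * (d : ℝ) ^ 2 * Real.exp (-c * h.card) ≤
        2 * d ^ 2 * Real.exp (-(c / 4) * (n : ℝ) ^ (1 : ℝ)) := by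
    intro h hh
    gcongr ?_ * Real.exp ?_
    rw [Real.rpow_one]
    nlinarith
  have hT1 : (P.typeKernel θ).real T ≤ 2 * d * Real.exp (-(1 / (2 * σ ^ 2)) * (n : ℝ) ^ (1 / 4 : ℝ)) := by
    refine (P.typeKernel_norm_tail hd hsub θ (by positivity)).trans (le_of_eq ?_)
    have hR2 : R ^ 2 = (n : ℝ) ^ (1 / 4 : ℝ) := by
      rw [hR, ← Real.rpow_natCast, ← Real.rpow_mul hn.le]; norm_num
    rw [hR2]
    congr 2
    field_simp
  have hU1 : (P.profileKernel n θ).real U ≤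
      6 * d ^ 2 * Real.exp (-(c / 4) * (n : ℝ) ^ (1 : ℝ)) +
        n * (2 * d * Real.exp (-(1 / (2 * σ ^ 2)) * (n : ℝ) ^ (1 / 4 : ℝ))) := by
    have b0 := (hE₀p θ).trans (hexpg _ huq)
    have b1 := (hE₁p θ).trans (hexpg _ hgq)
    have b2 := (hE₂p θ).trans (hexpg _ hgcq)
    have b3 := (P.profileKernel_exists_mem_le n θ hTm).trans
      (mul_le_mul_of_nonneg_left hT1 hn.le)
    have u1 := measureReal_union_le (μ := P.profileKernel n θ) ((E₀ᶜ ∪ E₁ᶜ) ∪ E₂ᶜ)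
      {t | ∃ i, t i ∈ T}
    have u2 := measureReal_union_le (μ := P.profileKernel n θ) (E₀ᶜ ∪ E₁ᶜ) E₂ᶜ
    have u3 := measureReal_union_le (μ := P.profileKernel n θ) E₀ᶜ E₁ᶜ
    linarith
  have hfst : ((P.profileKernel n θ).prod (P.typeKernel θ)).real (Prod.fst ⁻¹' U) =
      (P.profileKernel n θ).real U :=
    measurePreserving_fst.measureReal_preimage hUm.nullMeasurableSet
  have hsnd : ((P.profileKernel n θ).prod (P.typeKernel θ)).real (Prod.snd ⁻¹' T) =
      (P.typeKernel θ).real T :=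
    measurePreserving_snd.measureReal_preimage hTm.nullMeasurableSet
  refine (measureReal_union_le _ _).trans ?_
  rw [hfst, hsnd]
  set e1 := Real.exp (-(c / 4) * (n : ℝ) ^ (1 : ℝ))
  set e2 := Real.exp (-(1 / (2 * σ ^ 2)) * (n : ℝ) ^ (1 / 4 : ℝ))
  have he1 : 0 < e1 := Real.exp_pos _
  have he2 : 0 < e2 := Real.exp_pos _
  have f1 : 6 * (d : ℝ) ^ 2 * e1 ≤ 6 * d ^ 2 * n * e1 := by
    have hpos : 0 ≤ 6 * (d : ℝ) ^ 2 * e1 := by positivity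
    nlinarith
  have f2 : (2 : ℝ) * d * e2 ≤ n * (2 * d * e2) := le_mul_of_one_le_left (by positivity) (by linarith)
  have f3 : C₁ * (n : ℝ) ^ (-ω) ≤ confidence C₁ ω n := by
    unfold confidence
    have : 0 ≤ 2 * (C₁ * ((n : ℝ) / 2) ^ (-ω)) := by positivity
    linarith
  linarith

end Privacy

/-! ### The event of high probability -/

section GoodEvent

variable {d n : ℕ}

/-- Types with a bounded parameter, a well-behaved design in `E`, covariates below `r₁`, residuals
below `r₂`, nonnegative costs, a weighted sum of residuals below `r₃` and at least `(1 - α) n`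
costs below `τ`. -/
def goodEvent (d n : ℕ) (E : Set (Fin n → AgentType d)) (τθ r₁ r₂ r₃ α τ : ℝ) :
    Set (Vec d × (Fin n → AgentType d)) :=
  {w | (‖w.1‖ ≤ τθ ∧ w.2 ∈ E ∧ (∀ i, ‖(w.2 i).1.1‖ < r₁) ∧
    (∀ i, |(w.2 i).1.2 - inner ℝ w.1 (w.2 i).1.1| < r₂) ∧ (∀ i, 0 ≤ (w.2 i).2) ∧
    ‖∑ j, ((w.2 j).1.2 - inner ℝ w.1 (w.2 j).1.1) • (w.2 j).1.1‖ < r₃)} ∩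
  {w | (1 - α) * n ≤ ({i : Fin n | (w.2 i).2 ≤ τ} : Set (Fin n)).ncard}

theorem measurableSet_regular {E : Set (Fin n → AgentType d)} (hE : MeasurableSet E)
    (τθ r₁ r₂ r₃ : ℝ) :
    MeasurableSet {w : Vec d × (Fin n → AgentType d) | ‖w.1‖ ≤ τθ ∧ w.2 ∈ E ∧
      (∀ i, ‖(w.2 i).1.1‖ < r₁) ∧
      (∀ i, |(w.2 i).1.2 - inner ℝ w.1 (w.2 i).1.1| < r₂) ∧ (∀ i, 0 ≤ (w.2 i).2) ∧
      ‖∑ j, ((w.2 j).1.2 - inner ℝ w.1 (w.2 j).1.1) • (w.2 j).1.1‖ < r₃} := by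
  have hres : ∀ i : Fin n, Measurable fun w : Vec d × (Fin n → AgentType d) =>
      (w.2 i).1.2 - inner ℝ w.1 (w.2 i).1.1 := fun i => by fun_prop
  have h₁ : MeasurableSet {w : Vec d × (Fin n → AgentType d) | ∀ i, ‖(w.2 i).1.1‖ < r₁} := by
    simp only [ofPred_forall]
    exact MeasurableSet.iInter fun i => measurableSet_lt (by fun_prop) measurable_const
  have h₂ : MeasurableSet {w : Vec d × (Fin n → AgentType d) |
      ∀ i, |(w.2 i).1.2 - inner ℝ w.1 (w.2 i).1.1| < r₂} := by
    simp only [ofPred_forall]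
    exact MeasurableSet.iInter fun i => measurableSet_lt (hres i).norm measurable_const
  have h₃ : MeasurableSet {w : Vec d × (Fin n → AgentType d) | ∀ i, 0 ≤ (w.2 i).2} := by
    simp only [ofPred_forall]
    exact MeasurableSet.iInter fun i => measurableSet_le measurable_const (by fun_prop)
  have h₄ : MeasurableSet {w : Vec d × (Fin n → AgentType d) |
      ‖∑ j, ((w.2 j).1.2 - inner ℝ w.1 (w.2 j).1.1) • (w.2 j).1.1‖ < r₃} := by
    refine measurableSet_lt (Measurable.norm ?_) measurable_const
    exact Finset.measurable_fun_sum _ fun j _ => (hres j).smul (by fun_prop)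
  exact (measurableSet_le measurable_fst.norm measurable_const).inter
    ((measurable_snd hE).inter (h₁.inter (h₂.inter (h₃.inter h₄))))

theorem measurableSet_goodEvent {E : Set (Fin n → AgentType d)} (hE : MeasurableSet E)
    (τθ r₁ r₂ r₃ α τ : ℝ) : MeasurableSet (goodEvent d n E τθ r₁ r₂ r₃ α τ) :=
  (measurableSet_regular hE τθ r₁ r₂ r₃).inter (Population.measurableSet_count n α τ)

/-- Union bound, in two layers: the regularity conditions are controlled conditionally on the
parameter, whereas the count of small costs is only known to be large under the joint law. -/
theorem le_jointLaw_goodEvent (hd : 1 ≤ d) (P : Population d) {σ τθ : ℝ}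
    (hsub : SubGaussianVec σ P.covariate) (hprior : ∀ᵐ θ ∂P.prior, ‖θ‖ ≤ τθ)
    (hcost : ∀ z : Sample d, ∀ᵐ c ∂(P.cost z), 0 ≤ c)
    {E : Set (Fin n → AgentType d)} (hE : MeasurableSet E) {e r₁ r₂ r₃ α β τ : ℝ}
    (he : ∀ θ, (P.profileKernel n θ).real Eᶜ ≤ e)
    (hr₁ : 0 ≤ r₁) (hr₂ : 0 ≤ r₂) (hr₃ : 0 < r₃)
    (hcount : 1 - β ≤ (P.jointLaw n).real
      {w | (1 - α) * n ≤ ({i : Fin n | (w.2 i).2 ≤ τ} : Set (Fin n)).ncard}) :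
    1 - (e + n * (2 * d * Real.exp (-r₁ ^ 2 / (2 * σ ^ 2))) +
      n * (2 * Real.exp (-r₂ ^ 2 / (2 * (P.noiseSd : ℝ) ^ 2))) +
      n * (2 * d ^ 2 * (P.noiseSd : ℝ) ^ 2 * fourthMoment σ d) / r₃ ^ 2 + β) ≤
    (P.jointLaw n).real (goodEvent d n E τθ r₁ r₂ r₃ α τ) := by
  have hreg := measurableSet_regular hE τθ r₁ r₂ r₃
  set A := {w : Vec d × (Fin n → AgentType d) | ‖w.1‖ ≤ τθ ∧ w.2 ∈ E ∧
      (∀ i, ‖(w.2 i).1.1‖ < r₁) ∧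
      (∀ i, |(w.2 i).1.2 - inner ℝ w.1 (w.2 i).1.1| < r₂) ∧ (∀ i, 0 ≤ (w.2 i).2) ∧
      ‖∑ j, ((w.2 j).1.2 - inner ℝ w.1 (w.2 j).1.1) • (w.2 j).1.1‖ < r₃} with hA
  have he0 : 0 ≤ e := measureReal_nonneg.trans (he 0)
  have hM : 0 ≤ fourthMoment σ d := zero_le_one.trans (one_le_fourthMoment hd σ)
  have hbad : (P.jointLaw n).real Aᶜ ≤ e + n * (2 * d * Real.exp (-r₁ ^ 2 / (2 * σ ^ 2))) +
      n * (2 * Real.exp (-r₂ ^ 2 / (2 * (P.noiseSd : ℝ) ^ 2))) +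
      n * (2 * d ^ 2 * (P.noiseSd : ℝ) ^ 2 * fourthMoment σ d) / r₃ ^ 2 := by
    refine P.jointLaw_real_le n hreg.compl (by positivity) ?_
    filter_upwards [hprior] with θ hθ
    set T₁ : Set (AgentType d) := {t | r₁ ≤ ‖t.1.1‖} with hT₁
    set T₂ : Set (AgentType d) := {t | r₂ ≤ |t.1.2 - inner ℝ θ t.1.1|} with hT₂
    set T₃ : Set (AgentType d) := {t | t.2 < 0} with hT₃
    have hm₁ : MeasurableSet T₁ := measurableSet_le measurable_const (by fun_prop)
    have hm₂ : MeasurableSet T₂ := measurableSet_le measurable_const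
      (Measurable.norm (f := fun t : AgentType d => t.1.2 - inner ℝ θ t.1.1) (by fun_prop))
    have hm₃ : MeasurableSet T₃ := measurableSet_lt (by fun_prop) measurable_const
    set V : Set (Fin n → AgentType d) :=
      {t | r₃ ≤ ‖∑ j, ((t j).1.2 - inner ℝ θ (t j).1.1) • (t j).1.1‖} with hV
    have hsubset : {t : Fin n → AgentType d | (θ, t) ∈ Aᶜ} ⊆
        (((Eᶜ ∪ {t | ∃ i, t i ∈ T₁}) ∪ {t | ∃ i, t i ∈ T₂}) ∪ {t | ∃ i, t i ∈ T₃}) ∪ V := by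
      intro t ht
      by_contra hcon
      simp only [hV, hT₁, hT₂, hT₃, mem_union, mem_compl_iff, mem_ofPred_eq, not_or, not_not,
        not_exists, not_le, not_lt, hA] at hcon ht
      obtain ⟨⟨⟨⟨h0, h1⟩, h2⟩, h3⟩, h4⟩ := hcon
      exact ht ⟨hθ, h0, h1, h2, h3, h4⟩
    have b₀ := he θ
    have b₁ := (P.profileKernel_exists_mem_le n θ hm₁).trans
      (mul_le_mul_of_nonneg_left (P.typeKernel_norm_tail hd hsub θ hr₁) (Nat.cast_nonneg n))
    have b₂ := (P.profileKernel_exists_mem_le n θ hm₂).trans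
      (mul_le_mul_of_nonneg_left (P.typeKernel_residual_tail θ hr₂) (Nat.cast_nonneg n))
    have b₃ := P.profileKernel_exists_mem_le n θ hm₃
    rw [P.typeKernel_ae_cost_nonneg hcost θ, mul_zero] at b₃
    have b₄ := P.profileKernel_residual_sum_tail hd hsub n θ hr₃
    have u₁ := measureReal_union_le (μ := P.profileKernel n θ)
      (((Eᶜ ∪ {t | ∃ i, t i ∈ T₁}) ∪ {t | ∃ i, t i ∈ T₂}) ∪ {t | ∃ i, t i ∈ T₃}) V
    have u₂ := measureReal_union_le (μ := P.profileKernel n θ)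
      ((Eᶜ ∪ {t | ∃ i, t i ∈ T₁}) ∪ {t | ∃ i, t i ∈ T₂}) {t | ∃ i, t i ∈ T₃}
    have u₃ := measureReal_union_le (μ := P.profileKernel n θ)
      (Eᶜ ∪ {t | ∃ i, t i ∈ T₁}) {t | ∃ i, t i ∈ T₂}
    have u₄ := measureReal_union_le (μ := P.profileKernel n θ) Eᶜ {t | ∃ i, t i ∈ T₁}
    refine (measureReal_mono hsubset).trans ?_
    linarith
  have hcm := Population.measurableSet_count (d := d) n α τ
  have h1 := probReal_compl_eq_one_sub (μ := P.jointLaw n) hcm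
  have h2 := probReal_compl_eq_one_sub (μ := P.jointLaw n)
    (measurableSet_goodEvent hE τθ r₁ r₂ r₃ α τ)
  have h3 : (goodEvent d n E τθ r₁ r₂ r₃ α τ)ᶜ = Aᶜ ∪ {w | (1 - α) * n ≤
      (({i : Fin n | (w.2 i).2 ≤ τ} : Set (Fin n)).ncard : ℝ)}ᶜ := compl_inter _ _
  have h4 := measureReal_union_le (μ := P.jointLaw n) Aᶜ {w | (1 - α) * n ≤
      (({i : Fin n | (w.2 i).2 ≤ τ} : Set (Fin n)).ncard : ℝ)}ᶜ
  rw [← h3] at h4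
  linarith

/-- On the good event the least squares estimator is accurate whatever the non-participants do. -/
theorem estimator_accuracy_of_goodEvent {E : Set (Fin n → AgentType d)}
    {τθ r₁ r₂ r₃ α τ τ₂ l : ℝ} (hn : 0 < n) (hl : 0 < l)
    (hE : ∀ t ∈ E, DesignBound Finset.univ (fun j => (t j).1.1) (l * n)) (hr₁ : 0 ≤ r₁)
    (hτ₂ : τθ * r₁ + r₂ ≤ τ₂) (hτ₂0 : 0 ≤ τ₂) {θ : Vec d} {t : Fin n → AgentType d}
    (h : (θ, t) ∈ goodEvent d n E τθ r₁ r₂ r₃ α τ) {strat : Fin n → Strategy d}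
    (hstrat : ∀ i, IsThresholdStrategy τ (strat i)) :
    ‖estimator τ₂ Finset.univ (reports strat t) - θ‖ ≤ (r₃ + α * n * (2 * τ₂ * r₁)) / (l * n) := by
  obtain ⟨⟨hθ, hEt, hx, hres, hc, hsum⟩, hcount⟩ := h
  have hn' : (0 : ℝ) < n := by exact_mod_cast hn
  simp only [mem_ofPred_eq] at hcount hθ hx hres hsum
  have hy : ∀ j, |(t j).1.2| ≤ τ₂ := by
    intro j
    have h1 : |inner ℝ θ (t j).1.1| ≤ τθ * r₁ := (abs_real_inner_le_norm _ _).trans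
      (mul_le_mul hθ (hx j).le (norm_nonneg _) ((norm_nonneg _).trans hθ))
    have h2 := abs_add_le ((t j).1.2 - inner ℝ θ (t j).1.1) (inner ℝ θ (t j).1.1)
    rw [sub_add_cancel] at h2
    linarith [hres j]
  -- A threshold strategy can misreport only when the cost exceeds `τ`, and at most `α * n` agents
  -- are in that case.
  have hb : (((Finset.univ : Finset (Fin n)).filter
      fun j => strat j (t j) ≠ (t j).1.2).card : ℝ) ≤ α * n := by
    have h1 : (Finset.univ.filter fun j => strat j (t j) ≠ (t j).1.2) ⊆
        (Finset.univ.filter fun j : Fin n => (t j).2 ≤ τ)ᶜ := by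
      intro j hj
      simp only [Finset.mem_filter, Finset.mem_univ, true_and, Finset.mem_compl] at hj ⊢
      exact fun hle => hj ((hstrat j).2 _ hle)
    have h2 : ({i : Fin n | (t i).2 ≤ τ} : Set (Fin n)).ncard =
        (Finset.univ.filter fun j : Fin n => (t j).2 ≤ τ).card := by
      rw [ncard_eq_toFinset_card']
      congr 1
      ext j
      simp
    have h3 := Finset.card_le_card h1
    have h4 := Finset.card_add_card_compl (Finset.univ.filter fun j : Fin n => (t j).2 ≤ τ)
    rw [Fintype.card_fin] at h4
    rw [h2] at hcount
    have h5 : ((Finset.univ.filter fun j => strat j (t j) ≠ (t j).1.2).card : ℝ) ≤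
        ((Finset.univ.filter fun j : Fin n => (t j).2 ≤ τ)ᶜ.card : ℝ) := by exact_mod_cast h3
    have h6 : ((Finset.univ.filter fun j : Fin n => (t j).2 ≤ τ).card : ℝ) +
        ((Finset.univ.filter fun j : Fin n => (t j).2 ≤ τ)ᶜ.card : ℝ) = n := by exact_mod_cast h4
    linarith
  refine (estimator_accuracy hτ₂0 hr₁ (by positivity) Finset.univ (fun j => (t j).1.1)
    (fun j => (t j).1.2) (fun j => strat j (t j)) θ (hE t hEt) (fun j => (hx j).le) hy hb).trans ?_
  gcongr

/-- The squared clipping level `n ^ (1 - 3δ)`, divided by the sample size and by `n ^ (-2δ)`, is `n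
^ (-δ)`: this privacy noise term sets the rate of the accuracy bound. -/
theorem sensBound_div_sq (d : ℕ) (C₀ δ : ℝ) (hn : 0 < n) (hlog : 0 ≤ Real.log n) :
    (sensBound C₀ (clipLevel δ n) d n / (n : ℝ) ^ (-δ)) ^ 2 =
      C₀ ^ 2 * d * ((n : ℝ) ^ (-δ) * Real.log n) := by
  have hn' : (0 : ℝ) < n := by exact_mod_cast hn
  unfold sensBound clipLevel
  rw [div_pow, mul_pow, mul_pow, div_pow, Real.sq_sqrt (mul_nonneg d.cast_nonneg hlog), Real.sq_sqrt hn'.le]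
  have e1 : ((n : ℝ) ^ ((1 - 3 * δ) / 2)) ^ 2 = (n : ℝ) ^ (-δ) * n * ((n : ℝ) ^ (-δ)) ^ 2 := by
    rw [← Real.rpow_natCast, ← Real.rpow_natCast, ← Real.rpow_mul hn'.le, ← Real.rpow_mul hn'.le,
      ← Real.rpow_add_one hn'.ne', ← Real.rpow_add hn']
    congr 1; push_cast; ring
  rw [e1]
  have : (n : ℝ) ^ (-δ) ≠ 0 := by positivity
  field_simp

/-- Accuracy of the released estimator on the good event. -/
theorem integral_privateEstimator_le_of_goodEvent (hd : 1 ≤ d) {σ τθ δ C C₀ C₁ ω l ua α τ a₂ r₂ : ℝ}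
    {E : Set (Fin n → AgentType d)} (hn : 0 < n) (hlog2 : 1 ≤ Real.log ((n : ℝ) / 2))
    (hδ : 1 / 4 < δ) (hl : 0 < l) (hC₀ : 0 < C₀) (hCσ : 0 < C * σ) (hτθ : 0 ≤ τθ) (hua : 0 ≤ ua)
    (hα : α ≤ ua * (n : ℝ) ^ (-(3 * δ)))
    (hclip : τθ * (C * σ * √(Real.log n)) + r₂ ≤ clipLevel δ n)
    (hE : ∀ t ∈ E, DesignBound Finset.univ (fun j => (t j).1.1) (l * n))
    {θ : Vec d} {t : Fin n → AgentType d}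
    (h : (θ, t) ∈ goodEvent d n E τθ (C * σ * √(Real.log n)) r₂ ((n : ℝ) ^ (1 - δ / 2)) α τ)
    {strat : Fin n → Strategy d} (hstrat : ∀ i, IsThresholdStrategy τ (strat i)) :
    ∫ v, ‖privateEstimator (linearParams d σ τθ δ C C₀ C₁ ω n τ a₂) (reports strat t) v - θ‖ ^ 2
        ∂((linearParams d σ τθ δ C C₀ C₁ ω n τ a₂).noiseLaw d) ≤
      (2 * ((1 + ua * (2 * (C * σ))) / l) ^ 2 + 2 * (8 * 2 ^ d * (C₀ ^ 2 * d))) *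
        ((n : ℝ) ^ (-δ) * Real.log n) := by
  have hn' : (0 : ℝ) < n := by exact_mod_cast hn
  have hn1 : (1 : ℝ) ≤ n := by exact_mod_cast hn
  have hlog : 1 ≤ Real.log n := hlog2.trans (Real.log_le_log (by positivity) (by linarith))
  have hclip0 : 0 < clipLevel δ n := by unfold clipLevel; positivity
  have hacc := estimator_accuracy_of_goodEvent hn hl hE (by positivity) hclip hclip0.le h hstrat
  refine (integral_privateEstimator_le hd (linearParams d σ τθ δ C C₀ C₁ ω n τ a₂)
    (by simp only [linearParams]; positivity) (sensBound_pos hd hC₀ hclip0 hlog hn')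
    (sensBound_pos hd hC₀ hclip0 hlog2 (by positivity)) hτθ _ θ h.1.1).trans ?_
  simp only [linearParams]
  rw [sensBound_div_sq d C₀ δ hn (by linarith)]
  set L := Real.log n
  set q := (n : ℝ) ^ (-(δ / 2)) with hq
  have hq0 : 0 < q := by positivity
  have hsqrt2 : 1 ≤ √L := Real.one_le_sqrt.2 hlog
  have hest : ‖estimator (clipLevel δ n) Finset.univ (reports strat t) - θ‖ ≤
      (1 + ua * (2 * (C * σ))) / l * (q * √L) := by
    refine hacc.trans ?_
    rw [div_le_iff₀ (by positivity)]
    have e1 : (n : ℝ) ^ (1 - δ / 2) = n * q := by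
      rw [sub_eq_add_neg, Real.rpow_add hn', Real.rpow_one]
    -- The exponents compare as soon as `δ ≥ 1/8`, so misreports cost no more than the residuals, up
    -- to the logarithm.
    have e2 : (n : ℝ) ^ (-(3 * δ)) * clipLevel δ n ≤ q := by
      unfold clipLevel
      rw [← Real.rpow_add hn']
      exact Real.rpow_le_rpow_of_exponent_le hn1 (by linarith)
    have e3 : α * n * (2 * clipLevel δ n * (C * σ * √L)) ≤
        ua * (2 * (C * σ)) * (n * (q * √L)) := by
      calc α * n * (2 * clipLevel δ n * (C * σ * √L))
          ≤ ua * (n : ℝ) ^ (-(3 * δ)) * n * (2 * clipLevel δ n * (C * σ * √L)) := by gcongr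
        _ = ua * (2 * (C * σ)) * (n * (((n : ℝ) ^ (-(3 * δ)) * clipLevel δ n) * √L)) := by ring
        _ ≤ _ := by gcongr
    have e4 : (n : ℝ) * q ≤ n * (q * √L) := by
      gcongr
      exact le_mul_of_one_le_right hq0.le hsqrt2
    have e5 : (1 + ua * (2 * (C * σ))) / l * (q * √L) * (l * n) =
        (1 + ua * (2 * (C * σ))) * (n * (q * √L)) := by
      field_simp
    rw [e5, e1]
    linarith
  have hsq : (q * √L) ^ 2 = (n : ℝ) ^ (-δ) * L := by
    rw [mul_pow, Real.sq_sqrt (by linarith), hq, ← Real.rpow_natCast, ← Real.rpow_mul hn'.le]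
    congr 2; push_cast; ring
  have hestsq : ‖estimator (clipLevel δ n) Finset.univ (reports strat t) - θ‖ ^ 2 ≤
      ((1 + ua * (2 * (C * σ))) / l) ^ 2 * ((n : ℝ) ^ (-δ) * L) := by
    rw [← hsq, ← mul_pow]
    gcongr
  linarith

/-- The threshold grows at most logarithmically. -/
theorem threshold_log_bounds (P : Population d) (hs : 0 < P.noiseSd) {lam c δ lα lβ α β : ℝ}
    (hlam : 0 < lam) (hc : 0 < c)
    (htail : ∀ (z : Sample d) (τ : ℝ), 1 - Real.exp (-lam * τ) ≤ (P.costBelief z).real (Iic τ))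
    (hlog : 1 ≤ Real.log n) (hα : lα * (n : ℝ) ^ (-(3 * δ)) ≤ α) (hβ : lβ * (n : ℝ) ^ (-c) ≤ β)
    (h1 : (n : ℝ) ^ (-(c + 2)) ≤ lβ * (n : ℝ) ^ (-c))
    (h2 : (n : ℝ) ^ (-(c + 3)) ≤ lα * (n : ℝ) ^ (-(3 * δ))) :
    P.threshold n α β ≤ (c + 3) / lam * Real.log n ∧
      1 - β ≤ (P.jointLaw n).real {w | (1 - α) * n ≤
        ({i : Fin n | (w.2 i).2 ≤ P.threshold n α β} : Set (Fin n)).ncard} := by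
  have hn : (0 : ℝ) < n := by
    by_contra hcon
    have : (n : ℝ) = 0 := le_antisymm (not_lt.1 hcon) (Nat.cast_nonneg n)
    rw [this, Real.log_zero] at hlog
    linarith
  -- At this level a single cost tail is `n ^ (-(c + 3))` and the union over agents gives `n ^ (-(c
  -- + 2))`; these fall below `α` and `β` by `h2` and `h1`.
  have hexpT : Real.exp (-lam * ((c + 3) / lam * Real.log n)) = (n : ℝ) ^ (-(c + 3)) := by
    rw [Real.rpow_def_of_pos hn]
    congr 1
    field_simp
  have hTα : Real.exp (-lam * ((c + 3) / lam * Real.log n)) ≤ α := by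
    rw [hexpT]; linarith
  have hTβ : n * Real.exp (-lam * ((c + 3) / lam * Real.log n)) ≤ β := by
    have : (n : ℝ) * (n : ℝ) ^ (-(c + 3)) = (n : ℝ) ^ (-(c + 2)) := by
      rw [mul_comm, ← Real.rpow_add_one hn.ne']
      congr 1; ring
    rw [hexpT, this]; linarith
  have hTL : 0 < (c + 3) / lam * Real.log n := by positivity
  exact ⟨P.threshold_le hs htail n hTL hTα hTβ,
    P.le_jointLaw_count_threshold hs htail n hTL ((Real.exp_pos _).le.trans hTα) hTβ⟩

/-- The good event has high probability. -/
theorem one_sub_le_jointLaw_goodEvent (hd : 1 ≤ d) (P : Population d)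
    {σ s τθ δ C ρ u e α β τ : ℝ} (hσ : 0 < σ) (hC : 4 ≤ C) (hs : (P.noiseSd : ℝ) = s) (hn : 0 < n)
    (hlog : 1 ≤ Real.log n) (hδ : δ < 1 / 3) (hρ : ρ ≤ 1 / 2)
    (hsub : SubGaussianVec σ P.covariate) (hprior : ∀ᵐ θ ∂P.prior, ‖θ‖ ≤ τθ)
    (hcost : ∀ z : Sample d, ∀ᵐ c ∂(P.cost z), 0 ≤ c)
    {E : Set (Fin n → AgentType d)} (hE : MeasurableSet E)
    (he : ∀ θ, (P.profileKernel n θ).real Eᶜ ≤ e) (he' : e ≤ (n : ℝ) ^ (-1 : ℝ))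
    (hβ : β ≤ u * (n : ℝ) ^ (-ρ))
    (h1 : 2 * d * (n : ℝ) ^ (-7 : ℝ) ≤ (n : ℝ) ^ (-1 : ℝ))
    (h2 : 2 * n * Real.exp (-(1 / (2 * s ^ 2)) * (n : ℝ) ^ ((1 - 3 * δ) / 2)) ≤ (n : ℝ) ^ (-1 : ℝ))
    (hcount : 1 - β ≤ (P.jointLaw n).real
      {w | (1 - α) * n ≤ ({i : Fin n | (w.2 i).2 ≤ τ} : Set (Fin n)).ncard}) :
    1 - (3 + 2 * d ^ 2 * s ^ 2 * fourthMoment σ d + u) * (n : ℝ) ^ (-ρ) ≤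
      (P.jointLaw n).real (goodEvent d n E τθ (C * σ * √(Real.log n)) ((n : ℝ) ^ ((1 - 3 * δ) / 4))
        ((n : ℝ) ^ (1 - δ / 2)) α τ) := by
  have hn' : (0 : ℝ) < n := by exact_mod_cast hn
  have hn1 : (1 : ℝ) ≤ n := by exact_mod_cast hn
  have hM := one_le_fourthMoment hd σ
  refine le_trans ?_ (le_jointLaw_goodEvent hd P hsub hprior hcost hE he (by positivity)
    (by positivity) (by positivity) hcount)
  rw [hs]
  have hmono : ∀ {a b : ℝ}, a ≤ b → (n : ℝ) ^ a ≤ (n : ℝ) ^ b := fun h =>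
    Real.rpow_le_rpow_of_exponent_le hn1 h
  have hρ1 : (n : ℝ) ^ (-1 : ℝ) ≤ (n : ℝ) ^ (-ρ) := hmono (by linarith)
  have p2 : n * (2 * d * Real.exp (-(C * σ * √(Real.log n)) ^ 2 / (2 * σ ^ 2))) ≤
      (n : ℝ) ^ (-ρ) := by
    -- `C ≥ 4` gives `C ^ 2 / 2 ≥ 8`, so the union bound over the agents still leaves `n ^ (-7)`.
    have e1 : Real.exp (-(C * σ * √(Real.log n)) ^ 2 / (2 * σ ^ 2)) ≤ (n : ℝ) ^ (-8 : ℝ) := by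
      rw [Real.rpow_def_of_pos hn']
      refine Real.exp_le_exp.2 ?_
      have hexp : -(C * σ * √(Real.log n)) ^ 2 / (2 * σ ^ 2) = -(C ^ 2 / 2) * Real.log n := by
        rw [mul_pow, mul_pow, Real.sq_sqrt (by linarith)]
        field_simp
      have hC2 : 16 ≤ C ^ 2 := by nlinarith only [hC]
      have := mul_le_mul_of_nonneg_right hC2 (zero_le_one.trans hlog)
      linarith
    have e2 : (n : ℝ) ^ (-7 : ℝ) = (n : ℝ) ^ (-8 : ℝ) * n := by
      rw [← Real.rpow_add_one hn'.ne']; norm_num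
    calc _ ≤ n * (2 * d * (n : ℝ) ^ (-8 : ℝ)) := by gcongr
      _ = 2 * d * (n : ℝ) ^ (-7 : ℝ) := by rw [e2]; ring
      _ ≤ _ := by linarith
  have p3 : n * (2 * Real.exp (-((n : ℝ) ^ ((1 - 3 * δ) / 4)) ^ 2 / (2 * s ^ 2))) ≤
      (n : ℝ) ^ (-ρ) := by
    have e1 : ((n : ℝ) ^ ((1 - 3 * δ) / 4)) ^ 2 = (n : ℝ) ^ ((1 - 3 * δ) / 2) := by
      rw [← Real.rpow_natCast, ← Real.rpow_mul hn'.le]; congr 1; push_cast; ring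
    have e2 : -((n : ℝ) ^ ((1 - 3 * δ) / 4)) ^ 2 / (2 * s ^ 2) =
        -(1 / (2 * s ^ 2)) * (n : ℝ) ^ ((1 - 3 * δ) / 2) := by
      rw [e1]; field_simp
    rw [e2]
    linarith
  -- Chebyshev at level `n ^ (1 - δ/2)` leaves `n ^ (δ - 1)`, at most `n ^ (-ρ)` because `ρ + δ ≤
  -- 1`.
  have p4 : n * (2 * d ^ 2 * s ^ 2 * fourthMoment σ d) / ((n : ℝ) ^ (1 - δ / 2)) ^ 2 ≤
      2 * d ^ 2 * s ^ 2 * fourthMoment σ d * (n : ℝ) ^ (-ρ) := by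
    have e1 : ((n : ℝ) ^ (1 - δ / 2)) ^ 2 = (n : ℝ) ^ (2 - δ) := by
      rw [← Real.rpow_natCast, ← Real.rpow_mul hn'.le]; congr 1; push_cast; ring
    have e2 : (n : ℝ) ≤ (n : ℝ) ^ (-ρ) * (n : ℝ) ^ (2 - δ) := by
      rw [← Real.rpow_add hn']
      calc (n : ℝ) = (n : ℝ) ^ (1 : ℝ) := (Real.rpow_one _).symm
        _ ≤ _ := hmono (by linarith)
    rw [e1, div_le_iff₀ (by positivity), mul_assoc _ ((n : ℝ) ^ (-ρ)), mul_comm (n : ℝ) _]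
    gcongr
  linarith

end GoodEvent

end TruthfulRegression

end

/-! ### Choice of the constants and assembly of the theorem -/

open TruthfulRegression in
theorem mainTheorem1 (d : ℕ) (hd : 1 ≤ d)
    (σ s τθ κinf κ2 lam : ℝ) (hσ : 0 < σ) (hs : 0 < s) (hτθ : 0 < τθ) (hκinf : 0 < κinf)
    (hκ2 : 0 < κ2) (hlam : 0 < lam)
    (δ c : ℝ) (hδ : δ ∈ Set.Ioo (1 / 4 : ℝ) (1 / 3)) (hc : 0 < c)
    (C C₀ C₁ ω : ℝ) (hC : 4 ≤ C) (hC₀ : 0 < C₀) (hC₁ : 0 < C₁) (hω : 0 < ω)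
    (lα uα lβ uβ A : ℝ) (hlα : 0 < lα) (hlβ : 0 < lβ) (hA : 0 < A) :
    ∃ (K ρ : ℝ) (k N : ℕ), 0 < K ∧ 0 < ρ ∧
      ∀ n : ℕ, N ≤ n →
      ∀ P : Population d, P.Admissible σ s τθ κinf κ2 lam →
      ∀ α ∈ Set.Icc (lα * (n : ℝ) ^ (-(3 * δ))) (uα * (n : ℝ) ^ (-(3 * δ))),
      ∀ β ∈ Set.Icc (lβ * (n : ℝ) ^ (-c)) (uβ * (n : ℝ) ^ (-c)),
      ∀ a₂ ∈ Set.Ioc 0 (A * (n : ℝ) ^ (-(4 * δ))),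
      ∀ f : Fin n → ℝ → ℝ → ℝ → ℝ,
        (∀ i, ∀ cᵢ ε γ : ℝ, 0 ≤ cᵢ → 0 < ε → 0 ≤ γ → f i cᵢ ε γ ≤ cᵢ * costBound ε γ) →
      let τ : ℝ := P.threshold n α β
      let m : MechParams := linearParams d σ τθ δ C C₀ C₁ ω n τ a₂
      let ε' : ℝ := 2 * (n : ℝ) ^ (-δ)
      let γ' : ℝ := confidence C₁ ω n
      -- privacy, for every balanced partition and every profile of reporting strategies
      (ε' ≤ K * (n : ℝ) ^ (-δ) ∧ γ' ≤ K * (n : ℝ) ^ (-ρ) ∧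
        ∀ g : Finset (Fin n), IsBalanced g → ∀ strat : Fin n → Strategy d,
          IsRJDP (mechanism P m g) (m.noiseLaw d) (P.neighborLaw n)
            (fun z => reports strat z.1)
            (fun i z => reports strat (Function.update z.1 i z.2)) ε' γ') ∧
      -- an event of high probability for the parameter and the types of the agents
      ∃ G : Set (Vec d × (Fin n → AgentType d)), MeasurableSet G ∧
        1 - K * (n : ℝ) ^ (-ρ) ≤ (P.jointLaw n).real G ∧
        ∀ θ : Vec d, ∀ t : Fin n → AgentType d, (θ, t) ∈ G →
          -- the fraction of the agents that participate truthfully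
          (1 - K * (n : ℝ) ^ (-(3 * δ))) * n ≤
            ({i : Fin n | (t i).2 ≤ τ} : Set (Fin n)).ncard ∧
          ∀ strat : Fin n → Strategy d, (∀ i, IsThresholdStrategy τ (strat i)) →
            -- accuracy
            ∫ v, ‖privateEstimator m (reports strat t) v - θ‖ ^ 2 ∂(m.noiseLaw d) ≤
                K * (n : ℝ) ^ (-δ) * Real.log n ^ k ∧
            ∀ g : Finset (Fin n), IsBalanced g →
              -- approximate equilibrium and individual rationality
              (∀ i : Fin n, (t i).2 ≤ τ →
                IsApproxBestResponse P m g (f i (t i).2 ε' γ')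
                  (K * (n : ℝ) ^ (-(4 * δ)) * Real.log n ^ k) strat i (t i) ∧
                0 ≤ interimUtility P m g (f i (t i).2 ε' γ') strat i (t i)) ∧
              -- expected budget
              ∑ i : Fin n, ∫ v, payment P m g (reports strat t) v i ∂(m.noiseLaw d) ≤
                K * (n : ℝ) ^ (1 - 4 * δ) * Real.log n ^ k := by
  obtain ⟨hδ1, hδ2⟩ := hδ
  obtain ⟨l, c', hl, hc', hdes⟩ := Population.exists_design_concentration hd σ κ2 hκ2
  have hM := one_le_fourthMoment hd σ
  obtain ⟨B, hB⟩ : ∃ B, B = τθ * (C * σ) := ⟨_, rfl⟩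
  have hCσ : 0 < C * σ := by positivity
  have hB0 : 0 < B := hB ▸ mul_pos hτθ hCσ
  -- Constants for, in order: confidence level, failure probability of the good event, accuracy,
  -- equilibrium slack, payment per agent. They are kept opaque, and `K` dominates all of them.
  obtain ⟨K₁, hK₁⟩ : ∃ K, K = C₁ * (1 + 2 * 2 ^ ω) := ⟨_, rfl⟩
  obtain ⟨K₂, hK₂⟩ : ∃ K, K = 3 + 2 * d ^ 2 * s ^ 2 * fourthMoment σ d + |uβ| := ⟨_, rfl⟩
  obtain ⟨K₃, hK₃⟩ : ∃ K, K = 2 * ((1 + |uα| * (2 * (C * σ))) / l) ^ 2 +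
    2 * (8 * 2 ^ d * (C₀ ^ 2 * d)) := ⟨_, rfl⟩
  obtain ⟨K₄, hK₄⟩ : ∃ K, K = A * (4 * B ^ 2) := ⟨_, rfl⟩
  obtain ⟨K₅, hK₅⟩ : ∃ K, K = 2 * A * (B + 3 * B ^ 2) + 32 * ((c + 3) / lam) := ⟨_, rfl⟩
  have hK₁0 : 0 ≤ K₁ := by rw [hK₁]; positivity
  have hK₂0 : 0 ≤ K₂ := by rw [hK₂]; positivity
  have hK₃0 : 0 ≤ K₃ := by rw [hK₃]; positivity
  have hK₄0 : 0 ≤ K₄ := by rw [hK₄]; positivity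
  have hK₅0 : 0 ≤ K₅ := by rw [hK₅]; positivity
  have huα := abs_nonneg uα
  obtain ⟨K, hK2, hKK₁, hKK₂, hKα, hKK₃, hKK₄, hKK₅⟩ : ∃ K, 2 ≤ K ∧ K₁ ≤ K ∧ K₂ ≤ K ∧ |uα| ≤ K ∧
      K₃ ≤ K ∧ K₄ ≤ K ∧ K₅ ≤ K :=
    ⟨2 + K₁ + K₂ + |uα| + K₃ + K₄ + K₅, by linarith, by linarith, by linarith, by linarith,
      by linarith, by linarith, by linarith⟩
  -- The bounds by `c`, `ω` and `1/2` serve `β`, the confidence level and the Chebyshev term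
  -- respectively.
  obtain ⟨ρ, hρ0, hρc, hρω, hρh⟩ : ∃ ρ : ℝ, 0 < ρ ∧ ρ ≤ c ∧ ρ ≤ ω ∧ ρ ≤ 1 / 2 :=
    ⟨min (min c ω) (1 / 2), lt_min (lt_min hc hω) (by norm_num),
      (min_le_left _ _).trans (min_le_left _ _), (min_le_left _ _).trans (min_le_right _ _),
      min_le_right _ _⟩
  have hev := (eventually_isRJDP (δ := δ) hd hσ hκ2 hC₀ hC₁ hω τθ C).and <|
    (Filter.eventually_ge_atTop 2).and <| eventually_one_le_log.and <|
    (eventually_rpow_le K₁ (show -ω < 0 by linarith) one_pos).and <|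
    (eventually_exp_le (2 * d ^ 2) 1 hc' one_pos one_pos).and <|
    (eventually_rpow_le (2 * d) (show (-7 : ℝ) < -1 by norm_num) one_pos).and <|
    (eventually_exp_le 2 1 (show 0 < 1 / (2 * s ^ 2) by positivity)
      (show 0 < (1 - 3 * δ) / 2 by linarith) one_pos).and <|
    (eventually_sqrt_log_le B (show 0 < (1 - 3 * δ) / 2 by linarith) one_half_pos).and <|
    (eventually_rpow_le 1 (show (1 - 3 * δ) / 4 < (1 - 3 * δ) / 2 by linarith) one_half_pos).and <|
    (eventually_rpow_le 1 (show -(c + 2) < -c by linarith) hlβ).and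
    (eventually_rpow_le 1 (show -(c + 3) < -(3 * δ) by linarith) hlα)
  obtain ⟨N, hN⟩ := Filter.eventually_atTop.1 hev
  refine ⟨K, ρ, 1, N, by linarith, hρ0, ?_⟩
  intro n hNn P hP α hα β hβ a₂ ha₂ f hf τ m ε' γ'
  obtain ⟨hpriv, hn2, hlog2, hconf, hex1, hex2, hex3, hclip1, hclip2, hthr1, hthr2⟩ := hN n hNn
  clear hN hev
  rw [Real.rpow_zero, one_mul] at hconf
  rw [one_mul] at hclip2 hthr1 hthr2 hex1 hex2 hex3
  have hn0 : 0 < n := by omega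
  have hn : (0 : ℝ) < n := by exact_mod_cast hn0
  have hn1 : (1 : ℝ) ≤ n := by exact_mod_cast hn0
  have hlog : 1 ≤ Real.log n := hlog2.trans (Real.log_le_log (by positivity) (by linarith only [hn]))
  have hL0 : 0 < Real.log n := one_pos.trans_le hlog
  have hmono : ∀ {a b : ℝ}, a ≤ b → (n : ℝ) ^ a ≤ (n : ℝ) ^ b := fun h =>
    Real.rpow_le_rpow_of_exponent_le hn1 h
  have hγeq : γ' = K₁ * (n : ℝ) ^ (-ω) := by rw [hK₁]; exact confidence_eq C₁ ω hn0
  have hγ1 : γ' ≤ 1 := hγeq.trans_le hconf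
  have hγ0 : 0 ≤ γ' := by rw [hγeq]; positivity
  have hε0 : 0 < ε' := mul_pos two_pos (Real.rpow_pos_of_pos hn _)
  have hsd0 : 0 < P.noiseSd := by rw [← NNReal.coe_pos, hP.noise_sd]; exact hs
  have hα1 : α ≤ |uα| * (n : ℝ) ^ (-(3 * δ)) :=
    hα.2.trans (mul_le_mul_of_nonneg_right (le_abs_self _) (by positivity))
  have hβ1 : β ≤ |uβ| * (n : ℝ) ^ (-ρ) :=
    hβ.2.trans (mul_le_mul (le_abs_self _) (hmono (neg_le_neg hρc)) (by positivity) (abs_nonneg _))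
  have hτ0 : 0 ≤ τ := P.threshold_nonneg n α β
  obtain ⟨hτ1, hcount⟩ : τ ≤ (c + 3) / lam * Real.log n ∧ _ :=
    threshold_log_bounds P hsd0 hlam hc hP.cost_tail hlog hα.1 hβ.1 hthr1 hthr2
  have hclip0 : 0 < clipLevel δ n := Real.rpow_pos_of_pos hn _
  have hnoise : IsProbabilityMeasure (m.noiseLaw d) :=
    isProbabilityMeasure_noiseLaw hd m (Real.rpow_pos_of_pos hn _)
      (sensBound_pos hd hC₀ hclip0 hlog hn) (sensBound_pos hd hC₀ hclip0 hlog2 (by positivity))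
  have hpost : ∀ z, ‖P.posteriorMean z‖ ≤ m.τθ := P.norm_posteriorMean_le hsd0 hP.prior_bounded
  have hm2 : 0 ≤ m.a₂ := ha₂.1.le
  have hmτ : 0 ≤ m.τθ := hτθ.le
  obtain ⟨MA, hMAdef⟩ : ∃ M, M = boundMA C σ τθ n := ⟨_, rfl⟩
  have hMA : MA = B * √(Real.log n) := by rw [hMAdef, hB]; unfold boundMA; ring
  have hMA0 : 0 < MA := by rw [hMA]; positivity
  have hMAsq : MA ^ 2 = B ^ 2 * Real.log n := by rw [hMA, mul_pow, Real.sq_sqrt hL0.le]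
  have hMAle : MA + 3 * MA ^ 2 ≤ (B + 3 * B ^ 2) * Real.log n := by
    have hsqrt : √(Real.log n) ≤ Real.log n :=
      Real.sqrt_le_iff.2 ⟨hL0.le, by nlinarith only [hlog]⟩
    have := mul_le_mul_of_nonneg_left hsqrt hB0.le
    rw [hMAsq, hMA]
    linarith only [this]
  have hma₁ : m.a₁ = a₂ * (MA + 3 * MA ^ 2) + τ * costBound ε' γ' := by rw [hMAdef]; rfl
  have hma₂ : m.a₂ = a₂ := rfl
  have hcostB0 : 0 ≤ costBound ε' γ' := by unfold costBound; positivity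
  -- The factor `32` is `1 + γ' ≤ 2` times `2 ^ 4` from the doubled privacy parameter.
  have hcostB : costBound ε' γ' ≤ 32 * (n : ℝ) ^ (-(4 * δ)) := by
    have e4 : ε' ^ 4 = 16 * (n : ℝ) ^ (-(4 * δ)) := by
      change (2 * (n : ℝ) ^ (-δ)) ^ 4 = _
      rw [mul_pow, ← Real.rpow_natCast ((n : ℝ) ^ (-δ)), ← Real.rpow_mul hn.le,
        show -δ * ((4 : ℕ) : ℝ) = -(4 * δ) by push_cast; ring]
      norm_num
    have h0 : 0 < (n : ℝ) ^ (-(4 * δ)) := by positivity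
    have h1 := mul_le_mul_of_nonneg_right hγ1 h0.le
    unfold costBound
    rw [e4]
    linarith only [h1]
  have ha₂M : a₂ * (MA + 3 * MA ^ 2) ≤
      A * (n : ℝ) ^ (-(4 * δ)) * ((B + 3 * B ^ 2) * Real.log n) :=
    mul_le_mul ha₂.2 hMAle (by positivity) (by positivity)
  have hτF : τ * costBound ε' γ' ≤
      (c + 3) / lam * Real.log n * (32 * (n : ℝ) ^ (-(4 * δ))) :=
    mul_le_mul hτ1 hcostB hcostB0 (by positivity)
  refine ⟨⟨?_, ?_, fun g hg strat => hpriv P hP.covariate_subGaussian hP.covariance_two τ a₂ g hg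
    strat⟩, ?_⟩
  · exact mul_le_mul_of_nonneg_right hK2 (by positivity)
  · rw [hγeq]
    exact mul_le_mul hKK₁ (hmono (neg_le_neg hρω)) (by positivity) (by positivity)
  obtain ⟨E, hEm, hE, hEp⟩ :=
    hdes P hP.covariate_subGaussian hP.covariance_two n Finset.univ
  simp only [Finset.card_univ, Fintype.card_fin] at hE hEp
  -- The covariate level is `M_A / τθ`, which makes all predictions at most `M_A`; the residual
  -- level is the square root of the clipping level.
  refine ⟨goodEvent d n E τθ (C * σ * √(Real.log n)) ((n : ℝ) ^ ((1 - 3 * δ) / 4))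
    ((n : ℝ) ^ (1 - δ / 2)) α τ, measurableSet_goodEvent hEm _ _ _ _ _ _, ?_, ?_⟩
  · have he : 2 * (d : ℝ) ^ 2 * Real.exp (-c' * n) ≤ (n : ℝ) ^ (-1 : ℝ) := by
      rw [Real.rpow_one] at hex1
      refine le_trans ?_ hex1
      exact mul_le_mul_of_nonneg_right (le_mul_of_one_le_right (by positivity) hn1) (Real.exp_pos _).le
    refine le_trans ?_ (one_sub_le_jointLaw_goodEvent hd P hσ hC hP.noise_sd hn0 hlog hδ2 hρh
      hP.covariate_subGaussian hP.prior_bounded hP.cost_nonneg hEm hEp he hβ1 hex2 hex3 hcount)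
    rw [← hK₂]
    have := mul_le_mul_of_nonneg_right hKK₂ (Real.rpow_nonneg hn.le (-ρ))
    linarith only [this]
  intro θ t hG
  have hxB : ∀ i, ‖(t i).1.1‖ * m.τθ ≤ MA := fun i => by
    have h1 := mul_le_mul_of_nonneg_right (hG.1.2.2.1 i).le hτθ.le
    refine h1.trans_eq ?_
    rw [hMA, hB]
    ring
  refine ⟨?_, fun strat hstrat => ⟨?_, fun g hg => ⟨fun i hi => ?_, ?_⟩⟩⟩
  · refine le_trans (mul_le_mul_of_nonneg_right ?_ hn.le) hG.2
    have := mul_le_mul_of_nonneg_right hKα (Real.rpow_nonneg hn.le (-(3 * δ)))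
    linarith only [this, hα1]
  -- Each summand is eventually at most half the clipping level, whose exponent is positive because
  -- `δ < 1/3`; so no true response is clipped.
  · have hclip : τθ * (C * σ * √(Real.log n)) + (n : ℝ) ^ ((1 - 3 * δ) / 4) ≤ clipLevel δ n := by
      rw [← mul_assoc, ← hB]
      unfold clipLevel
      linarith only [hclip1, hclip2]
    refine (integral_privateEstimator_le_of_goodEvent hd hn0 hlog2 hδ1 hl hC₀ hCσ hτθ.le huα hα1
      hclip hE hG hstrat).trans ?_
    rw [← hK₃, pow_one, mul_assoc]
    exact mul_le_mul_of_nonneg_right hKK₃ (by positivity)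
  · have hbel : IsProbabilityMeasure (P.belief n (t i).1) :=
      P.isProbabilityMeasure_belief hsd0 n (t i).1
    constructor
    · refine isApproxBestResponse_of_bound P m g _ strat (fun j => (hstrat j).1) i (t i) hmτ hm2
        hpost (hxB i) ?_
      rw [hma₂, hMAsq, pow_one]
      calc a₂ * (4 * (B ^ 2 * Real.log n))
          ≤ A * (n : ℝ) ^ (-(4 * δ)) * (4 * (B ^ 2 * Real.log n)) :=
            mul_le_mul_of_nonneg_right ha₂.2 (by positivity)
        _ = K₄ * ((n : ℝ) ^ (-(4 * δ)) * Real.log n) := by rw [hK₄]; ring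
        _ ≤ K * ((n : ℝ) ^ (-(4 * δ)) * Real.log n) :=
            mul_le_mul_of_nonneg_right hKK₄ (by positivity)
        _ = _ := by ring
    · refine interimUtility_nonneg P m g _ strat (fun j => (hstrat j).1) i (t i) hmτ hm2
        hpost (hxB i) ?_
      rw [hma₁, hma₂]
      -- The cost is nonnegative on the good event and at most `τ` for a participant, so the second
      -- term of `a₁` covers the privacy cost.
      have h1 := hf i (t i).2 ε' γ' (hG.1.2.2.2.2.1 i) hε0 hγ0
      have h2 : (t i).2 * costBound ε' γ' ≤ τ * costBound ε' γ' :=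
        mul_le_mul_of_nonneg_right hi hcostB0
      linarith only [h1, h2]
  · have ha₁0 : 0 ≤ m.a₁ := by
      rw [hma₁]
      have := ha₂.1
      positivity
    have hone : ∀ i : Fin n, ∫ v, payment P m g (reports strat t) v i ∂(m.noiseLaw d) ≤
        K * ((n : ℝ) ^ (-(4 * δ)) * Real.log n) := by
      intro i
      refine (integral_payment_le P m g (reports strat t) i hmτ hm2 hpost (hxB i) ha₁0).trans ?_
      rw [hma₁, hma₂]
      have : K₅ * ((n : ℝ) ^ (-(4 * δ)) * Real.log n) ≤
          K * ((n : ℝ) ^ (-(4 * δ)) * Real.log n) :=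
        mul_le_mul_of_nonneg_right hKK₅ (by positivity)
      rw [hK₅] at this
      linarith only [this, ha₂M, hτF]
    refine (Finset.sum_le_sum fun i _ => hone i).trans (le_of_eq ?_)
    rw [Finset.sum_const, Finset.card_univ, Fintype.card_fin, nsmul_eq_mul, pow_one,
      sub_eq_add_neg, Real.rpow_add hn, Real.rpow_one]
    ring
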